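/- Let $(X,g)$ be a closed Riemannian $n$-manifold with volume $dv_g$, let $E,F\to X$ be smooth real vector bundles with smooth fibre metrics and smooth connections $\nabla$, let $\sigma_D:T^*X\to\mathrm{Hom}(E,F)$ and $A:E\to F$ be smooth bundle maps, and let $D=\sigma_D\circ\nabla$, i.e. $D\xi=\sum_i\sigma_D(e^i)\nabla_{e_i}\xi$. A pair $(\sigma,A)$ is *concentrating* if $A^*\sigma(u)=\sigma(u)^*A$ for every covector $u$. The singular set of $A$ is $Z_A=\{x:\ker A_x\ne0\}$. For a family $P_s:\Gamma(E')\to\Gamma(F')$ ($s\in\mathbb R$) of operators between the smooth sections of subbundles $E'\subseteq E$, $F'\subseteq F$, we say that *low eigensections of $P_s$ concentrate along $Z\subseteq X$* if for all $\delta>0$ and $C\ge0$ there is a constant $C'>0$ such that, for all $s\neq0$ and all $\xi\in\Gamma(E')$ with $\|\xi\|_{L^2}=1$ which satisfy $\|P_s\xi\|_{L^2}^2\le C|s|$ or $P_s^*P_s\xi=\lambda\xi$ with $|\lambda|\le C|s|$, $$\int_{X\setminus Z(\delta)}|\xi|^2\,dv_g<\frac{C'}{|s|},$$ where $Z(\delta)$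 is the $\delta$-neighbourhood of $Z$ and $P_s^*$ is the formal $L^2$ adjoint. **(1) Restriction by an involution.** Let $T=\mathrm{diag}(\tau,\hat\tau)$ be a smooth, metric-preserving bundle involution of $E\oplus F$ with $\nabla T=0$ and $\sigma_D(v)\tau=\varepsilon\hat\tau\sigma_D(v)$ for all covectors $v$, where $\varepsilon\in\{1,-1\}$ is fixed. Let $E^\pm$, $F^\pm$ be the $\pm1$ eigenbundles of $\tau$, $\hat\tau$, let $p^+=\frac12(1+\tau)$ and $\hat p^\varepsilon=\frac12(1+\varepsilon\hat\tau)$, and put $D^+=\sigma_D\circ p^+\nabla|_{E^+}$ and $A^+=\hat p^\varepsilon A|_{E^+}$. Suppose that $(\sigma_D,A)$ is a concentrating pair. Then $D^+$ is a first order operator $\Gamma(E^+)\to\Gamma(F^\varepsilon)$ with symbol $\sigma_{D^+}(u)=\sigma_D(u)|_{E^+}:E^+\to F^\varepsilon$, it is the restriction of $D$, and $\sigma_{D^+}(u)$ is bijective whenever $\sigma_D(u)$ is. The pair $(\sigma_{D^+},A^+)$ is concentrating, and low eigensections of $D^+_s=D^++sA^+:\Gamma(E^+)\to\Gamma(F^\varepsilon)$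 concentrate along $Z_{A^+}$. **Spinor-form pairs.** In (2) and (3), suppose that there are a field of finite-dimensional Hermitian Clifford modules $W_x$ over $T^*_xX$ (so that $c(u)c(v)+c(v)c(u)=-2\langle u,v\rangle$ and $c(v)^*=-c(v)$) and a field of spinors $\psi_x\in W_x$, and that both $E$ and $F$ are fibrewise isometrically identified with $W\oplus\Lambda^*_{\mathbb C}T^*X$ in such a way that $\sigma_D(v)=c(v)\oplus(v\wedge\cdot-\iota_v)$ and $A(\varphi,\alpha)=(P_\psi\alpha,-P_\psi^*\varphi)$. Here $P_\psi\alpha=c(\alpha)\psi$, where $c(e^{j_1}\wedge\cdots\wedge e^{j_p})=c(e^{j_1})\cdots c(e^{j_p})$ for $j_1<\dots<j_p$ in an oriented orthonormal frame; the orientation of each tangent space is part of the data. No continuity in $x$ of these identifications is required beyond the smoothness of $\sigma_D$, $A$ and of the involutions below, which are assumed to be smooth bundle maps. **(2) Parity.** If $n=2m$ and $i^mc(d\mathrm{vol})\psi=\psi$, let $\tau=\hat\tau=i^mc(d\mathrm{vol})\oplus(-1)^{p+1}$, with $(-1)^{p+1}$ acting on $p$-forms. Then $\tau$ and $\hat\tau$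 are metric-preserving involutions, $\sigma_D(v)\tau=-\hat\tau\sigma_D(v)$, $A$ maps $E^+=W^+\oplus\Lambda^{odd}_{\mathbb C}$ to $F^-=W^-\oplus\Lambda^{ev}_{\mathbb C}$, and for $D^+$, $A^+$ defined as in (1) with $\varepsilon=-1$, $D^+:\Gamma(E^+)\to\Gamma(F^-)$ is a first order operator with symbol $\sigma_{D^+}=\sigma_D|_{E^+}$, $(\sigma_{D^+},A^+)$ is a concentrating pair, and low eigensections of $D^++sA^+$ concentrate along $Z_{A^+}$. **(3) Self-duality.** If $n=4m$ and $i^{2m}c(d\mathrm{vol})\psi=\psi$, let $\tau,\hat\tau$ be the parity involutions as in (2) (with $2m$ in place of $m$). Let $T(\varphi,\alpha)=(\varphi,T\alpha)$ on $W\oplus\Lambda^*_{\mathbb C}T^*X$, where $T$ is the identity on $p$-forms with $p<2m$, the Hodge star on $2m$-forms, and minus the identity on $p$-forms with $p>2m$; write $T_E$, $T_F$ for the corresponding endomorphisms of $E$ and $F$. Then $T_E,T_F$ are metric-preserving involutions. Let $E^{++}=E^+\cap\ker(T_E-1)=W^+\oplus\bigoplus_{p=1}^m\Lambda^{2p-1}_{\mathbb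 C}$ and $F^{-+}=F^-\cap\ker(T_F-1)=W^-\oplus\Lambda^{2m,+}_{\mathbb C}\oplus\bigoplus_{p=0}^{m-1}\Lambda^{2p}_{\mathbb C}$, and set $p_T=\frac12(1+T_E)$, $\hat p_T=\frac12(1+T_F)$, $D^{++}=\hat p_T\sigma_D\circ p_Tp^+\nabla|_{E^{++}}$, $A^{++}=\hat p_T\hat p^-A|_{E^{++}}$. Then $D^{++}:\Gamma(E^{++})\to\Gamma(F^{-+})$ is a first order operator with symbol $\sigma_{D^{++}}=\hat p_T\sigma_D|_{E^{++}}$, $(\sigma_{D^{++}},A^{++})$ is a concentrating pair, and low eigensections of $D^{++}+sA^{++}$ concentrate along $Z_{A^{++}}$. -/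

import Mathlib

open Bundle Manifold ContDiff MeasureTheory
open scoped InnerProductSpace

noncomputable section

/-! ### The Riemannian volume measure -/

section Volume

variable {n : ℕ} {M : Type*} [TopologicalSpace M] [ChartedSpace (EuclideanSpace ℝ (Fin n)) M]
  [IsManifold (𝓡 n) ∞ M] [RiemannianBundle (fun x : M => TangentSpace (𝓡 n) x)]

/-- The `i`-th coordinate vector field `∂_i` of the preferred chart at `x₀`, at the point `p`; that
is, the derivative of the inverse chart in the direction of the `i`-th basis vector. -/
def coordVector (x₀ : M) (i : Fin n) (p : M) : TangentSpace (𝓡 n) p :=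
  (trivializationAt (EuclideanSpace ℝ (Fin n)) (fun x : M => TangentSpace (𝓡 n) x) x₀).symm p
    (EuclideanSpace.single i (1 : ℝ))

/-- The Gram matrix `g_{ij} = ⟨∂_i, ∂_j⟩` of the metric in the preferred chart at `x₀`, at the
point `p` of the domain of that chart. -/
def chartGram (x₀ : M) (p : M) : Matrix (Fin n) (Fin n) ℝ :=
  Matrix.of fun i j => ⟪coordVector x₀ i p, coordVector x₀ j p⟫_ℝ

/-- The measure `√(det g_{ij}) dy` of the preferred chart at `x₀`, as a measure on `M` carried by
the domain of that chart. -/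
def chartVolume [MeasurableSpace M] (x₀ : M) : Measure M :=
  ((volume.restrict (extChartAt (𝓡 n) x₀).target).withDensity
    (fun y => ENNReal.ofReal
      (Real.sqrt (chartGram (n := n) x₀ ((extChartAt (𝓡 n) x₀).symm y)).det))).map
    (extChartAt (𝓡 n) x₀).symm

variable (n M) in
/-- The Riemannian volume measure. By the change of variables formula the measures `chartVolume x₀`
agree on overlaps of charts, so that their supremum is the measure which on the domain of
each chart is `√(det g_{ij}) dy`. -/
def riemannianVolume [MeasurableSpace M] : Measure M :=
  ⨆ x₀ : M, chartVolume (n := n) x₀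

end Volume

/-! ### Concentrating pairs -/

section Pairs

variable {n : ℕ} {M : Type*} [TopologicalSpace M] [ChartedSpace (EuclideanSpace ℝ (Fin n)) M]

/-- The cotangent space at `x`. -/
abbrev Cotangent (n : ℕ) {M : Type*} [TopologicalSpace M]
    [ChartedSpace (EuclideanSpace ℝ (Fin n)) M] (x : M) : Type :=
  TangentSpace (𝓡 n) x →L[ℝ] ℝ

section Fibres

variable {E F : M → Type*} [∀ x, NormedAddCommGroup (E x)] [∀ x, InnerProductSpace ℝ (E x)]
  [∀ x, FiniteDimensional ℝ (E x)]
  [∀ x, NormedAddCommGroup (F x)] [∀ x, InnerProductSpace ℝ (F x)]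
  [∀ x, FiniteDimensional ℝ (F x)]

/-- `(σ, A)` is a concentrating pair: `A* ∘ σ(u) = σ(u)* ∘ A` for every covector `u`. -/
def IsConcentratingPair (σ : ∀ x : M, Cotangent n x → (E x →ₗ[ℝ] F x))
    (A : ∀ x : M, E x →ₗ[ℝ] F x) : Prop :=
  ∀ (x : M) (u : Cotangent n x),
    LinearMap.adjoint (A x) ∘ₗ σ x u = LinearMap.adjoint (σ x u) ∘ₗ A x

end Fibres

/-- The singular set `Z_A`, the set of points at which `A` fails to be injective. -/
def singularSet {E F : M → Type*} [∀ x, AddCommGroup (E x)] [∀ x, Module ℝ (E x)]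
    [∀ x, AddCommGroup (F x)] [∀ x, Module ℝ (F x)] (A : ∀ x : M, E x →ₗ[ℝ] F x) : Set M :=
  {x | LinearMap.ker (A x) ≠ ⊥}

end Pairs

/-! ### Smooth bundle maps, Dirac operators and involutions -/

section Bundles

variable {n : ℕ} {M : Type*} [TopologicalSpace M] [ChartedSpace (EuclideanSpace ℝ (Fin n)) M]
  {FE : Type*} [NormedAddCommGroup FE] [NormedSpace ℝ FE]
  {FF : Type*} [NormedAddCommGroup FF] [NormedSpace ℝ FF]
  {E : M → Type*} [TopologicalSpace (TotalSpace FE E)]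
  [∀ x, NormedAddCommGroup (E x)] [∀ x, InnerProductSpace ℝ (E x)]
  [FiberBundle FE E] [VectorBundle ℝ FE E]
  {F : M → Type*} [TopologicalSpace (TotalSpace FF F)]
  [∀ x, NormedAddCommGroup (F x)] [∀ x, InnerProductSpace ℝ (F x)]
  [FiberBundle FF F] [VectorBundle ℝ FF F]

variable (n FE) in
/-- The smooth sections of `E` with values in the family of subspaces `E'`. If `E'` is a subbundle,
these are the smooth sections of `E'`. -/
def sectionsIn (E' : ∀ x, Submodule ℝ (E x)) : Set (∀ x, E x) :=
  {ξ | ContMDiff (𝓡 n) ((𝓡 n).prod 𝓘(ℝ, FE)) ∞ (fun x => TotalSpace.mk' FE x (ξ x)) ∧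
    ∀ x, ξ x ∈ E' x}

variable (n FE FF) in
/-- `A : E → F` is a smooth bundle map. -/
def IsSmoothHom (A : ∀ x : M, E x →L[ℝ] F x) : Prop :=
  ContMDiff (𝓡 n) ((𝓡 n).prod 𝓘(ℝ, FE →L[ℝ] FF)) ∞
    (fun x => TotalSpace.mk' (FE →L[ℝ] FF) (E := fun x => E x →L[ℝ] F x) x (A x))

variable [IsManifold (𝓡 n) ∞ M]

variable (FE FF) in
/-- `σ : T*M → Hom(E, F)` is a smooth bundle map. -/
def IsSmoothSymbol (σ : ∀ x : M, Cotangent n x →L[ℝ] (E x →L[ℝ] F x)) : Prop :=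
  ContMDiff (𝓡 n)
    ((𝓡 n).prod 𝓘(ℝ, (EuclideanSpace ℝ (Fin n) →L[ℝ] ℝ) →L[ℝ] (FE →L[ℝ] FF))) ∞
    (fun x => TotalSpace.mk' ((EuclideanSpace ℝ (Fin n) →L[ℝ] ℝ) →L[ℝ] (FE →L[ℝ] FF))
      (E := fun x => (TangentSpace (𝓡 n) x →L[ℝ] Bundle.Trivial M ℝ x) →L[ℝ] (E x →L[ℝ] F x))
      x (σ x))

/-- The operator `σ ∘ p ∇`, i.e. `ξ ↦ ∑ᵢ σ(eⁱ) (p (∇_{eᵢ} ξ))` for a (equivalently any) basis `eᵢ` of the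
tangent space with dual basis `eⁱ`, where `p` is an endomorphism of `E`. -/
def diracOp (nabla : CovariantDerivative (𝓡 n) FE E)
    (σ : ∀ x : M, Cotangent n x →L[ℝ] (E x →L[ℝ] F x)) (p : ∀ x : M, E x →L[ℝ] E x)
    (ξ : ∀ x, E x) (x : M) : F x :=
  ∑ i : Fin n,
    let e : TangentSpace (𝓡 n) x := EuclideanSpace.single i (1 : ℝ)
    let e' : Cotangent n x := (EuclideanSpace.proj i : EuclideanSpace ℝ (Fin n) →L[ℝ] ℝ)
    σ x e' (p x (nabla ξ x e))

/-- `τ` is a smooth metric-preserving bundle involution of `E`. -/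
structure IsMetricInvolution (n : ℕ) {M : Type*} [TopologicalSpace M]
    [ChartedSpace (EuclideanSpace ℝ (Fin n)) M] (FE : Type*) [NormedAddCommGroup FE]
    [NormedSpace ℝ FE] {E : M → Type*} [TopologicalSpace (TotalSpace FE E)]
    [∀ x, NormedAddCommGroup (E x)] [∀ x, InnerProductSpace ℝ (E x)]
    [FiberBundle FE E] [VectorBundle ℝ FE E] (τ : ∀ x : M, E x →L[ℝ] E x) : Prop where
  smooth : IsSmoothHom n FE FE τ
  involutive : ∀ x e, τ x (τ x e) = e
  isometry : ∀ x e e', ⟪τ x e, τ x e'⟫_ℝ = ⟪e, e'⟫_ℝ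

/-- The bundle endomorphism `τ` is parallel: `∇ (τ ξ) = τ (∇ ξ)` for smooth sections `ξ`. -/
def IsParallel (nabla : CovariantDerivative (𝓡 n) FE E) (τ : ∀ x : M, E x →L[ℝ] E x) : Prop :=
  ∀ ξ : (∀ x, E x),
    ContMDiff (𝓡 n) ((𝓡 n).prod 𝓘(ℝ, FE)) ∞ (fun x => TotalSpace.mk' FE x (ξ x)) →
    ∀ (x : M) (v : TangentSpace (𝓡 n) x),
      nabla (fun y => τ y (ξ y)) x v = τ x (nabla ξ x v)

/-- The eigenspaces of `τ` for the eigenvalue `ε = ±1`. -/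
def eigenbundle (τ : ∀ x : M, E x →L[ℝ] E x) (ε : ℝ) (x : M) : Submodule ℝ (E x) :=
  Module.End.eigenspace (τ x : E x →ₗ[ℝ] E x) ε

/-- The projection `½ (1 + ε τ)` onto the eigenspaces of `τ` for the eigenvalue `ε = ±1`. -/
def eigenproj (τ : ∀ x : M, E x →L[ℝ] E x) (ε : ℝ) (x : M) : E x →L[ℝ] E x :=
  (1 / 2 : ℝ) • (ContinuousLinearMap.id ℝ (E x) + ε • τ x)

end Bundles

/-! ### Concentration of low eigensections -/

section Concentration

variable {n : ℕ} {M : Type*} [EMetricSpace M] [ChartedSpace (EuclideanSpace ℝ (Fin n)) M]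
  [IsManifold (𝓡 n) ∞ M] [MeasurableSpace M]
  [RiemannianBundle (fun x : M => TangentSpace (𝓡 n) x)]
  {FE : Type*} [NormedAddCommGroup FE] [NormedSpace ℝ FE]
  {FF : Type*} [NormedAddCommGroup FF] [NormedSpace ℝ FF]
  {E : M → Type*} [TopologicalSpace (TotalSpace FE E)]
  [∀ x, NormedAddCommGroup (E x)] [∀ x, InnerProductSpace ℝ (E x)]
  [FiberBundle FE E] [VectorBundle ℝ FE E]
  {F : M → Type*} [TopologicalSpace (TotalSpace FF F)]
  [∀ x, NormedAddCommGroup (F x)] [∀ x, InnerProductSpace ℝ (F x)]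
  [FiberBundle FF F] [VectorBundle ℝ FF F]

variable (n) in
/-- `P* η = ζ`, where `P*` is the formal `L²` adjoint of the operator `P` whose domain is the
space `Γ` of sections. -/
def FormalAdjointEq {E F : M → Type*}
    [∀ x, NormedAddCommGroup (E x)] [∀ x, InnerProductSpace ℝ (E x)]
    [∀ x, NormedAddCommGroup (F x)] [∀ x, InnerProductSpace ℝ (F x)]
    (Γ : Set (∀ x, E x)) (P : (∀ x, E x) → ∀ x, F x)
    (η : ∀ x, F x) (ζ : ∀ x, E x) : Prop :=
  ∀ θ ∈ Γ, ∫ x, ⟪P θ x, η x⟫_ℝ ∂(riemannianVolume n M) = ∫ x, ⟪θ x, ζ x⟫_ℝ ∂(riemannianVolume n M)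

variable (n) in
/-- The low eigensections of the family `P s` of operators on the space `Γ` of sections concentrate
along `Z`: for `δ > 0` and `C ≥ 0` there is a constant `C'` such that every `ξ ∈ Γ` with
`‖ξ‖₂ = 1` which satisfies `‖P_s ξ‖₂² ≤ C |s|`, or solves `P_s* P_s ξ = lam ξ` with
`|lam| ≤ C |s|`, satisfies `∫ |ξ|² < C' / |s|` over the complement of the `δ`-neighbourhood
of `Z`. -/
def ConcentratesAlong {E F : M → Type*}
    [∀ x, NormedAddCommGroup (E x)] [∀ x, InnerProductSpace ℝ (E x)]
    [∀ x, NormedAddCommGroup (F x)] [∀ x, InnerProductSpace ℝ (F x)]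
    (Γ : Set (∀ x, E x)) (P : ℝ → (∀ x, E x) → ∀ x, F x) (Z : Set M) : Prop :=
  ∀ δ : ℝ, 0 < δ → ∀ C : ℝ, 0 ≤ C → ∃ C' : ℝ, 0 < C' ∧
    ∀ s : ℝ, s ≠ 0 → ∀ ξ ∈ Γ, ∫ x, ‖ξ x‖ ^ 2 ∂(riemannianVolume n M) = 1 →
      (∫ x, ‖P s ξ x‖ ^ 2 ∂(riemannianVolume n M) ≤ C * |s| ∨
        ∃ lam : ℝ, |lam| ≤ C * |s| ∧
          FormalAdjointEq n Γ (P s) (P s ξ) (fun x => lam • ξ x)) →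
      ∫ x in (Metric.thickening δ Z)ᶜ, ‖ξ x‖ ^ 2 ∂(riemannianVolume n M) < C' / |s|

variable (FE FF) in
/-- Let `E' ⊆ E` and `F' ⊆ F` be subbundles, `D' : Γ(E') → Γ(F')` an operator,
`σ'(u)` a family of maps and `A'` a bundle map. The statement that `D'` is a first order operator
from `Γ(E')` to `Γ(F')` with symbol `σ'|_{E'} : T*M → Hom(E', F')`, that
`(σ'|_{E'}, A'|_{E'})` is a concentrating pair for `E'` and `F'`, and that the low eigensections of
`D' + s A' : Γ(E') → Γ(F')` concentrate along the singular set of `A'|_{E'} : E' → F'`. -/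
def IsConcentratingRestriction [∀ x, FiniteDimensional ℝ (E x)] [∀ x, FiniteDimensional ℝ (F x)]
    (E' : ∀ x, Submodule ℝ (E x)) (F' : ∀ x, Submodule ℝ (F x))
    (D' : (∀ x, E x) → ∀ x, F x)
    (σ' : ∀ x : M, Cotangent n x → (E x →L[ℝ] F x)) (A' : ∀ x : M, E x →L[ℝ] F x) : Prop :=
  ∃ (hσ : ∀ x u, ∀ e ∈ E' x, (σ' x u : E x →ₗ[ℝ] F x) e ∈ F' x)
    (hA : ∀ x, ∀ e ∈ E' x, (A' x : E x →ₗ[ℝ] F x) e ∈ F' x),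
    (∀ ξ ∈ sectionsIn n FE E', D' ξ ∈ sectionsIn n FF F') ∧
    (∀ ξ ∈ sectionsIn n FE E', ∀ f : M → ℝ, ContMDiff (𝓡 n) 𝓘(ℝ) ∞ f → ∀ x,
      D' (fun y => f y • ξ y) x = σ' x (mvfderiv (𝓡 n) f x) (ξ x) + f x • D' ξ x) ∧
    IsConcentratingPair (E := fun x => E' x) (F := fun x => F' x)
      (fun x u => (σ' x u : E x →ₗ[ℝ] F x).restrict (hσ x u))
      (fun x => (A' x : E x →ₗ[ℝ] F x).restrict (hA x)) ∧
    ConcentratesAlong n (sectionsIn n FE E') (fun s ξ x => D' ξ x + s • A' x (ξ x))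
      (singularSet (E := fun x => E' x) (F := fun x => F' x)
        (fun x => (A' x : E x →ₗ[ℝ] F x).restrict (hA x)))

end Concentration

/-! ### Spinor-form pairs at a point -/

section SpinorForm

/-- The complex exterior algebra `Λ*_ℂ ℝⁿ` with its Hermitian metric, in coordinates with respect to
the orthonormal basis `e_S = e_{j₁} ∧ ⋯ ∧ e_{j_p}`, `S = {j₁ < ⋯ < j_p}`. -/
abbrev Form (n : ℕ) : Type := EuclideanSpace ℂ (Finset (Fin n))

/-- The sign with `e_S ∧ e_R = shuffleSign S R • e_{S ∪ R}` for disjoint `S` and `R`. -/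
def shuffleSign {n : ℕ} (S R : Finset (Fin n)) : ℂ :=
  (-1) ^ ((S ×ˢ R).filter fun a => a.2 < a.1).card

/-- The exterior product `v ∧ α` of a vector and a form. -/
def extMul {n : ℕ} (v : EuclideanSpace ℝ (Fin n)) : Form n →ₗ[ℂ] Form n where
  toFun α := WithLp.toLp 2 fun S =>
    ∑ j ∈ S, shuffleSign {j} (S.erase j) * (v j : ℂ) * α (S.erase j)
  map_add' α β := by
    ext S
    simp [mul_add, Finset.sum_add_distrib]
  map_smul' a α := by
    ext S
    simp [Finset.mul_sum, mul_left_comm]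

/-- The interior product `ι_v α` of a vector and a form. -/
def intMul {n : ℕ} (v : EuclideanSpace ℝ (Fin n)) : Form n →ₗ[ℂ] Form n where
  toFun α := WithLp.toLp 2 fun S =>
    ∑ j ∈ Sᶜ, shuffleSign {j} S * (v j : ℂ) * α (insert j S)
  map_add' α β := by
    ext S
    simp [mul_add, Finset.sum_add_distrib]
  map_smul' a α := by
    ext S
    simp [Finset.mul_sum, mul_left_comm]

/-- The symbol `v ∧ · - ι_v` of `d + d*`. -/
def formClifford {n : ℕ} (v : EuclideanSpace ℝ (Fin n)) : Form n →ₗ[ℂ] Form n :=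
  extMul v - intMul v

/-- The operator `(-1)^{p+1}` on `p`-forms. -/
def formParity (n : ℕ) : Form n →ₗ[ℂ] Form n where
  toFun α := WithLp.toLp 2 fun S => (-1) ^ (S.card + 1) * α S
  map_add' α β := by
    ext S
    simp [mul_add]
  map_smul' a α := by
    ext S
    simp [mul_left_comm]

/-- The Hodge star operator, `⋆ e_R = shuffleSign R Rᶜ • e_{Rᶜ}`. -/
def hodgeStar (n : ℕ) : Form n →ₗ[ℂ] Form n where
  toFun α := WithLp.toLp 2 fun S => shuffleSign Sᶜ S * α Sᶜ
  map_add' α β := by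
    ext S
    simp [mul_add]
  map_smul' a α := by
    ext S
    simp [mul_left_comm]

/-- For `k = n / 2`: the operator which is the identity on `p`-forms with `p < k`, the
Hodge star on `k`-forms, and minus the identity on `p`-forms with `k < p`. -/
def formSelfDuality (n k : ℕ) : Form n →ₗ[ℂ] Form n where
  toFun α := WithLp.toLp 2 fun S =>
    if S.card < k then α S else if S.card = k then hodgeStar n α S else -α S
  map_add' α β := by
    ext S
    simp only [map_add, PiLp.add_apply]
    split_ifs <;> ring
  map_smul' a α := by
    ext S
    simp only [map_smul, PiLp.smul_apply, smul_eq_mul, RingHom.id_apply]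
    split_ifs <;> ring

/-- A Hermitian Clifford module structure on `W`: Clifford multiplication is complex linear and
satisfies `c(u)c(v) + c(v)c(u) = -2⟨u, v⟩`, and `c(v)* = -c(v)`. -/
structure CliffordAction (n : ℕ) (W : Type*) [NormedAddCommGroup W] [InnerProductSpace ℂ W] where
  c : EuclideanSpace ℝ (Fin n) →ₗ[ℝ] (W →ₗ[ℂ] W)
  clifford : ∀ u v φ, c u (c v φ) + c v (c u φ) = ((-2 * ⟪u, v⟫_ℝ : ℝ) : ℂ) • φ
  skew : ∀ v φ φ', ⟪c v φ, φ'⟫_ℂ = -⟪φ, c v φ'⟫_ℂ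

namespace CliffordAction

variable {n : ℕ} {W : Type*} [NormedAddCommGroup W] [InnerProductSpace ℂ W]

/-- `c(e_S) = c(e_{j₁}) ⋯ c(e_{j_p})` for `S = {j₁ < ⋯ < j_p}`. -/
def basisForm (κ : CliffordAction n W) (S : Finset (Fin n)) : W →ₗ[ℂ] W :=
  ((S.sort (· ≤ ·)).map fun j => (κ.c (EuclideanSpace.single j (1 : ℝ)) : Module.End ℂ W)).prod

/-- The map `P_ψ : Λ*_ℂ → W`, `α ↦ c(α) ψ`. -/
def formToSpinor (κ : CliffordAction n W) (ψ : W) : Form n →ₗ[ℂ] W where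
  toFun α := ∑ S, α S • κ.basisForm S ψ
  map_add' α β := by simp [add_smul, Finset.sum_add_distrib]
  map_smul' a α := by simp [mul_smul, Finset.smul_sum]

/-- The chirality operator `i^m c(dvol)`. -/
def chirality (κ : CliffordAction n W) (m : ℕ) : W →ₗ[ℂ] W :=
  Complex.I ^ m • κ.basisForm Finset.univ

/-- The symbol `c(v) ⊕ (v ∧ · - ι_v)` of `D_A ⊕ (d + d*)` on spinor-form pairs. -/
def pairSymbol (κ : CliffordAction n W) (v : EuclideanSpace ℝ (Fin n))
    (w : WithLp 2 (W × Form n)) : WithLp 2 (W × Form n) :=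
  WithLp.toLp 2 (κ.c v w.fst, formClifford v w.snd)

/-- The perturbation `A_ψ (φ, α) = (P_ψ α, -P_ψ* φ)`. -/
def pairPerturbation [FiniteDimensional ℂ W] (κ : CliffordAction n W) (ψ : W)
    (w : WithLp 2 (W × Form n)) : WithLp 2 (W × Form n) :=
  WithLp.toLp 2
    (κ.formToSpinor ψ w.snd, -(LinearMap.adjoint (κ.formToSpinor ψ) w.fst))

/-- The parity involution `i^m c(dvol) ⊕ (-1)^{p+1}`, in dimension `n = 2m`. -/
def pairParity (κ : CliffordAction n W) (m : ℕ)
    (w : WithLp 2 (W × Form n)) : WithLp 2 (W × Form n) :=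
  WithLp.toLp 2 (κ.chirality m w.fst, formParity n w.snd)

end CliffordAction

/-- The self-duality involution of spinor-form pairs, with `k = n / 2`. -/
def pairSelfDuality {n : ℕ} {W : Type*} [NormedAddCommGroup W] [InnerProductSpace ℂ W] (k : ℕ)
    (w : WithLp 2 (W × Form n)) : WithLp 2 (W × Form n) :=
  WithLp.toLp 2 (w.fst, formSelfDuality n k w.snd)

variable {n : ℕ} {M : Type*} [TopologicalSpace M] [ChartedSpace (EuclideanSpace ℝ (Fin n)) M]
  [RiemannianBundle (fun x : M => TangentSpace (𝓡 n) x)]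

/-- The coordinates `u(e_1), …, u(e_n)` of a covector with respect to an orthonormal frame. -/
def frameCoord {x : M} (b : TangentSpace (𝓡 n) x ≃ₗᵢ[ℝ] EuclideanSpace ℝ (Fin n))
    (u : Cotangent n x) : EuclideanSpace ℝ (Fin n) :=
  WithLp.toLp 2 fun i => u (b.symm (EuclideanSpace.single i (1 : ℝ)))

/-- Fibrewise isometric identifications of `E` and `F` with the spinor-form bundle `W ⊕ Λ*_ℂ T*M` of
a Hermitian bundle `W` of Clifford modules, under which `σ` becomes the symbol of
`D_A ⊕ (d + d*)` and `A` becomes `A_ψ`. The fibres of `Λ*_ℂ T*M` are written in orthonormal frames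
of the tangent spaces. -/
structure SpinorFormBundle (E F : M → Type*)
    [∀ x, NormedAddCommGroup (E x)] [∀ x, InnerProductSpace ℝ (E x)]
    [∀ x, NormedAddCommGroup (F x)] [∀ x, InnerProductSpace ℝ (F x)]
    (σ : ∀ x : M, Cotangent n x → (E x →L[ℝ] F x)) (A : ∀ x : M, E x →L[ℝ] F x)
    (W : M → Type*) [∀ x, NormedAddCommGroup (W x)] [∀ x, InnerProductSpace ℂ (W x)]
    [∀ x, FiniteDimensional ℂ (W x)] where
  frame : ∀ x : M, TangentSpace (𝓡 n) x ≃ₗᵢ[ℝ] EuclideanSpace ℝ (Fin n)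
  action : ∀ x, CliffordAction n (W x)
  spinor : ∀ x, W x
  isoE : ∀ x, E x ≃ₗᵢ[ℝ] WithLp 2 (W x × Form n)
  isoF : ∀ x, F x ≃ₗᵢ[ℝ] WithLp 2 (W x × Form n)
  symbol_eq : ∀ x (u : Cotangent n x) (e : E x),
    isoF x (σ x u e) = (action x).pairSymbol (frameCoord (frame x) u) (isoE x e)
  perturbation_eq : ∀ x (e : E x), isoF x (A x e) = (action x).pairPerturbation (spinor x) (isoE x e)

end SpinorForm

end

noncomputable section

universe u

/-! Concentration comes from expanding a square. With `P = D + sA`, ‖Pξ‖² = ‖Dξ‖² + 2s ∫⟨Dξ, Aξ⟩ +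
s²‖Aξ‖². The concentrating condition says exactly that ⟨σ(u)e, Ae'⟩ is symmetric in e, e'
(`isConcentratingPair_iff`), and this makes the cross term an operator of order zero: |∫⟨Dξ, Aξ⟩| ≤
C₀‖ξ‖² (`exists_abs_integral_inner_le`). Off the δ-neighbourhood of the singular set, `A` is
injective on the subbundle over a compact set, so |Aξ|² ≥ κ|ξ|² there (`exists_lower_bound`). If
‖Pξ‖² ≤ C|s| and ‖ξ‖ = 1, then s²κ∫|ξ|² ≤ (C + 2C₀)|s| over that set, and dividing by |s| gives the
bound. An eigensection satisfies the same hypothesis, by pairing its equation with ξ itself.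

The cross term is treated without constructing D*. Write ξ = ∑ vₐtₐ with finitely many global
sections tₐ of the subbundle. The first order part of ⟨Dξ, Aξ⟩ is ∑ v_b yₐ_b(dvₐ) with yₐ_b(u) =
⟨σ(u)tₐ, At_b⟩ symmetric in a, b, hence equal to ½∑ yₐ_b(d(vₐv_b)). Each yₐ_b is a smooth vector
field, and integrating by parts (`exists_divergence`) leaves only products vₐv_b, which are bounded
by a multiple of |ξ|². The integration by parts rests on a description of the Riemannian measure in
charts.

This argument uses only additivity, the Leibniz rule, smoothness and the symmetry of the pairing on
the subbundle, so each restriction reduces to checking that symmetry. For an involution, σ(u) maps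
E⁺ into F^ε, and the projection in A⁺ can therefore be moved onto σ(u)e, where it does nothing. For
spinor-form pairs the symmetry follows from c(v)P_ψα = P_ψ(v∧α − ι_vα) and c(v)* = −c(v). For
self-duality, a form in E⁺⁺ has degree less than n/2, so its image under the symbol has degree at
most n/2, and a spinor ψ of positive chirality does not distinguish a middle-degree form from its
Hodge star. Hence the involution drops out of the pairing
(`CliffordAction.inner_pairSelfDuality_pairSymbol`). -/

theorem gram_eq_transpose_mul_gram_mul {ι V : Type*} [Fintype ι] [NormedAddCommGroup V]
    [InnerProductSpace ℝ V] {v w : ι → V} {J : Matrix ι ι ℝ} (h : ∀ i, v i = ∑ j, J j i • w j) :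
    Matrix.gram ℝ v = J.transpose * Matrix.gram ℝ w * J := by
  ext i j
  simp only [Matrix.gram_apply, Matrix.mul_apply, Matrix.transpose_apply, Finset.sum_mul]
  rw [h i, h j, sum_inner]
  simp only [inner_sum]
  rw [Finset.sum_comm]
  refine Finset.sum_congr rfl fun k _ => Finset.sum_congr rfl fun l _ => ?_
  rw [real_inner_smul_left, real_inner_smul_right]
  ring

/-! ### Coordinate frames and the Gram determinant -/

section CoordVectors

variable {n : ℕ} {M : Type*} [TopologicalSpace M] [ChartedSpace (EuclideanSpace ℝ (Fin n)) M]
  [IsManifold (𝓡 n) ∞ M]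

/-- The tangent space at `p` is ℝⁿ read in the preferred chart at `p` itself, so the coordinate
vectors of another chart are the columns of the derivative of the transition map. -/
theorem coordVector_eq_tangentCoordChange {x₀ p : M} (hp : p ∈ (chartAt (EuclideanSpace ℝ (Fin n)) x₀).source)
    (i : Fin n) : coordVector (n := n) x₀ i p =
      tangentCoordChange (𝓡 n) x₀ p p (EuclideanSpace.single i (1 : ℝ)) := by
  have := TangentBundle.symmL_trivializationAt_eq_core (I := 𝓡 n) hp
  have h2 := congrArg (fun L => L (EuclideanSpace.single i (1 : ℝ))) this
  rw [coordVector, ← Trivialization.symmL_apply (R := ℝ) _ (by simpa using hp)]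
  exact h2

theorem coordVector_eq_sum {x₀ x₁ p : M}
    (h₀ : p ∈ (chartAt (EuclideanSpace ℝ (Fin n)) x₀).source)
    (h₁ : p ∈ (chartAt (EuclideanSpace ℝ (Fin n)) x₁).source) (i : Fin n) :
    coordVector (n := n) x₀ i p = ∑ j, tangentCoordChange (𝓡 n) x₀ x₁ p
      (EuclideanSpace.single i (1 : ℝ)) j • coordVector (n := n) x₁ j p := by
  have hpp := mem_chart_source (EuclideanSpace ℝ (Fin n)) p
  set w := tangentCoordChange (𝓡 n) x₀ x₁ p (EuclideanSpace.single i (1 : ℝ)) with hw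
  have e : w = ∑ j, w j • EuclideanSpace.single j (1 : ℝ) := by
    simpa using ((EuclideanSpace.basisFun (Fin n) ℝ).sum_repr w).symm
  rw [coordVector_eq_tangentCoordChange h₀]
  have := tangentCoordChange_comp (I := 𝓡 n) (w := x₀) (x := x₁) (y := p) (z := p)
    (v := EuclideanSpace.single i (1 : ℝ)) (by simp [h₀, h₁, hpp])
  rw [← this, ← hw]
  conv_lhs => rw [e]
  rw [map_sum]
  refine Finset.sum_congr rfl fun j _ => ?_
  rw [map_smul, coordVector_eq_tangentCoordChange h₁]
  rfl

theorem linearIndependent_coordVector {x₀ p : M}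
    (h₀ : p ∈ (chartAt (EuclideanSpace ℝ (Fin n)) x₀).source) :
    LinearIndependent ℝ (fun i => coordVector (n := n) x₀ i p) := by
  let e := trivializationAt (EuclideanSpace ℝ (Fin n)) (fun x : M => TangentSpace (𝓡 n) x) x₀
  have hp : p ∈ e.baseSet := by simpa [e] using h₀
  have := ((EuclideanSpace.basisFun (Fin n) ℝ).toBasis.map
    (e.linearEquivAt ℝ p hp).symm).linearIndependent
  have h : (fun i => coordVector (n := n) x₀ i p) = ((EuclideanSpace.basisFun (Fin n) ℝ).toBasis.map
    (e.linearEquivAt ℝ p hp).symm) := by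
    ext i
    simp [coordVector, e]
  rw [h]
  exact this

variable [RiemannianBundle (fun x : M => TangentSpace (𝓡 n) x)]

theorem det_chartGram_pos {x₀ p : M}
    (h₀ : p ∈ (chartAt (EuclideanSpace ℝ (Fin n)) x₀).source) :
    0 < (chartGram (n := n) x₀ p).det := by
  have h := Fintype.linearIndependent_iff.1 (linearIndependent_coordVector h₀)
  have h' : LinearIndependent ℝ (fun i => coordVector (n := n) x₀ i p) :=
    Fintype.linearIndependent_iff.2 h
  exact (Matrix.posDef_gram_of_linearIndependent h').det_pos

/-- The two coordinate frames differ by the Jacobian J, so the Gram matrices are related by JᵀGJ. -/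
theorem det_chartGram_change {x₀ x₁ p : M}
    (h₀ : p ∈ (chartAt (EuclideanSpace ℝ (Fin n)) x₀).source)
    (h₁ : p ∈ (chartAt (EuclideanSpace ℝ (Fin n)) x₁).source) :
    (chartGram (n := n) x₀ p).det =
      (tangentCoordChange (𝓡 n) x₀ x₁ p).det ^ 2 * (chartGram (n := n) x₁ p).det := by
  let b := (EuclideanSpace.basisFun (Fin n) ℝ).toBasis
  let J := LinearMap.toMatrix b b (tangentCoordChange (𝓡 n) x₀ x₁ p).toLinearMap
  have hJ : J.det = (tangentCoordChange (𝓡 n) x₀ x₁ p).det := by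
    rw [LinearMap.det_toMatrix]
  have : chartGram (n := n) x₀ p = J.transpose * chartGram (n := n) x₁ p * J := by
    refine gram_eq_transpose_mul_gram_mul fun i => ?_
    rw [coordVector_eq_sum h₀ h₁ i]
    simp [J, b, LinearMap.toMatrix_apply]
  rw [this, Matrix.det_mul, Matrix.det_mul, Matrix.det_transpose, hJ]
  ring

theorem contMDiffOn_coordVector (x₀ : M) (i : Fin n) :
    ContMDiffOn (𝓡 n) ((𝓡 n).prod 𝓘(ℝ, EuclideanSpace ℝ (Fin n))) ∞
      (fun p => TotalSpace.mk' (EuclideanSpace ℝ (Fin n)) p (coordVector (n := n) x₀ i p))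
      (chartAt (EuclideanSpace ℝ (Fin n)) x₀).source := by
  let e := trivializationAt (EuclideanSpace ℝ (Fin n)) (fun x : M => TangentSpace (𝓡 n) x) x₀
  have hb : e.baseSet = (chartAt (EuclideanSpace ℝ (Fin n)) x₀).source := by simp [e]
  rw [← hb]
  refine (e.contMDiffOn_localFrame_baseSet (I := 𝓡 n) ∞
    (EuclideanSpace.basisFun (Fin n) ℝ).toBasis i).congr fun p hp => ?_
  rw [e.localFrame_apply_of_mem_baseSet _ hp]
  simp [coordVector, e, Trivialization.basisAt]

variable [IsContMDiffRiemannianBundle (𝓡 n) ∞ (EuclideanSpace ℝ (Fin n))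
      (fun x : M => TangentSpace (𝓡 n) x)]

/-- The density `√(det g_{ij})` of the Riemannian volume in the preferred chart at `x₀`. -/
def chartDensity (x₀ p : M) : ℝ := Real.sqrt (chartGram (n := n) x₀ p).det

theorem contMDiffOn_det_chartGram (x₀ : M) :
    ContMDiffOn (𝓡 n) 𝓘(ℝ) ∞ (fun p => (chartGram (n := n) x₀ p).det)
      (chartAt (EuclideanSpace ℝ (Fin n)) x₀).source := by
  simp only [Matrix.det_apply]
  refine contMDiffOn_finsetSum fun g _ => ?_
  simp only [Units.smul_def, zsmul_eq_mul]
  refine contMDiffOn_const.mul (contMDiffOn_finsetProd fun i _ => ?_)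
  exact (contMDiffOn_coordVector x₀ (g i)).inner_bundle (contMDiffOn_coordVector x₀ i)

theorem contMDiffOn_chartDensity (x₀ : M) :
    ContMDiffOn (𝓡 n) 𝓘(ℝ) ∞ (chartDensity (n := n) x₀)
      (chartAt (EuclideanSpace ℝ (Fin n)) x₀).source := by
  intro p hp
  refine ContMDiffAt.comp_contMDiffWithinAt (g := Real.sqrt) p ?_ (contMDiffOn_det_chartGram x₀ p hp)
  exact (Real.contDiffAt_sqrt (det_chartGram_pos hp).ne').contMDiffAt

end CoordVectors

/-! ### The Riemannian volume measure in a chart -/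

section VolumeMeasure

variable {n : ℕ} {M : Type*} [TopologicalSpace M] [MeasurableSpace M] [BorelSpace M]
  [ChartedSpace (EuclideanSpace ℝ (Fin n)) M]
  [IsManifold (𝓡 n) ∞ M] [RiemannianBundle (fun x : M => TangentSpace (𝓡 n) x)]

theorem aemeasurable_extChartAt_symm (x₀ : M) :
    AEMeasurable (extChartAt (𝓡 n) x₀).symm (volume.restrict (extChartAt (𝓡 n) x₀).target) :=
  (continuousOn_extChartAt_symm x₀).aemeasurable (isOpen_extChartAt_target x₀).measurableSet

theorem measurableSet_extChartAt_symm_preimage (x₀ : M) {B : Set M} (hB : MeasurableSet B) :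
    MeasurableSet ((extChartAt (𝓡 n) x₀).symm ⁻¹' B ∩ (extChartAt (𝓡 n) x₀).target) := by
  have ht := (isOpen_extChartAt_target (I := 𝓡 n) x₀).measurableSet
  have hc := continuousOn_iff_continuous_domRestrict.1 (continuousOn_extChartAt_symm (I := 𝓡 n) x₀)
  have := ht.subtype_image (hc.measurable hB)
  convert this using 1
  ext y
  simp [and_comm]

theorem chartVolume_apply (x₀ : M) {B : Set M} (hB : MeasurableSet B) :
    chartVolume (n := n) x₀ B =
      ∫⁻ y in (extChartAt (𝓡 n) x₀).symm ⁻¹' B ∩ (extChartAt (𝓡 n) x₀).target,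
        ENNReal.ofReal (chartDensity (n := n) x₀ ((extChartAt (𝓡 n) x₀).symm y)) := by
  rw [chartVolume, Measure.map_apply_of_aemeasurable _ hB, withDensity_apply',
    Measure.restrict_restrict' (isOpen_extChartAt_target x₀).measurableSet]
  · rfl
  · exact (aemeasurable_extChartAt_symm x₀).mono_ac (withDensity_absolutelyContinuous _ _)

/-- Change of variables along the transition map: the factor |det J| it produces is the one by which
√det g changes. -/
theorem chartVolume_eq_of_subset {x₀ x₁ : M} {B : Set M} (hB : MeasurableSet B)
    (h₀ : B ⊆ (extChartAt (𝓡 n) x₀).source) (h₁ : B ⊆ (extChartAt (𝓡 n) x₁).source) :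
    chartVolume (n := n) x₀ B = chartVolume (n := n) x₁ B := by
  rw [chartVolume_apply x₀ hB, chartVolume_apply x₁ hB]
  set φ₀ := extChartAt (𝓡 n) x₀
  set φ₁ := extChartAt (𝓡 n) x₁
  have him : φ₁.symm ⁻¹' B ∩ φ₁.target = (φ₁ ∘ φ₀.symm) '' (φ₀.symm ⁻¹' B ∩ φ₀.target) := by
    ext z
    constructor
    · rintro ⟨hz, hzt⟩
      exact ⟨φ₀ (φ₁.symm z), ⟨by simpa [φ₀.left_inv (h₀ hz)] using hz, φ₀.map_source (h₀ hz)⟩,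
        by simp [φ₀.left_inv (h₀ hz), φ₁.right_inv hzt]⟩
    · rintro ⟨y, ⟨hy, hyt⟩, rfl⟩
      exact ⟨by simpa [φ₁.left_inv (h₁ hy)] using hy, φ₁.map_source (h₁ hy)⟩
  rw [him, lintegral_image_eq_lintegral_abs_det_fderiv_mul (f' := fun y =>
    tangentCoordChange (𝓡 n) x₀ x₁ (φ₀.symm y)) _ (measurableSet_extChartAt_symm_preimage x₀ hB)]
  · refine setLIntegral_congr_fun (measurableSet_extChartAt_symm_preimage x₀ hB) ?_
    rintro y ⟨hy, hyt⟩
    have e₀ := h₀ hy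
    have e₁ := h₁ hy
    simp only [Function.comp_apply, φ₁.left_inv e₁]
    rw [← ENNReal.ofReal_mul (abs_nonneg _)]
    congr 1
    simp only [φ₀, φ₁, extChartAt_source] at e₀ e₁
    simp only [chartDensity]
    rw [det_chartGram_change e₀ e₁, Real.sqrt_mul (sq_nonneg _), Real.sqrt_sq_eq_abs]
  · rintro y ⟨hy, hyt⟩
    have := hasFDerivWithinAt_tangentCoordChange (I := 𝓡 n) (x := x₀) (y := x₁) (z := φ₀.symm y)
      ⟨h₀ hy, h₁ hy⟩
    rw [show extChartAt (𝓡 n) x₀ (φ₀.symm y) = y from φ₀.right_inv hyt] at this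
    exact this.mono (by simp)
  · rintro y ⟨hy, hyt⟩ z ⟨hz, hzt⟩ h
    simp only [Function.comp_apply] at h
    have := φ₁.injOn (h₁ hy) (h₁ hz) h
    exact φ₀.symm.injOn hyt hzt this

theorem chartVolume_compl_source (x₀ : M) :
    chartVolume (n := n) x₀ (extChartAt (𝓡 n) x₀).sourceᶜ = 0 := by
  rw [chartVolume_apply x₀ (isOpen_extChartAt_source x₀).measurableSet.compl]
  have : (extChartAt (𝓡 n) x₀).symm ⁻¹' (extChartAt (𝓡 n) x₀).sourceᶜ ∩
      (extChartAt (𝓡 n) x₀).target = ∅ := by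
    ext y
    simp only [Set.mem_inter_iff, Set.mem_preimage, Set.mem_compl_iff, Set.mem_empty_iff_false,
      iff_false, not_and]
    exact fun h h' => h ((extChartAt (𝓡 n) x₀).map_target h')
  simp only [this, Measure.restrict_empty, lintegral_zero_measure]

/-- Chart measures agree on overlaps, so on one chart domain the supremum defining the volume adds
nothing to the measure of that chart. -/
theorem riemannianVolume_restrict_source (x₀ : M) :
    (riemannianVolume n M).restrict (extChartAt (𝓡 n) x₀).source = chartVolume (n := n) x₀ := by
  set S := (extChartAt (𝓡 n) x₀).source
  have hS : MeasurableSet S := (isOpen_extChartAt_source x₀).measurableSet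
  have h0 : (chartVolume (n := n) x₀).restrict S = chartVolume (n := n) x₀ := by
    refine Measure.restrict_eq_self_of_ae_mem ?_
    rw [ae_iff]
    exact chartVolume_compl_source x₀
  refine le_antisymm ?_ ?_
  -- A supremum of measures is only accessible as a least upper bound. Hence every chart measure is
  -- dominated by a single measure, which is infinite off `S` and so costs nothing there, and the
  -- restriction to `S` is taken afterwards.
  · have hle : riemannianVolume n M ≤ chartVolume (n := n) x₀ + (⊤ : Measure M).restrict Sᶜ := by
      refine iSup_le fun x₁ => ?_
      rw [← Measure.restrict_add_restrict_compl (μ := chartVolume (n := n) x₁) hS]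
      refine add_le_add ?_ (Measure.restrict_mono le_rfl le_top)
      refine Measure.le_intro fun B hB _ => ?_
      rw [Measure.restrict_apply hB]
      set T := (extChartAt (𝓡 n) x₁).source
      have hT : MeasurableSet T := (isOpen_extChartAt_source x₁).measurableSet
      calc chartVolume (n := n) x₁ (B ∩ S)
          ≤ chartVolume (n := n) x₁ (B ∩ S ∩ T) + chartVolume (n := n) x₁ Tᶜ := by
            refine (measure_mono ?_).trans (measure_union_le _ _)
            intro y hy
            by_cases h : y ∈ T
            · exact Or.inl ⟨hy, h⟩
            · exact Or.inr h
        _ = chartVolume (n := n) x₀ (B ∩ S ∩ T) := by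
            rw [chartVolume_compl_source, add_zero]
            exact chartVolume_eq_of_subset ((hB.inter hS).inter hT) (fun y hy => hy.2)
              (fun y hy => hy.1.2)
        _ ≤ chartVolume (n := n) x₀ B := measure_mono fun y hy => hy.1.1
    refine (Measure.restrict_mono le_rfl hle).trans ?_
    rw [Measure.restrict_add, Measure.restrict_restrict hS, Set.inter_compl_self]
    simp [h0]
  · rw [← h0]
    exact Measure.restrict_mono le_rfl (le_iSup (fun x => chartVolume (n := n) x) x₀)

variable [IsContMDiffRiemannianBundle (𝓡 n) ∞ (EuclideanSpace ℝ (Fin n))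
      (fun x : M => TangentSpace (𝓡 n) x)]

theorem continuousOn_chartDensity_symm (x₀ : M) :
    ContinuousOn (fun y => chartDensity (n := n) x₀ ((extChartAt (𝓡 n) x₀).symm y))
      (extChartAt (𝓡 n) x₀).target := by
  refine (contMDiffOn_chartDensity (n := n) x₀).continuousOn.comp
    (continuousOn_extChartAt_symm (I := 𝓡 n) x₀) fun y hy => ?_
  simpa using (extChartAt (𝓡 n) x₀).map_target hy

theorem integral_riemannianVolume_eq (x₀ : M) {f : M → ℝ}
    (hf : ∀ p ∉ (extChartAt (𝓡 n) x₀).source, f p = 0) (hfm : Continuous f) :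
    ∫ p, f p ∂(riemannianVolume n M) = ∫ y in (extChartAt (𝓡 n) x₀).target,
      chartDensity (n := n) x₀ ((extChartAt (𝓡 n) x₀).symm y) *
        f ((extChartAt (𝓡 n) x₀).symm y) := by
  have ht := (isOpen_extChartAt_target (I := 𝓡 n) x₀).measurableSet
  have hm : AEMeasurable (fun y => ENNReal.ofReal (chartDensity (n := n) x₀
      ((extChartAt (𝓡 n) x₀).symm y))) (volume.restrict (extChartAt (𝓡 n) x₀).target) :=
    ((continuousOn_chartDensity_symm x₀).aemeasurable ht).ennreal_ofReal
  rw [← setIntegral_eq_integral_of_forall_compl_eq_zero hf, riemannianVolume_restrict_source,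
    chartVolume, integral_map ?_ hfm.aestronglyMeasurable]
  · refine (integral_withDensity_eq_integral_toReal_smul₀ hm (by simp) _).trans ?_
    refine integral_congr_ae (ae_of_all _ fun y => ?_)
    simp only [smul_eq_mul]
    rw [ENNReal.toReal_ofReal (show 0 ≤ chartDensity x₀ _ from Real.sqrt_nonneg _)]
  · exact (aemeasurable_extChartAt_symm x₀).mono_ac (withDensity_absolutelyContinuous _ _)

/-- The density is continuous on the chart target, hence integrable over a closed ball contained in
it. -/
theorem isLocallyFiniteMeasure_riemannianVolume :
    IsLocallyFiniteMeasure (riemannianVolume n M) := by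
  refine ⟨fun x₀ => ?_⟩
  set φ := extChartAt (𝓡 n) x₀
  obtain ⟨r, hr, hrt⟩ := Metric.nhds_basis_closedBall.mem_iff.1
    ((isOpen_extChartAt_target (I := 𝓡 n) x₀).mem_nhds (mem_extChartAt_target x₀))
  set N := φ.source ∩ φ ⁻¹' Metric.ball (φ x₀) r
  have hN : IsOpen N := (continuousOn_extChartAt (I := 𝓡 n) x₀).isOpen_inter_preimage
    (isOpen_extChartAt_source x₀) Metric.isOpen_ball
  refine ⟨N, hN.mem_nhds ⟨mem_extChartAt_source x₀, by simpa using hr⟩, ?_⟩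
  have h1 : riemannianVolume n M N = chartVolume (n := n) x₀ N := by
    rw [← riemannianVolume_restrict_source, Measure.restrict_apply hN.measurableSet,
      Set.inter_eq_left.2 (fun y hy => hy.1)]
  rw [h1, chartVolume_apply x₀ hN.measurableSet]
  have hint : IntegrableOn (fun y => chartDensity (n := n) x₀ (φ.symm y))
      (Metric.closedBall (φ x₀) r) volume :=
    ((continuousOn_chartDensity_symm x₀).mono hrt).integrableOn_compact (isCompact_closedBall _ _)
  refine lt_of_le_of_lt (lintegral_mono_set ?_) hint.lintegral_lt_top
  rintro y ⟨hy, hyt⟩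
  have : φ (φ.symm y) ∈ Metric.ball (φ x₀) r := hy.2
  rw [φ.right_inv hyt] at this
  exact Metric.ball_subset_closedBall this

theorem isFiniteMeasure_riemannianVolume [CompactSpace M] :
    IsFiniteMeasure (riemannianVolume n M) := by
  have := isLocallyFiniteMeasure_riemannianVolume (n := n) (M := M)
  infer_instance

end VolumeMeasure

/-! ### Smooth partitions of unity by squares -/

section SquarePartition

variable {n : ℕ} {M : Type*} [TopologicalSpace M] [CompactSpace M] [T2Space M]
  [ChartedSpace (EuclideanSpace ℝ (Fin n)) M] [IsManifold (𝓡 n) ∞ M]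

/-- A finite smooth partition of unity by squares, with supports in prescribed neighbourhoods. -/
theorem exists_finite_sq_partition (U : M → Set M) (hU : ∀ x, U x ∈ nhds x) :
    ∃ (t : Finset M) (χ : M → M → ℝ), (∀ x, ContMDiff (𝓡 n) 𝓘(ℝ) ∞ (χ x)) ∧
      (∀ x, tsupport (χ x) ⊆ U x) ∧ ∀ y, ∑ x ∈ t, χ x y ^ 2 = 1 := by
  have h1 : ∀ x, ∃ f : SmoothBumpFunction (𝓡 n) x, tsupport f ⊆ U x := fun x => by
    obtain ⟨f, -, hf⟩ := (SmoothBumpFunction.nhds_basis_tsupport (I := 𝓡 n) x).mem_iff.1 (hU x)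
    exact ⟨f, hf⟩
  choose f hf using h1
  obtain ⟨t, ht⟩ := isCompact_univ.elim_nhds_subcover (fun x => Function.support (f x))
    (fun x _ => (f x).support_mem_nhds)
  have hpos : ∀ y, 0 < ∑ x ∈ t, f x y ^ 2 := fun y => by
    obtain ⟨x, hx, hy⟩ := Set.mem_iUnion₂.1 (ht.2 (Set.mem_univ y))
    refine Finset.sum_pos' (fun i _ => sq_nonneg _) ⟨x, hx, ?_⟩
    have : f x y ≠ 0 := hy
    positivity
  -- Finitely many bump functions, divided by the root of the sum of their squares; compactness
  -- makes that sum positive everywhere, so the root is smooth.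
  have hw : ContMDiff (𝓡 n) 𝓘(ℝ) ∞ (fun y => (Real.sqrt (∑ x ∈ t, f x y ^ 2))⁻¹) := by
    intro y
    have h2 : ContMDiffAt (𝓡 n) 𝓘(ℝ) ∞ (fun y => ∑ x ∈ t, f x y ^ 2) y :=
      contMDiffAt_finsetSum fun x _ => ((f x).contMDiff y).pow 2
    have h3 : ContDiffAt ℝ ∞ (fun r => (Real.sqrt r)⁻¹) (∑ x ∈ t, f x y ^ 2) :=
      (Real.contDiffAt_sqrt (hpos y).ne').inv (Real.sqrt_pos.2 (hpos y)).ne'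
    exact ContMDiffAt.comp (g := fun r => (Real.sqrt r)⁻¹) y h3.contMDiffAt h2
  refine ⟨t, fun x y => (Real.sqrt (∑ x ∈ t, f x y ^ 2))⁻¹ * f x y, fun x => hw.mul (f x).contMDiff,
    fun x => (tsupport_mul_subset_right).trans (hf x), fun y => ?_⟩
  simp only [mul_pow, inv_pow, Real.sq_sqrt (hpos y).le]
  rw [← Finset.mul_sum, inv_mul_cancel₀ (hpos y).ne']

end SquarePartition

/-! ### Integration by parts in a chart -/

section ChartDerivative

variable {n : ℕ} {M : Type*} [TopologicalSpace M]
  [ChartedSpace (EuclideanSpace ℝ (Fin n)) M]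

/-- The partial derivative `∂_i f` in the preferred chart at `x₀`. -/
def chartDeriv (x₀ : M) (i : Fin n) (f : M → ℝ) (p : M) : ℝ :=
  fderiv ℝ (f ∘ (extChartAt (𝓡 n) x₀).symm) (extChartAt (𝓡 n) x₀ p)
    (EuclideanSpace.single i (1 : ℝ))

/-- The function `f` in the preferred chart at `x₀`, extended by zero. -/
def chartExtend (x₀ : M) (f : M → ℝ) : EuclideanSpace ℝ (Fin n) → ℝ :=
  (extChartAt (𝓡 n) x₀).target.indicator (f ∘ (extChartAt (𝓡 n) x₀).symm)

theorem chartExtend_of_mem {x₀ : M} (f : M → ℝ) {y : EuclideanSpace ℝ (Fin n)}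
    (hy : y ∈ (extChartAt (𝓡 n) x₀).target) :
    chartExtend x₀ f y = f ((extChartAt (𝓡 n) x₀).symm y) := Set.indicator_of_mem hy _

theorem chartExtend_eventuallyEq {x₀ : M} (f : M → ℝ) {y : EuclideanSpace ℝ (Fin n)}
    (hy : y ∈ (extChartAt (𝓡 n) x₀).target) :
    chartExtend x₀ f =ᶠ[nhds y] f ∘ (extChartAt (𝓡 n) x₀).symm :=
  Filter.eventuallyEq_of_mem ((isOpen_extChartAt_target x₀).mem_nhds hy)
    fun _ hz => chartExtend_of_mem f hz

variable [IsManifold (𝓡 n) ∞ M]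

theorem contDiffOn_comp_extChartAt_symm {x₀ : M} {f : M → ℝ}
    (hf : ContMDiffOn (𝓡 n) 𝓘(ℝ) ∞ f (extChartAt (𝓡 n) x₀).source) :
    ContDiffOn ℝ ∞ (f ∘ (extChartAt (𝓡 n) x₀).symm) (extChartAt (𝓡 n) x₀).target := by
  rw [← contMDiffOn_iff_contDiffOn]
  exact hf.comp (contMDiffOn_extChartAt_symm x₀) fun y hy => (extChartAt (𝓡 n) x₀).map_target hy

theorem continuousOn_chartDeriv {x₀ : M} {f : M → ℝ} (i : Fin n)
    (hf : ContMDiffOn (𝓡 n) 𝓘(ℝ) ∞ f (extChartAt (𝓡 n) x₀).source) :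
    ContinuousOn (chartDeriv x₀ i f) (extChartAt (𝓡 n) x₀).source := by
  have h := (contDiffOn_comp_extChartAt_symm hf).continuousOn_fderiv_of_isOpen
    (isOpen_extChartAt_target x₀) (by simp)
  exact (h.comp (continuousOn_extChartAt x₀) fun p hp => (extChartAt (𝓡 n) x₀).map_source hp).clm_apply
    continuousOn_const

variable [CompactSpace M] [T2Space M]

theorem isCompact_extChartAt_image_tsupport {x₀ : M} {f : M → ℝ}
    (hs : tsupport f ⊆ (extChartAt (𝓡 n) x₀).source) :
    IsCompact (extChartAt (𝓡 n) x₀ '' tsupport f) :=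
  (isClosed_tsupport f).isCompact.image_of_continuousOn ((continuousOn_extChartAt x₀).mono hs)

/-- Compactness of `M` makes the image of the support compact, hence closed in ℝⁿ, so the extension
by zero acquires no support at the boundary of the chart target. -/
theorem tsupport_chartExtend_subset {x₀ : M} {f : M → ℝ}
    (hs : tsupport f ⊆ (extChartAt (𝓡 n) x₀).source) :
    tsupport (chartExtend (n := n) x₀ f) ⊆ extChartAt (𝓡 n) x₀ '' tsupport f := by
  refine closure_minimal ?_ (isCompact_extChartAt_image_tsupport hs).isClosed
  intro y hy
  by_cases h : y ∈ (extChartAt (𝓡 n) x₀).target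
  · rw [Function.mem_support, chartExtend_of_mem f h] at hy
    exact ⟨_, subset_tsupport f hy, (extChartAt (𝓡 n) x₀).right_inv h⟩
  · exact absurd (Set.indicator_of_notMem h _) hy

theorem tsupport_chartExtend_subset_target {x₀ : M} {f : M → ℝ}
    (hs : tsupport f ⊆ (extChartAt (𝓡 n) x₀).source) :
    tsupport (chartExtend (n := n) x₀ f) ⊆ (extChartAt (𝓡 n) x₀).target := by
  refine (tsupport_chartExtend_subset hs).trans ?_
  rintro _ ⟨p, hp, rfl⟩
  exact (extChartAt (𝓡 n) x₀).map_source (hs hp)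

theorem hasCompactSupport_chartExtend {x₀ : M} {f : M → ℝ}
    (hs : tsupport f ⊆ (extChartAt (𝓡 n) x₀).source) : HasCompactSupport (chartExtend (n := n) x₀ f) :=
  (isCompact_extChartAt_image_tsupport hs).of_isClosed_subset (isClosed_tsupport _)
    (tsupport_chartExtend_subset hs)

theorem contDiff_chartExtend {x₀ : M} {f : M → ℝ} (hf : ContMDiff (𝓡 n) 𝓘(ℝ) ∞ f)
    (hs : tsupport f ⊆ (extChartAt (𝓡 n) x₀).source) : ContDiff ℝ ∞ (chartExtend (n := n) x₀ f) := by
  refine (contMDiff_of_tsupport fun y hy => ?_).contDiff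
  have ht := tsupport_chartExtend_subset_target hs hy
  exact (((contDiffOn_comp_extChartAt_symm hf.contMDiffOn).contDiffAt
    ((isOpen_extChartAt_target x₀).mem_nhds ht)).congr_of_eventuallyEq
      (chartExtend_eventuallyEq f ht)).contMDiffAt

/-- Only `w` is extended by zero. The function `f` in the chart is controlled on the target alone,
which suffices because every integrand is supported in the compact support of the extension of `w`.
-/
theorem chartExtend_integral_by_parts {x₀ : M} (i : Fin n) {w f : M → ℝ}
    (hw : ContMDiff (𝓡 n) 𝓘(ℝ) ∞ w) (hs : tsupport w ⊆ (extChartAt (𝓡 n) x₀).source)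
    (hf : ContMDiff (𝓡 n) 𝓘(ℝ) ∞ f) :
    ∫ y, chartExtend (n := n) x₀ w y * fderiv ℝ (f ∘ (extChartAt (𝓡 n) x₀).symm) y
        (EuclideanSpace.single i (1 : ℝ)) =
      -∫ y, fderiv ℝ (chartExtend (n := n) x₀ w) y (EuclideanSpace.single i (1 : ℝ)) *
        (f ∘ (extChartAt (𝓡 n) x₀).symm) y := by
  have hk := contDiff_chartExtend hw hs
  have hc := hasCompactSupport_chartExtend hs
  have ht := tsupport_chartExtend_subset_target hs
  have hF := contDiffOn_comp_extChartAt_symm (x₀ := x₀) hf.contMDiffOn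
  have hF' := hF.continuousOn_fderiv_of_isOpen (isOpen_extChartAt_target x₀) (by simp)
  have hk' : Continuous fun y => fderiv ℝ (chartExtend (n := n) x₀ w) y (EuclideanSpace.single i (1 : ℝ)) :=
    (hk.continuous_fderiv (by simp)).clm_apply continuous_const
  have key : ∀ a b : EuclideanSpace ℝ (Fin n) → ℝ, Continuous a →
      ContinuousOn b (extChartAt (𝓡 n) x₀).target → (∀ y ∉ tsupport (chartExtend (n := n) x₀ w), a y = 0) →
      Integrable (fun y => a y * b y) := by
    intro a b ha hb h0
    rw [← integrableOn_iff_integrable_of_support_subset (s := tsupport (chartExtend (n := n) x₀ w))]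
    · exact (ha.continuousOn.mul (hb.mono ht)).integrableOn_compact hc.isCompact
    · intro y hy
      by_contra h
      exact hy (by simp [h0 y h])
  have h0 : ∀ y ∉ tsupport (chartExtend (n := n) x₀ w), chartExtend x₀ w y = 0 := fun y hy =>
    image_eq_zero_of_notMem_tsupport hy
  refine integral_mul_fderiv_eq_neg_fderiv_mul_of_integrable (key _ _ hk' hF.continuousOn ?_)
    (key _ _ hk.continuous (hF'.clm_apply continuousOn_const) h0)
    (key _ _ hk.continuous hF.continuousOn h0) (fun y _ => hk.differentiable (by simp) y)
    (fun y hy => (hF.contDiffAt ((isOpen_extChartAt_target x₀).mem_nhds (ht hy))).differentiableAt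
      (by simp))
  intro y hy
  have : fderiv ℝ (chartExtend (n := n) x₀ w) y = 0 :=
    image_eq_zero_of_notMem_tsupport fun h => hy (tsupport_fderiv_subset ℝ h)
  simp [this]

theorem continuous_mul_chartDeriv {x₀ : M} (i : Fin n) {h f : M → ℝ} (hh : Continuous h)
    (hs : tsupport h ⊆ (extChartAt (𝓡 n) x₀).source) (hf : ContMDiff (𝓡 n) 𝓘(ℝ) ∞ f) :
    Continuous fun p => h p * chartDeriv x₀ i f p := by
  refine continuous_of_tsupport fun p hp => ?_
  have hp' := hs (tsupport_mul_subset_left hp)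
  exact hh.continuousAt.mul ((continuousOn_chartDeriv i hf.contMDiffOn).continuousAt
    ((isOpen_extChartAt_source x₀).mem_nhds hp'))

variable [MeasurableSpace M] [BorelSpace M] [RiemannianBundle (fun x : M => TangentSpace (𝓡 n) x)]
  [IsContMDiffRiemannianBundle (𝓡 n) ∞ (EuclideanSpace ℝ (Fin n))
      (fun x : M => TangentSpace (𝓡 n) x)]

theorem exists_integral_mul_chartDeriv (x₀ : M) (i : Fin n) {h : M → ℝ}
    (hh : ContMDiff (𝓡 n) 𝓘(ℝ) ∞ h) (hs : tsupport h ⊆ (extChartAt (𝓡 n) x₀).source) :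
    ∃ d : M → ℝ, Continuous d ∧ ∀ f : M → ℝ, ContMDiff (𝓡 n) 𝓘(ℝ) ∞ f →
      ∫ p, h p * chartDeriv x₀ i f p ∂(riemannianVolume n M) =
        -∫ p, d p * f p ∂(riemannianVolume n M) := by
  set φ := extChartAt (𝓡 n) x₀ with hφ
  have hopen : IsOpen φ.source := isOpen_extChartAt_source x₀
  have hdens : ∀ p ∈ φ.source, ContMDiffAt (𝓡 n) 𝓘(ℝ) ∞ (chartDensity (n := n) x₀) p :=
    fun p hp => (contMDiffOn_chartDensity x₀).contMDiffAt
      (by simpa [φ] using hopen.mem_nhds hp)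
  have hpos : ∀ p ∈ φ.source, 0 < chartDensity (n := n) x₀ p := fun p hp =>
    Real.sqrt_pos.2 (det_chartGram_pos (by simpa [φ] using hp))
  let w : M → ℝ := fun p => h p * chartDensity (n := n) x₀ p
  have hws : tsupport w ⊆ φ.source := tsupport_mul_subset_left.trans hs
  have hw : ContMDiff (𝓡 n) 𝓘(ℝ) ∞ w := contMDiff_of_tsupport fun p hp =>
    (hh p).mul (hdens p (hws hp))
  -- With ρ = √det g and w = hρ, Euclidean integration by parts turns ∫ hρ ∂ᵢf dy into −∫ (∂ᵢw) f
  -- dy; dividing by ρ makes the latter an integral against the Riemannian volume.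
  let d : M → ℝ := φ.source.indicator fun p => chartDeriv x₀ i w p / chartDensity (n := n) x₀ p
  have hd0 : ∀ p ∉ φ.source, d p = 0 := fun p hp => Set.indicator_of_notMem hp _
  have hdw : ∀ p ∈ φ.source, d p * chartDensity (n := n) x₀ p =
      fderiv ℝ (chartExtend (n := n) x₀ w) (φ p) (EuclideanSpace.single i (1 : ℝ)) := by
    intro p hp
    rw [(chartExtend_eventuallyEq w (φ.map_source hp)).fderiv_eq]
    simp only [d, Set.indicator_of_mem hp]
    exact div_mul_cancel₀ _ (hpos p hp).ne'
  -- This makes the extension of `d` by zero continuous across the boundary of the chart domain.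
  have hdt : tsupport d ⊆ tsupport w := by
    refine closure_minimal (fun p hp => ?_) (isClosed_tsupport _)
    have hps : p ∈ φ.source := by
      by_contra hps
      exact hp (hd0 p hps)
    have h1 : fderiv ℝ (chartExtend (n := n) x₀ w) (φ p) ≠ 0 := by
      intro h0
      have := hdw p hps
      rw [h0] at this
      simp [(hpos p hps).ne'] at this
      exact hp this
    have h2 := tsupport_chartExtend_subset hws
      (tsupport_fderiv_subset ℝ (subset_tsupport _ (Function.mem_support.2 h1)))
    obtain ⟨q, hq, hqp⟩ := h2
    rwa [φ.injOn (hws hq) hps hqp] at hq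
  have hd : Continuous d := by
    refine continuous_of_tsupport fun p hp => ?_
    have hps := hws (hdt hp)
    have : ContinuousAt (fun p => chartDeriv x₀ i w p / chartDensity (n := n) x₀ p) p :=
      ((continuousOn_chartDeriv i hw.contMDiffOn).continuousAt (hopen.mem_nhds hps)).div
        (hdens p hps).continuousAt (hpos p hps).ne'
    exact this.congr (Filter.eventuallyEq_of_mem (hopen.mem_nhds hps)
      fun q hq => by simp only [d, Set.indicator_of_mem hq])
  refine ⟨d, hd, fun f hf => ?_⟩
  rw [integral_riemannianVolume_eq x₀ (fun p hp => ?_) (continuous_mul_chartDeriv i hh.continuous hs hf),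
    integral_riemannianVolume_eq x₀ (f := fun p => d p * f p) (fun p hp => ?_)
      (hd.mul hf.continuous)]
  · have ht : MeasurableSet φ.target := (isOpen_extChartAt_target x₀).measurableSet
    have h1 : ∀ y ∉ φ.target, chartExtend (n := n) x₀ w y *
        fderiv ℝ (f ∘ φ.symm) y (EuclideanSpace.single i (1 : ℝ)) = 0 := fun y hy => by
      have : chartExtend (n := n) x₀ w y = 0 := Set.indicator_of_notMem hy _
      rw [this, zero_mul]
    have h2 : ∀ y ∉ φ.target, fderiv ℝ (chartExtend (n := n) x₀ w) y
        (EuclideanSpace.single i (1 : ℝ)) * (f ∘ φ.symm) y = 0 := fun y hy => by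
      have : fderiv ℝ (chartExtend (n := n) x₀ w) y = 0 := image_eq_zero_of_notMem_tsupport
        fun h => hy (tsupport_chartExtend_subset_target hws (tsupport_fderiv_subset ℝ h))
      simp [this]
    have := chartExtend_integral_by_parts i hw hws hf
    rw [← setIntegral_eq_integral_of_forall_compl_eq_zero h1,
      ← setIntegral_eq_integral_of_forall_compl_eq_zero h2] at this
    refine Eq.trans ?_ (this.trans (congrArg Neg.neg ?_))
    · refine setIntegral_congr_fun ht fun y hy => ?_
      simp only [chartExtend_of_mem w hy, w, chartDeriv, ← hφ, φ.right_inv hy]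
      ring
    · refine setIntegral_congr_fun ht fun y hy => ?_
      have := hdw _ (φ.map_target hy)
      rw [φ.right_inv hy] at this
      simp only [← this, Function.comp_apply, ← hφ]
      ring
  · rw [hd0 p hp, zero_mul]
  · rw [image_eq_zero_of_notMem_tsupport (fun h => hp (hs h)), zero_mul]

end ChartDerivative

/-! ### The divergence of a smooth vector field -/

section Divergence

variable {n : ℕ} {M : Type*} [TopologicalSpace M]
  [ChartedSpace (EuclideanSpace ℝ (Fin n)) M] [IsManifold (𝓡 n) ∞ M]

/-- The `i`-th coordinate function of the preferred chart at `x₀`. -/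
def chartCoord (x₀ : M) (i : Fin n) (p : M) : ℝ := extChartAt (𝓡 n) x₀ p i

theorem contMDiffAt_chartCoord {x₀ p : M} (i : Fin n) (hp : p ∈ (extChartAt (𝓡 n) x₀).source) :
    ContMDiffAt (𝓡 n) 𝓘(ℝ) ∞ (chartCoord (n := n) x₀ i) p := by
  have h : ContMDiffAt (𝓡 n) 𝓘(ℝ, EuclideanSpace ℝ (Fin n)) ∞ (extChartAt (𝓡 n) x₀) p :=
    contMDiffAt_extChartAt' (by simpa using hp)
  exact (EuclideanSpace.proj i : EuclideanSpace ℝ (Fin n) →L[ℝ] ℝ).contDiff.contDiffAt.contMDiffAt.comp p h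

/-- The chain rule for f = (f ∘ φ⁻¹) ∘ φ. -/
theorem mvfderiv_eq_sum_chartDeriv {x₀ p : M} (hp : p ∈ (extChartAt (𝓡 n) x₀).source) {f : M → ℝ}
    (hf : ContMDiff (𝓡 n) 𝓘(ℝ) ∞ f) :
    mvfderiv (𝓡 n) f p =
      ∑ i, chartDeriv x₀ i f p • mvfderiv (𝓡 n) (chartCoord (n := n) x₀ i) p := by
  set φ := extChartAt (𝓡 n) x₀
  have hφ : MDifferentiableAt (𝓡 n) 𝓘(ℝ, EuclideanSpace ℝ (Fin n)) φ p :=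
    (contMDiffAt_extChartAt' (I := 𝓡 n) (n := ∞) (by simpa [φ] using hp)).mdifferentiableAt (by simp)
  have hF : DifferentiableAt ℝ (f ∘ φ.symm) (φ p) :=
    ((contDiffOn_comp_extChartAt_symm (x₀ := x₀) hf.contMDiffOn).contDiffAt
      ((isOpen_extChartAt_target x₀).mem_nhds (φ.map_source hp))).differentiableAt (by simp)
  have hfe : f =ᶠ[nhds p] (f ∘ φ.symm) ∘ φ :=
    Filter.eventuallyEq_of_mem ((isOpen_extChartAt_source x₀).mem_nhds hp)
      fun q hq => by simp [φ.left_inv hq]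
  have h1 : ∀ v, mvfderiv (𝓡 n) f p v = fderiv ℝ (f ∘ φ.symm) (φ p) (mfderiv (𝓡 n) 𝓘(ℝ, EuclideanSpace ℝ (Fin n)) φ p v) := by
    intro v
    have : mvfderiv (𝓡 n) f p = mvfderiv (𝓡 n) ((f ∘ φ.symm) ∘ φ) p := by
      simp only [mvfderiv, hfe.mfderiv_eq]
      rfl
    rw [this, mvfderiv_comp_apply p hF.mdifferentiableAt hφ]
    simp only [mvfderiv, mfderiv_eq_fderiv]
    rfl
  have h2 : ∀ i v, mvfderiv (𝓡 n) (chartCoord (n := n) x₀ i) p v =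
      (EuclideanSpace.proj i : EuclideanSpace ℝ (Fin n) →L[ℝ] ℝ)
        (mfderiv (𝓡 n) 𝓘(ℝ, EuclideanSpace ℝ (Fin n)) φ p v) := by
    intro i v
    let L : EuclideanSpace ℝ (Fin n) →L[ℝ] ℝ := EuclideanSpace.proj i
    have : chartCoord (n := n) x₀ i = L ∘ φ := rfl
    rw [this, mvfderiv_comp_apply p L.differentiableAt.mdifferentiableAt hφ]
    simp only [mvfderiv, mfderiv_eq_fderiv, L.fderiv]
    rfl
  ext v
  rw [h1]
  simp only [sum_apply, smul_apply, h2]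
  set w : EuclideanSpace ℝ (Fin n) := mfderiv (𝓡 n) 𝓘(ℝ, EuclideanSpace ℝ (Fin n)) φ p v
  have e : w = ∑ j, w j • EuclideanSpace.single j (1 : ℝ) := by
    simpa using ((EuclideanSpace.basisFun (Fin n) ℝ).sum_repr w).symm
  conv_lhs => rw [e]
  rw [map_sum]
  refine Finset.sum_congr rfl fun i _ => ?_
  rw [map_smul, smul_eq_mul, smul_eq_mul, mul_comm]
  rfl

variable [CompactSpace M] [T2Space M]

/-- The field `y` is known to be smooth only on differentials of global functions, and chart
coordinates xᵢ are local. One factor χ turns xᵢ into the global function χxᵢ, the other localizes: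
χ²y(dxᵢ) = χ(y(d(χxᵢ)) − xᵢ y(dχ)). This is why the partition of unity is by squares. -/
theorem contMDiff_sq_mul_chartCoord {x₀ : M} {χ : M → ℝ} (hχ : ContMDiff (𝓡 n) 𝓘(ℝ) ∞ χ)
    (hs : tsupport χ ⊆ (extChartAt (𝓡 n) x₀).source) {y : ∀ x : M, Cotangent n x →ₗ[ℝ] ℝ}
    (hy : ∀ f : M → ℝ, ContMDiff (𝓡 n) 𝓘(ℝ) ∞ f →
      ContMDiff (𝓡 n) 𝓘(ℝ) ∞ fun x => y x (mvfderiv (𝓡 n) f x)) (i : Fin n) :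
    ContMDiff (𝓡 n) 𝓘(ℝ) ∞ fun p => χ p ^ 2 * y p (mvfderiv (𝓡 n) (chartCoord (n := n) x₀ i) p) := by
  have hc : ContMDiff (𝓡 n) 𝓘(ℝ) ∞ fun p => χ p * chartCoord (n := n) x₀ i p :=
    contMDiff_of_tsupport fun p hp =>
      (hχ p).mul (contMDiffAt_chartCoord i (hs (tsupport_mul_subset_left hp)))
  refine contMDiff_of_tsupport fun p hp => ?_
  have hp' : p ∈ (extChartAt (𝓡 n) x₀).source := by
    simp only [pow_two, mul_assoc] at hp
    exact hs (tsupport_mul_subset_left hp)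
  have key : ContMDiffAt (𝓡 n) 𝓘(ℝ) ∞ (fun p => χ p *
      (y p (mvfderiv (𝓡 n) (fun p => χ p * chartCoord (n := n) x₀ i p) p) -
        chartCoord (n := n) x₀ i p * y p (mvfderiv (𝓡 n) χ p))) p :=
    (hχ p).mul ((hy _ hc p).sub ((contMDiffAt_chartCoord i hp').mul (hy _ hχ p)))
  refine key.congr_of_eventuallyEq (Filter.eventuallyEq_of_mem
    ((isOpen_extChartAt_source x₀).mem_nhds hp') fun q hq => ?_)
  have := mvfderiv_fun_mul ((hχ q).mdifferentiableAt (by simp))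
    ((contMDiffAt_chartCoord i hq).mdifferentiableAt (by simp))
  simp only [this, map_add, map_smul, smul_eq_mul]
  ring

variable [MeasurableSpace M] [BorelSpace M] [RiemannianBundle (fun x : M => TangentSpace (𝓡 n) x)]
  [IsContMDiffRiemannianBundle (𝓡 n) ∞ (EuclideanSpace ℝ (Fin n))
      (fun x : M => TangentSpace (𝓡 n) x)]

/-- Integration by parts against a smooth vector field, given as a family of linear forms `y x` on
the cotangent spaces. -/
theorem exists_divergence {y : ∀ x : M, Cotangent n x →ₗ[ℝ] ℝ}
    (hy : ∀ f : M → ℝ, ContMDiff (𝓡 n) 𝓘(ℝ) ∞ f →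
      ContMDiff (𝓡 n) 𝓘(ℝ) ∞ fun x => y x (mvfderiv (𝓡 n) f x)) :
    ∃ d : M → ℝ, Continuous d ∧ ∀ f : M → ℝ, ContMDiff (𝓡 n) 𝓘(ℝ) ∞ f →
      ∫ p, y p (mvfderiv (𝓡 n) f p) ∂(riemannianVolume n M) =
        -∫ p, d p * f p ∂(riemannianVolume n M) := by
  have := isFiniteMeasure_riemannianVolume (n := n) (M := M)
  obtain ⟨t, χ, hχ, hs, h1⟩ := exists_finite_sq_partition (n := n)
    (fun x : M => (extChartAt (𝓡 n) x).source) (fun x => extChartAt_source_mem_nhds x)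
  let h : M → Fin n → M → ℝ := fun x i p =>
    χ x p ^ 2 * y p (mvfderiv (𝓡 n) (chartCoord (n := n) x i) p)
  have hh : ∀ x i, ContMDiff (𝓡 n) 𝓘(ℝ) ∞ (h x i) := fun x i =>
    contMDiff_sq_mul_chartCoord (hχ x) (hs x) hy i
  have hhs : ∀ x i, tsupport (h x i) ⊆ (extChartAt (𝓡 n) x).source := fun x i => by
    refine subset_trans ?_ (hs x)
    simp only [h, pow_two, mul_assoc]
    exact tsupport_mul_subset_left
  choose d hd hdf using fun x i => exists_integral_mul_chartDeriv x i (hh x i) (hhs x i)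
  have hint : ∀ u : M → ℝ, Continuous u → Integrable u (riemannianVolume n M) := fun u hu =>
    hu.integrable_of_hasCompactSupport (HasCompactSupport.of_compactSpace u)
  refine ⟨fun p => ∑ x ∈ t, ∑ i, d x i p, by fun_prop, fun f hf => ?_⟩
  -- Insert 1 = ∑χ² and expand df in the coordinates of each chart; the components of the localized
  -- field are the functions `h x i`.
  have e : ∀ p, y p (mvfderiv (𝓡 n) f p) = ∑ x ∈ t, ∑ i, h x i p * chartDeriv x i f p := by
    intro p
    rw [← one_mul (y p (mvfderiv (𝓡 n) f p)), ← h1 p, Finset.sum_mul]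
    refine Finset.sum_congr rfl fun x _ => ?_
    by_cases hp : p ∈ (extChartAt (𝓡 n) x).source
    · rw [mvfderiv_eq_sum_chartDeriv hp hf, map_sum, Finset.mul_sum]
      refine Finset.sum_congr rfl fun i _ => ?_
      rw [map_smul, smul_eq_mul]
      ring
    · have : χ x p = 0 := image_eq_zero_of_notMem_tsupport fun h => hp (hs x h)
      simp [h, this]
  simp only [e, Finset.sum_mul]
  rw [integral_finsetSum, integral_finsetSum, ← Finset.sum_neg_distrib]
  · refine Finset.sum_congr rfl fun x _ => ?_
    rw [integral_finsetSum, integral_finsetSum, ← Finset.sum_neg_distrib]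
    · exact Finset.sum_congr rfl fun i _ => hdf x i f hf
    · exact fun i _ => hint _ ((hd x i).mul hf.continuous)
    · exact fun i _ => hint _ (continuous_mul_chartDeriv i (hh x i).continuous (hhs x i) hf)
  · exact fun x _ => hint _ (continuous_finsetSum _ fun i _ => (hd x i).mul hf.continuous)
  · exact fun x _ => hint _ (continuous_finsetSum _ fun i _ =>
      continuous_mul_chartDeriv i (hh x i).continuous (hhs x i) hf)

end Divergence

/-! ### Smooth sections, generating families and lower bounds -/

section SmoothSections

variable (n : ℕ) {M : Type u} [TopologicalSpace M] [ChartedSpace (EuclideanSpace ℝ (Fin n)) M]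
  (FE : Type*) [NormedAddCommGroup FE] [NormedSpace ℝ FE]
  {E : M → Type*} [TopologicalSpace (TotalSpace FE E)]
  [∀ x, NormedAddCommGroup (E x)] [∀ x, InnerProductSpace ℝ (E x)] [FiberBundle FE E]

/-- The section `ξ` is smooth at `x`. -/
abbrev SmoothSectionAt (ξ : ∀ x, E x) (x : M) : Prop :=
  ContMDiffAt (𝓡 n) ((𝓡 n).prod 𝓘(ℝ, FE)) ∞ (fun x => TotalSpace.mk' FE x (ξ x)) x

/-- The section `ξ` is smooth. -/
abbrev SmoothSection (ξ : ∀ x, E x) : Prop :=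
  ContMDiff (𝓡 n) ((𝓡 n).prod 𝓘(ℝ, FE)) ∞ (fun x => TotalSpace.mk' FE x (ξ x))

/-- The family of maps `A x` sends sections of `E` which are smooth at a point to sections of `F`
which are smooth there. -/
def PreservesSmooth (FF : Type*) [NormedAddCommGroup FF] [NormedSpace ℝ FF]
    {F : M → Type*} [TopologicalSpace (TotalSpace FF F)]
    [∀ x, NormedAddCommGroup (F x)] [∀ x, InnerProductSpace ℝ (F x)] [FiberBundle FF F]
    (A : ∀ x, E x →L[ℝ] F x) : Prop :=
  ∀ (ξ : ∀ x, E x) (x : M), SmoothSectionAt n FE ξ x → SmoothSectionAt n FF (fun x => A x (ξ x)) x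

end SmoothSections

/-- Expanding the square reduces joint continuity in the base point and the coefficients to the
continuity of finitely many inner products. It feeds the tube lemma in `exists_local_lower_bound`.
-/
theorem continuousOn_norm_sq_linearCombination {X ι : Type*} [TopologicalSpace X] [Fintype ι]
    {G : X → Type*} [∀ x, NormedAddCommGroup (G x)] [∀ x, InnerProductSpace ℝ (G x)]
    {u : ι → ∀ x, G x} {U : Set X} (h : ∀ a b, ContinuousOn (fun x => ⟪u a x, u b x⟫_ℝ) U) :
    ContinuousOn (fun z : X × (ι → ℝ) => ‖∑ a, z.2 a • u a z.1‖ ^ 2) (U ×ˢ Set.univ) := by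
  have e : ∀ z : X × (ι → ℝ), ‖∑ a, z.2 a • u a z.1‖ ^ 2 =
      ∑ a, ∑ b, z.2 a * (z.2 b * ⟪u a z.1, u b z.1⟫_ℝ) := fun z => by
    rw [← real_inner_self_eq_norm_sq, sum_inner]
    refine Finset.sum_congr rfl fun a _ => ?_
    rw [inner_sum]
    refine Finset.sum_congr rfl fun b _ => ?_
    rw [real_inner_smul_left, real_inner_smul_right]
  simp only [e]
  refine continuousOn_finsetSum _ fun a _ => continuousOn_finsetSum _ fun b _ => ?_
  have h1 : ∀ a, ContinuousOn (fun z : X × (ι → ℝ) => z.2 a) (U ×ˢ Set.univ) := fun a =>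
    ((continuous_apply a).comp continuous_snd).continuousOn
  exact (h1 a).mul ((h1 b).mul ((h a b).comp continuousOn_fst fun z hz => hz.1))

section Families

variable {n : ℕ} {M : Type u} [TopologicalSpace M] [ChartedSpace (EuclideanSpace ℝ (Fin n)) M]
  [IsManifold (𝓡 n) ∞ M]
  {FE : Type*} [NormedAddCommGroup FE] [NormedSpace ℝ FE] [FiniteDimensional ℝ FE]
  {E : M → Type*} [TopologicalSpace (TotalSpace FE E)]
  [∀ x, NormedAddCommGroup (E x)] [∀ x, InnerProductSpace ℝ (E x)]
  [FiberBundle FE E] [VectorBundle ℝ FE E] [ContMDiffVectorBundle ∞ FE E (𝓡 n)]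
  [IsContMDiffRiemannianBundle (𝓡 n) ∞ FE E]

/-- Over a compact manifold, every vector bundle is generated by finitely many smooth sections
`s a`, with smooth and bounded coefficients `c a`. -/
theorem exists_generating_family [CompactSpace M] [T2Space M] :
    ∃ (ι : Type u) (_ : Fintype ι) (s : ι → ∀ x, E x) (c : ι → ∀ x, E x →ₗ[ℝ] ℝ) (K : ℝ),
      (∀ a, SmoothSection n FE (s a)) ∧
      (∀ a ξ, SmoothSection n FE ξ → ContMDiff (𝓡 n) 𝓘(ℝ) ∞ fun x => c a x (ξ x)) ∧
      (∀ x e, e = ∑ a, c a x e • s a x) ∧ ∀ a x e, |c a x e| ≤ K * ‖e‖ := by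
  have hcont : IsContinuousRiemannianBundle FE E := by
    obtain ⟨g, hg, h⟩ := IsContMDiffRiemannianBundle.exists_contMDiff (IB := 𝓡 n) (n := ∞)
      (F := FE) (E := E)
    exact ⟨g, hg.continuous, h⟩
  have : ContMDiffVectorBundle 1 FE E (𝓡 n) := ContMDiffVectorBundle.of_le (n := ∞) (by simp)
  choose C hC0 hC using fun x => eventually_norm_trivializationAt_lt FE E x
  let U : M → Set M := fun x => (trivializationAt FE E x).baseSet ∩
    {y | ‖(trivializationAt FE E x).continuousLinearMapAt ℝ y‖ < C x}
  obtain ⟨t, χ, hχ, hs, h1⟩ := exists_finite_sq_partition (n := n) U fun x =>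
    Filter.inter_mem ((trivializationAt FE E x).open_baseSet.mem_nhds
      (FiberBundle.mem_baseSet_trivializationAt' x)) (hC x)
  let b := Module.finBasis ℝ FE
  let L : FE →L[ℝ] (Fin (Module.finrank ℝ FE) → ℝ) := b.equivFunL
  -- Each local frame is multiplied by χ and its coefficient functions by the same χ: both become
  -- global, and their products sum to the identity because ∑χ² = 1.
  refine ⟨t × Fin (Module.finrank ℝ FE), inferInstance,
    fun a x => χ a.1 x • (trivializationAt FE E (a.1 : M)).localFrame b a.2 x,
    fun a x => χ a.1 x • (trivializationAt FE E (a.1 : M)).localFrameCoeff (𝓡 n) b a.2 x,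
    ‖L‖ * ∑ x ∈ t, C x, fun a => ?_, fun a ξ hξ => ?_, fun x e => ?_, fun a x e => ?_⟩
  · exact ContMDiffOn.smul_section_of_tsupport (hχ _).contMDiffOn
      (trivializationAt FE E (a.1 : M)).open_baseSet ((hs _).trans Set.inter_subset_left)
      ((trivializationAt FE E (a.1 : M)).contMDiffOn_localFrame_baseSet (I := 𝓡 n) ∞ b a.2)
  · refine contMDiff_of_tsupport fun x hx => ?_
    have hx' : x ∈ (trivializationAt FE E (a.1 : M)).baseSet :=
      (hs _ (tsupport_mul_subset_left hx)).1
    exact (hχ _ x).mul (contMDiffAt_localFrameCoeff b hx' (hξ x) a.2)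
  · rw [Fintype.sum_prod_type]
    conv_lhs => rw [← one_smul ℝ e, ← h1 x, Finset.sum_smul, ← Finset.sum_coe_sort]
    refine Finset.sum_congr rfl fun z _ => ?_
    by_cases hx : x ∈ (trivializationAt FE E (z : M)).baseSet
    · obtain ⟨ξ, rfl⟩ : ∃ ξ : ∀ y, E y, ξ x = e := by
        classical exact ⟨Function.update 0 x e, Function.update_self _ _ _⟩
      conv_lhs => rw [(trivializationAt FE E (z : M)).eq_sum_localFrameCoeff_smul (I := 𝓡 n)
        (b := b) (s := ξ) hx, Finset.smul_sum]
      refine Finset.sum_congr rfl fun i _ => ?_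
      simp only [LinearMap.smul_apply, smul_smul, smul_eq_mul]
      congr 1
      ring
    · have : χ z x = 0 := image_eq_zero_of_notMem_tsupport fun h => hx (hs _ h).1
      simp [this]
  -- The neighbourhoods `U` were chosen so that the trivializations have norm less than `C` on them,
  -- which bounds the coefficients on the support of χ.
  · have hχ1 : |χ a.1 x| ≤ 1 := by
      rw [← sq_le_one_iff_abs_le_one, ← h1 x]
      exact Finset.single_le_sum (f := fun z => χ z x ^ 2) (fun _ _ => sq_nonneg _) a.1.2
    by_cases hx : x ∈ tsupport (χ a.1)
    · obtain ⟨hxb, hxC⟩ := hs _ hx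
      have hxC' : ‖(trivializationAt FE E (a.1 : M)).continuousLinearMapAt ℝ x‖ ≤ ∑ x ∈ t, C x :=
        (le_of_lt hxC).trans (Finset.single_le_sum (f := C) (fun x _ => (hC0 x).le) a.1.2)
      obtain ⟨ξ, rfl⟩ : ∃ ξ : ∀ y, E y, ξ x = e := by
        classical exact ⟨Function.update 0 x e, Function.update_self _ _ _⟩
      have h2 : (trivializationAt FE E (a.1 : M)).localFrameCoeff (𝓡 n) b a.2 x (ξ x) =
          L ((trivializationAt FE E (a.1 : M)).continuousLinearMapAt ℝ x (ξ x)) a.2 := by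
        rw [(trivializationAt FE E (a.1 : M)).localFrameCoeff_eq_coeff hxb,
          Trivialization.continuousLinearMapAt_apply, Trivialization.coe_linearMapAt_of_mem _ hxb]
        rfl
      simp only [LinearMap.smul_apply, smul_eq_mul, abs_mul, h2]
      calc |χ a.1 x| * |L ((trivializationAt FE E (a.1 : M)).continuousLinearMapAt ℝ x (ξ x)) a.2|
          ≤ 1 * ‖L ((trivializationAt FE E (a.1 : M)).continuousLinearMapAt ℝ x (ξ x))‖ := by
            gcongr
            exact norm_le_pi_norm (L ((trivializationAt FE E (a.1 : M)).continuousLinearMapAt ℝ x (ξ x))) a.2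
        _ ≤ ‖L‖ * (‖(trivializationAt FE E (a.1 : M)).continuousLinearMapAt ℝ x‖ * ‖ξ x‖) := by
            rw [one_mul]
            exact (L.le_opNorm _).trans (by gcongr; exact ContinuousLinearMap.le_opNorm _ _)
        _ ≤ ‖L‖ * (∑ x ∈ t, C x) * ‖ξ x‖ := by
            rw [mul_assoc]
            gcongr
    · have : χ a.1 x = 0 := image_eq_zero_of_notMem_tsupport hx
      have h0 : 0 ≤ ∑ x ∈ t, C x := Finset.sum_nonneg fun x _ => (hC0 x).le
      simp only [this, zero_smul, LinearMap.zero_apply, abs_zero]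
      positivity

/-- The subbundle is the image of a projection `p`, and no local frame of it is chosen: the
quadratic form |Ape|² + |e − pe|² on all of `E` is positive definite at x₀ and restricts to |Ae|²
where pe = e. Positivity on the compact unit sphere of coefficients persists near x₀. -/
theorem exists_local_lower_bound {FF : Type*} [NormedAddCommGroup FF] [NormedSpace ℝ FF]
    {F : M → Type*} [TopologicalSpace (TotalSpace FF F)]
    [∀ x, NormedAddCommGroup (F x)] [∀ x, InnerProductSpace ℝ (F x)]
    [∀ x, FiniteDimensional ℝ (E x)]
    [FiberBundle FF F] [VectorBundle ℝ FF F] [IsContMDiffRiemannianBundle (𝓡 n) ∞ FF F]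
    {p : ∀ x, E x →L[ℝ] E x} {A : ∀ x, E x →L[ℝ] F x} (hp : PreservesSmooth n FE FE p)
    (hA : PreservesSmooth n FE FF A) {x₀ : M}
    (h₀ : ∀ e, A x₀ (p x₀ e) = 0 → p x₀ e = 0) :
    ∃ κ > 0, ∀ᶠ x in nhds x₀, ∀ e, p x e = e → κ * ‖e‖ ^ 2 ≤ ‖A x e‖ ^ 2 := by
  let f : E x₀ →L[ℝ] F x₀ × E x₀ := (A x₀ ∘L p x₀).prod (ContinuousLinearMap.id ℝ _ - p x₀)
  obtain ⟨K, hK, hf⟩ := f.toLinearMap.exists_antilipschitzWith (by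
    rw [LinearMap.ker_eq_bot']
    intro e he
    obtain ⟨h1, h2⟩ := Prod.mk.inj he
    have h1' : A x₀ (p x₀ e) = 0 := h1
    have h2' : e - p x₀ e = 0 := h2
    rwa [h₀ e h1', sub_zero] at h2')
  let b := Module.finBasis ℝ FE
  let tr := trivializationAt FE E x₀
  let s : Fin (Module.finrank ℝ FE) → ∀ x, E x := tr.localFrame b
  have hs : ∀ a, ∀ x ∈ tr.baseSet, SmoothSectionAt n FE (s a) x := fun a x hx =>
    (tr.contMDiffOn_localFrame_baseSet (I := 𝓡 n) ∞ b a).contMDiffAt (tr.open_baseSet.mem_nhds hx)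
  let V := Fin (Module.finrank ℝ FE) → ℝ
  let e : ∀ x, V →ₗ[ℝ] E x := fun x => Fintype.linearCombination ℝ fun a => s a x
  let q : M × V → ℝ := fun z => ‖A z.1 (p z.1 (e z.1 z.2))‖ ^ 2 + ‖e z.1 z.2 - p z.1 (e z.1 z.2)‖ ^ 2
  let g : M × V → ℝ := fun z => ‖e z.1 z.2‖ ^ 2
  have hps : ∀ a, ∀ x ∈ tr.baseSet, SmoothSectionAt n FE (fun x => p x (s a x)) x :=
    fun a x hx => hp _ x (hs a x hx)
  have hsps : ∀ a, ∀ x ∈ tr.baseSet, SmoothSectionAt n FE (fun x => s a x - p x (s a x)) x :=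
    fun a x hx => (hs a x hx).sub_section (hps a x hx)
  have hq : ContinuousOn q (tr.baseSet ×ˢ Set.univ) := by
    have h1 := continuousOn_norm_sq_linearCombination (U := tr.baseSet)
      (u := fun a x => A x (p x (s a x))) fun a b x hx =>
      ((hA _ x (hps a x hx)).inner_bundle (hA _ x (hps b x hx))).continuousAt.continuousWithinAt
    have h2 := continuousOn_norm_sq_linearCombination (U := tr.baseSet)
      (u := fun a x => s a x - p x (s a x)) fun a b x hx =>
      ((hsps a x hx).inner_bundle (hsps b x hx)).continuousAt.continuousWithinAt
    refine (h1.add h2).congr fun z _ => ?_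
    have he : e z.1 z.2 = ∑ a, z.2 a • s a z.1 := rfl
    simp only [q, he, Pi.add_apply, map_sum, map_smul, smul_sub, Finset.sum_sub_distrib]
  have hg : ContinuousOn g (tr.baseSet ×ˢ Set.univ) :=
    continuousOn_norm_sq_linearCombination (U := tr.baseSet) (u := s) fun a b x hx =>
      ((hs a x hx).inner_bundle (hs b x hx)).continuousAt.continuousWithinAt
  have hK' : (0 : ℝ) < K := hK
  -- At x₀ the antilipschitz bound gives g ≤ K²q; the extra factor 2 makes q − κg strictly positive,
  -- an open condition.
  let κ : ℝ := 1 / (2 * (K : ℝ) ^ 2)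
  have hκ : 0 < κ := by positivity
  have hx₀ : x₀ ∈ tr.baseSet := FiberBundle.mem_baseSet_trivializationAt' x₀
  have hopen : IsOpen ((tr.baseSet ×ˢ Set.univ) ∩ (fun z => q z - κ * g z) ⁻¹' Set.Ioi 0) :=
    (hq.sub (continuousOn_const.mul hg)).isOpen_inter_preimage
      (tr.open_baseSet.prod isOpen_univ) isOpen_Ioi
  have hpt : ∀ v : V, v ≠ 0 → 0 < q (x₀, v) - κ * g (x₀, v) := by
    intro v hv
    have hev : e x₀ v ≠ 0 := by
      have hli := (tr.isLocalFrameOn_localFrame_baseSet (𝓡 n) ∞ b).linearIndependent hx₀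
      rw [Fintype.linearIndependent_iff] at hli
      intro h0
      exact hv (funext (hli v h0))
    have h1 := hf.le_mul_dist (e x₀ v) 0
    rw [map_zero, dist_zero_right, dist_zero_right] at h1
    have h2 : ‖f (e x₀ v)‖ ^ 2 ≤ q (x₀, v) := by
      rw [Prod.norm_def]
      rcases max_cases ‖(f (e x₀ v)).1‖ ‖(f (e x₀ v)).2‖ with h | h <;> rw [h.1]
      · exact le_add_of_nonneg_right (sq_nonneg _)
      · exact le_add_of_nonneg_left (sq_nonneg _)
    have h3 : g (x₀, v) ≤ (K : ℝ) ^ 2 * q (x₀, v) := by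
      calc ‖e x₀ v‖ ^ 2 ≤ (K * ‖f (e x₀ v)‖) ^ 2 := by gcongr; exact h1
        _ ≤ (K : ℝ) ^ 2 * q (x₀, v) := by rw [mul_pow]; gcongr
    have h4 : 0 < g (x₀, v) := by
      have := norm_pos_iff.2 hev
      positivity
    have h5 : κ * g (x₀, v) ≤ q (x₀, v) / 2 := by
      calc κ * g (x₀, v) ≤ κ * ((K : ℝ) ^ 2 * q (x₀, v)) := by gcongr
        _ = q (x₀, v) / 2 := by simp only [κ]; field_simp
    have h6 : 0 < κ * g (x₀, v) := mul_pos hκ h4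
    linarith
  -- The open set contains {x₀} × sphere, hence U × sphere for a neighbourhood U of x₀.
  obtain ⟨U, W, hU, -, hxU, hSW, hUW⟩ := generalized_tube_lemma isCompact_singleton
    (isCompact_sphere (0 : V) 1) hopen (s := {x₀}) (by
      rintro ⟨x, v⟩ ⟨hx, hv⟩
      obtain rfl : x = x₀ := hx
      refine ⟨⟨hx₀, trivial⟩, hpt v ?_⟩
      rintro rfl
      simp at hv)
  refine ⟨κ, hκ, Filter.mem_of_superset (Filter.inter_mem (hU.mem_nhds (hxU rfl))
    (tr.open_baseSet.mem_nhds hx₀)) fun x hx w hw => ?_⟩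
  obtain ⟨v, rfl⟩ : ∃ v, e x v = w := by
    have := (tr.isLocalFrameOn_localFrame_baseSet (𝓡 n) ∞ b).generating hx.2
    rw [← Fintype.range_linearCombination] at this
    exact this trivial
  rcases eq_or_ne v 0 with rfl | hv
  · simp
  have hv' : 0 < ‖v‖ := norm_pos_iff.2 hv
  have h1 : 0 < q (x, ‖v‖⁻¹ • v) - κ * g (x, ‖v‖⁻¹ • v) :=
    (hUW ⟨hx.1, hSW (by simp [norm_smul, hv'.ne'])⟩).2
  -- Homogeneity of degree two carries the inequality from the sphere to all coefficients.
  have h2 : q (x, ‖v‖⁻¹ • v) - κ * g (x, ‖v‖⁻¹ • v) = ‖v‖⁻¹ ^ 2 * (q (x, v) - κ * g (x, v)) := by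
    simp only [q, g, map_smul, ← smul_sub, norm_smul, norm_inv, norm_norm]
    ring
  have h3 : 0 < q (x, v) - κ * g (x, v) := by
    rw [h2] at h1
    exact pos_of_mul_pos_right h1 (by positivity)
  simp only [q, g, hw, sub_self, norm_zero] at h3
  linarith

/-- Compact induction from the local bounds, a finite union being served by the smaller constant. -/
theorem exists_lower_bound {FF : Type*} [NormedAddCommGroup FF] [NormedSpace ℝ FF]
    {F : M → Type*} [TopologicalSpace (TotalSpace FF F)]
    [∀ x, NormedAddCommGroup (F x)] [∀ x, InnerProductSpace ℝ (F x)]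
    [∀ x, FiniteDimensional ℝ (E x)]
    [FiberBundle FF F] [VectorBundle ℝ FF F] [IsContMDiffRiemannianBundle (𝓡 n) ∞ FF F]
    {p : ∀ x, E x →L[ℝ] E x} {A : ∀ x, E x →L[ℝ] F x} (hp : PreservesSmooth n FE FE p)
    (hA : PreservesSmooth n FE FF A) {K : Set M} (hK : IsCompact K)
    (h₀ : ∀ x ∈ K, ∀ e, A x (p x e) = 0 → p x e = 0) :
    ∃ κ > 0, ∀ x ∈ K, ∀ e, p x e = e → κ * ‖e‖ ^ 2 ≤ ‖A x e‖ ^ 2 := by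
  refine hK.induction_on (p := fun K => ∃ κ > 0, ∀ x ∈ K, ∀ e, p x e = e →
    κ * ‖e‖ ^ 2 ≤ ‖A x e‖ ^ 2) ⟨1, one_pos, by simp⟩ ?_ ?_ ?_
  · rintro s t hst ⟨κ, hκ, h⟩
    exact ⟨κ, hκ, fun x hx => h x (hst hx)⟩
  · rintro s t ⟨κ, hκ, h⟩ ⟨κ', hκ', h'⟩
    refine ⟨min κ κ', lt_min hκ hκ', ?_⟩
    rintro x (hx | hx) e he
    · exact le_trans (by gcongr; exact min_le_left _ _) (h x hx e he)
    · exact le_trans (by gcongr; exact min_le_right _ _) (h' x hx e he)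
  · intro x hx
    obtain ⟨κ, hκ, h⟩ := exists_local_lower_bound hp hA (h₀ x hx)
    exact ⟨_, mem_nhdsWithin_of_mem_nhds h, κ, hκ, fun y hy => hy⟩

end Families

/-! ### The concentration estimate -/

theorem integrable_riemannianVolume {n : ℕ} {M : Type*} [TopologicalSpace M] [CompactSpace M]
    [MeasurableSpace M] [BorelSpace M] [ChartedSpace (EuclideanSpace ℝ (Fin n)) M]
    [IsManifold (𝓡 n) ∞ M] [RiemannianBundle (fun x : M => TangentSpace (𝓡 n) x)]
    [IsContMDiffRiemannianBundle (𝓡 n) ∞ (EuclideanSpace ℝ (Fin n))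
      (fun x : M => TangentSpace (𝓡 n) x)] {f : M → ℝ} (hf : Continuous f) :
    Integrable f (riemannianVolume n M) := by
  have := isFiniteMeasure_riemannianVolume (n := n) (M := M)
  exact hf.integrable_of_hasCompactSupport (HasCompactSupport.of_compactSpace f)

section Estimates

variable {n : ℕ} {M : Type u} [EMetricSpace M] [CompactSpace M] [MeasurableSpace M] [BorelSpace M]
  [ChartedSpace (EuclideanSpace ℝ (Fin n)) M] [IsManifold (𝓡 n) ∞ M]
  [RiemannianBundle (fun x : M => TangentSpace (𝓡 n) x)]
  [IsContMDiffRiemannianBundle (𝓡 n) ∞ (EuclideanSpace ℝ (Fin n))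
    (fun x : M => TangentSpace (𝓡 n) x)]
  {FE : Type*} [NormedAddCommGroup FE] [NormedSpace ℝ FE] [FiniteDimensional ℝ FE]
  {E : M → Type*} [TopologicalSpace (TotalSpace FE E)]
  [∀ x, NormedAddCommGroup (E x)] [∀ x, InnerProductSpace ℝ (E x)]
  [∀ x, FiniteDimensional ℝ (E x)]
  [FiberBundle FE E] [VectorBundle ℝ FE E] [ContMDiffVectorBundle ∞ FE E (𝓡 n)]
  [IsContMDiffRiemannianBundle (𝓡 n) ∞ FE E]
  {FF : Type*} [NormedAddCommGroup FF] [NormedSpace ℝ FF]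
  {F : M → Type*} [TopologicalSpace (TotalSpace FF F)]
  [∀ x, NormedAddCommGroup (F x)] [∀ x, InnerProductSpace ℝ (F x)]
  [FiberBundle FF F] [VectorBundle ℝ FF F] [ContMDiffVectorBundle ∞ FF F (𝓡 n)]
  [IsContMDiffRiemannianBundle (𝓡 n) ∞ FF F]
  {E' : ∀ x, Submodule ℝ (E x)} {p : ∀ x, E x →L[ℝ] E x}
  {D : (∀ x, E x) → ∀ x, F x} {σ : ∀ x : M, Cotangent n x →ₗ[ℝ] (E x →L[ℝ] F x)}
  {A : ∀ x, E x →L[ℝ] F x}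

/-- For a first order operator `D` with symbol `σ` such that `A* σ(u)` is symmetric, the form
`∫ ⟪D ξ, A ξ⟫` is of order zero. -/
theorem exists_abs_integral_inner_le (hp : PreservesSmooth n FE FE p)
    (hpE : ∀ x e, p x e ∈ E' x) (hpid : ∀ x, ∀ e ∈ E' x, p x e = e)
    (hD : ∀ ξ ∈ sectionsIn n FE E', SmoothSection n FF (D ξ))
    (hadd : ∀ ξ ∈ sectionsIn n FE E', ∀ η ∈ sectionsIn n FE E', ∀ x,
      D (fun y => ξ y + η y) x = D ξ x + D η x)
    (hleib : ∀ ξ ∈ sectionsIn n FE E', ∀ f : M → ℝ, ContMDiff (𝓡 n) 𝓘(ℝ) ∞ f → ∀ x,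
      D (fun y => f y • ξ y) x = σ x (mvfderiv (𝓡 n) f x) (ξ x) + f x • D ξ x)
    (hA : PreservesSmooth n FE FF A)
    (hsymm : ∀ x u, ∀ e ∈ E' x, ∀ e' ∈ E' x, ⟪σ x u e, A x e'⟫_ℝ = ⟪σ x u e', A x e⟫_ℝ) :
    ∃ C, 0 ≤ C ∧ ∀ ξ ∈ sectionsIn n FE E',
      |∫ x, ⟪D ξ x, A x (ξ x)⟫_ℝ ∂(riemannianVolume n M)| ≤
        C * ∫ x, ‖ξ x‖ ^ 2 ∂(riemannianVolume n M) := by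
  obtain ⟨ι, _, s, c, K, hs, hc, hsum, hcK⟩ := exists_generating_family (n := n) (FE := FE) (E := E)
  let t : ι → ∀ x, E x := fun a x => p x (s a x)
  have ht : ∀ a, t a ∈ sectionsIn n FE E' := fun a => ⟨fun x => hp _ x (hs a x), fun x => hpE x _⟩
  have hsmul : ∀ f : M → ℝ, ContMDiff (𝓡 n) 𝓘(ℝ) ∞ f → ∀ a,
      (fun y => f y • t a y) ∈ sectionsIn n FE E' := fun f hf a =>
    ⟨hf.smul_section (ht a).1, fun x => (E' x).smul_mem _ ((ht a).2 x)⟩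
  have hAt : ∀ a, SmoothSection n FF fun x => A x (t a x) := fun a x => hA _ x ((ht a).1 x)
  let y : ι → ι → ∀ x : M, Cotangent n x →ₗ[ℝ] ℝ := fun a b x =>
    (innerₛₗ ℝ (A x (t b x))) ∘ₗ ((LinearMap.applyₗ (t a x)) ∘ₗ
      ((ContinuousLinearMap.coeLM ℝ) ∘ₗ σ x))
  have hy : ∀ a b x u, y a b x u = ⟪σ x u (t a x), A x (t b x)⟫_ℝ := fun a b x u =>
    real_inner_comm _ _
  have hysymm : ∀ a b x u, y a b x u = y b a x u := fun a b x u => by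
    rw [hy, hy, hsymm x u _ ((ht a).2 x) _ ((ht b).2 x)]
  have hysmooth : ∀ a b (f : M → ℝ), ContMDiff (𝓡 n) 𝓘(ℝ) ∞ f →
      ContMDiff (𝓡 n) 𝓘(ℝ) ∞ fun x => y a b x (mvfderiv (𝓡 n) f x) := by
    intro a b f hf
    -- The Leibniz rule writes σ(df)tₐ as D(ftₐ) − fDtₐ, which is smooth, so the pairing is a smooth
    -- vector field with no separate smoothness assumption on σ.
    have h1 : SmoothSection n FF (fun x => D (fun y => f y • t a y) x - f x • D (t a) x) :=
      (hD _ (hsmul f hf a)).sub_section (hf.smul_section (hD _ (ht a)))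
    refine (h1.inner_bundle (hAt b)).congr fun x => ?_
    rw [hy, hleib _ (ht a) f hf, add_sub_cancel_right]
  choose d hd hdf using fun a b => exists_divergence (hysmooth a b)
  -- These are the coefficients of vₐv_b that remain after integration by parts; the half comes from
  -- ½ yₐ_b(d(vₐv_b)).
  let r : ι → ι → M → ℝ := fun a b x => ⟪D (t a) x, A x (t b x)⟫_ℝ - d a b x / 2
  have hm : ∀ a b, Continuous fun x => ⟪D (t a) x, A x (t b x)⟫_ℝ := fun a b =>
    ((hD _ (ht a)).inner_bundle (hAt b)).continuous
  have hr : ∀ a b, Continuous (r a b) := fun a b => (hm a b).sub ((hd a b).div_const 2)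
  choose R hR using fun a b => (isCompact_univ.exists_bound_of_continuousOn (hr a b).continuousOn)
  -- The bounds `R a b` themselves may be negative if `M` is empty, so absolute values enter the
  -- constant.
  have hR0 : ∀ a b, 0 ≤ |R a b| := fun a b => abs_nonneg _
  refine ⟨∑ a, ∑ b, |R a b| * K ^ 2, by positivity, fun ξ hξ => ?_⟩
  let v : ι → M → ℝ := fun a x => c a x (ξ x)
  have hv : ∀ a, ContMDiff (𝓡 n) 𝓘(ℝ) ∞ (v a) := fun a => hc a ξ hξ.1
  have hξs : ξ = fun x => ∑ a, v a x • t a x := by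
    ext x
    conv_lhs => rw [← hpid x _ (hξ.2 x), hsum x (ξ x)]
    simp only [map_sum, map_smul]
    rfl
  have hDsum : ∀ x, D ξ x = ∑ a, (σ x (mvfderiv (𝓡 n) (v a) x) (t a x) + v a x • D (t a) x) := by
    classical
    have key : ∀ S : Finset ι, (fun x => ∑ a ∈ S, v a x • t a x) ∈ sectionsIn n FE E' ∧
        ∀ x, D (fun x => ∑ a ∈ S, v a x • t a x) x =
          ∑ a ∈ S, (σ x (mvfderiv (𝓡 n) (v a) x) (t a x) + v a x • D (t a) x) := by
      intro S
      induction S using Finset.induction_on with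
      | empty =>
        have h0 : (fun x => (0 : E x)) ∈ sectionsIn n FE E' :=
          ⟨contMDiff_zeroSection ℝ E, fun x => zero_mem _⟩
        refine ⟨by simpa using h0, fun x => ?_⟩
        -- Additivity applied to 0 + 0 forces D0 = 0, the base of the induction.
        have := hadd _ h0 _ h0 x
        simpa using this
      | insert a S ha ih =>
        simp only [Finset.sum_insert ha]
        refine ⟨⟨(hsmul _ (hv a) a).1.add_section ih.1.1,
          fun x => add_mem ((hsmul _ (hv a) a).2 x) (ih.1.2 x)⟩, fun x => ?_⟩
        rw [hadd _ (hsmul _ (hv a) a) _ ih.1, ih.2, hleib _ (ht a) _ (hv a)]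
    intro x
    conv_lhs => rw [hξs]
    exact (key Finset.univ).2 x
  have hvv : ∀ a b, ContMDiff (𝓡 n) 𝓘(ℝ) ∞ fun x => v a x * v b x := fun a b => (hv a).mul (hv b)
  have hpt : ∀ x, ⟪D ξ x, A x (ξ x)⟫_ℝ = ∑ a, ∑ b,
      (y a b x (mvfderiv (𝓡 n) (fun x => v a x * v b x) x) / 2 +
        ⟪D (t a) x, A x (t b x)⟫_ℝ * (v a x * v b x)) := by
    intro x
    have h1 : ⟪D ξ x, A x (ξ x)⟫_ℝ = ∑ a, ∑ b, (v b x * y a b x (mvfderiv (𝓡 n) (v a) x) +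
        ⟪D (t a) x, A x (t b x)⟫_ℝ * (v a x * v b x)) := by
      have : A x (ξ x) = ∑ b, v b x • A x (t b x) := by
        conv_lhs => rw [hξs]
        simp only [map_sum, map_smul]
      rw [hDsum, this, sum_inner]
      refine Finset.sum_congr rfl fun a _ => ?_
      rw [inner_sum]
      refine Finset.sum_congr rfl fun b _ => ?_
      rw [inner_smul_right, inner_add_left, inner_smul_left, hy]
      simp only [RCLike.conj_to_real]
      ring
    have h2 : ∀ a b, y a b x (mvfderiv (𝓡 n) (fun x => v a x * v b x) x) =
        v a x * y b a x (mvfderiv (𝓡 n) (v b) x) + v b x * y a b x (mvfderiv (𝓡 n) (v a) x) := by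
      intro a b
      rw [mvfderiv_fun_mul ((hv a x).mdifferentiableAt (by simp))
        ((hv b x).mdifferentiableAt (by simp)), map_add, map_smul, map_smul, hysymm b a]
      simp only [smul_eq_mul]
    rw [h1]
    simp only [Finset.sum_add_distrib, h2, add_div]
    congr 1
    -- By the symmetry of y, the two halves of ½ yₐ_b(d(vₐv_b)) are the same double sum with a and b
    -- exchanged.
    rw [Finset.sum_comm (f := fun a b => v a x * y b a x (mvfderiv (𝓡 n) (v b) x) / 2)]
    simp only [← Finset.sum_add_distrib]
    refine Finset.sum_congr rfl fun a _ => Finset.sum_congr rfl fun b _ => ?_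
    ring
  have hint1 : ∀ a b, Integrable (fun x =>
      y a b x (mvfderiv (𝓡 n) (fun x => v a x * v b x) x) / 2) (riemannianVolume n M) :=
    fun a b => (integrable_riemannianVolume (hysmooth a b _ (hvv a b)).continuous).div_const 2
  have hint2 : ∀ a b, Integrable (fun x =>
      ⟪D (t a) x, A x (t b x)⟫_ℝ * (v a x * v b x)) (riemannianVolume n M) :=
    fun a b => integrable_riemannianVolume ((hm a b).mul (hvv a b).continuous)
  have hint3 : ∀ a b, Integrable (fun x => r a b x * (v a x * v b x)) (riemannianVolume n M) :=
    fun a b => integrable_riemannianVolume ((hr a b).mul (hvv a b).continuous)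
  have hI : ∫ x, ⟪D ξ x, A x (ξ x)⟫_ℝ ∂(riemannianVolume n M) =
      ∑ a, ∑ b, ∫ x, r a b x * (v a x * v b x) ∂(riemannianVolume n M) := by
    have hint12 : ∀ a b, Integrable (fun x =>
        y a b x (mvfderiv (𝓡 n) (fun x => v a x * v b x) x) / 2 +
          ⟪D (t a) x, A x (t b x)⟫_ℝ * (v a x * v b x)) (riemannianVolume n M) :=
      fun a b => (hint1 a b).add (hint2 a b)
    simp only [hpt]
    rw [integral_finsetSum _ fun a _ => integrable_finsetSum _ fun b _ => hint12 a b]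
    refine Finset.sum_congr rfl fun a _ => ?_
    rw [integral_finsetSum _ fun b _ => hint12 a b]
    refine Finset.sum_congr rfl fun b _ => ?_
    have hint4 : Integrable (fun x => d a b x * (v a x * v b x)) (riemannianVolume n M) :=
      integrable_riemannianVolume ((hd a b).mul (hvv a b).continuous)
    have e : ∀ x, r a b x * (v a x * v b x) = ⟪D (t a) x, A x (t b x)⟫_ℝ * (v a x * v b x) -
        d a b x * (v a x * v b x) / 2 := fun x => by simp only [r]; ring
    simp only [e]
    rw [integral_add (hint1 a b) (hint2 a b), integral_sub (hint2 a b) (hint4.div_const 2),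
      integral_div, integral_div, hdf a b _ (hvv a b)]
    ring
  have hξint : Integrable (fun x => ‖ξ x‖ ^ 2) (riemannianVolume n M) := by
    simp only [← real_inner_self_eq_norm_sq]
    exact integrable_riemannianVolume (hξ.1.inner_bundle hξ.1).continuous
  rw [hI, Finset.sum_mul]
  refine (Finset.abs_sum_le_sum_abs _ _).trans (Finset.sum_le_sum fun a _ => ?_)
  rw [Finset.sum_mul]
  refine (Finset.abs_sum_le_sum_abs _ _).trans (Finset.sum_le_sum fun b _ => ?_)
  rw [← integral_const_mul]
  refine (abs_integral_le_integral_abs).trans (integral_mono (hint3 a b).abs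
    (hξint.const_mul _) fun x => ?_)
  simp only [abs_mul]
  have hR' : |r a b x| ≤ |R a b| := (hR a b x trivial).trans (le_abs_self _)
  calc |r a b x| * (|v a x| * |v b x|) ≤ |R a b| * ((K * ‖ξ x‖) * (K * ‖ξ x‖)) := by
        have := hcK a x (ξ x)
        gcongr
        · exact (abs_nonneg _).trans this
        · exact hcK b x (ξ x)
    _ = |R a b| * K ^ 2 * ‖ξ x‖ ^ 2 := by ring

/-- Low eigensections concentrate along the singular set of `A`, for a first order operator `D` with
symbol `σ` such that `A* σ(u)` is symmetric. -/
theorem concentratesAlong_of_leibniz (hp : PreservesSmooth n FE FE p)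
    (hpE : ∀ x e, p x e ∈ E' x) (hpid : ∀ x, ∀ e ∈ E' x, p x e = e)
    (hD : ∀ ξ ∈ sectionsIn n FE E', SmoothSection n FF (D ξ))
    (hadd : ∀ ξ ∈ sectionsIn n FE E', ∀ η ∈ sectionsIn n FE E', ∀ x,
      D (fun y => ξ y + η y) x = D ξ x + D η x)
    (hleib : ∀ ξ ∈ sectionsIn n FE E', ∀ f : M → ℝ, ContMDiff (𝓡 n) 𝓘(ℝ) ∞ f → ∀ x,
      D (fun y => f y • ξ y) x = σ x (mvfderiv (𝓡 n) f x) (ξ x) + f x • D ξ x)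
    (hA : PreservesSmooth n FE FF A)
    (hsymm : ∀ x u, ∀ e ∈ E' x, ∀ e' ∈ E' x, ⟪σ x u e, A x e'⟫_ℝ = ⟪σ x u e', A x e⟫_ℝ)
    {Z : Set M} (hZ : ∀ x ∉ Z, ∀ e ∈ E' x, A x e = 0 → e = 0) :
    ConcentratesAlong n (sectionsIn n FE E') (fun s ξ x => D ξ x + s • A x (ξ x)) Z := by
  intro δ hδ C hC
  obtain ⟨C₀, hC₀, hcross⟩ := exists_abs_integral_inner_le hp hpE hpid hD hadd hleib hA hsymm
  set K := (Metric.thickening δ Z)ᶜ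
  have hKc : IsClosed K := Metric.isOpen_thickening.isClosed_compl
  obtain ⟨κ, hκ, hlow⟩ := exists_lower_bound hp hA hKc.isCompact (fun x hx e he =>
    hZ x (fun h => hx (Metric.self_subset_thickening hδ Z h)) _ (hpE x e) he)
  -- The estimate below gives ∫|ξ|² · |s| ≤ (C + 2C₀)/κ; adding 1 makes the inequality strict.
  refine ⟨(C + 2 * C₀) / κ + 1, by positivity, fun s hs ξ hξ hnorm hlowξ => ?_⟩
  have hs' : 0 < |s| := abs_pos.2 hs
  have hDξ := hD ξ hξ
  have hAξ : SmoothSection n FF fun x => A x (ξ x) := fun x => hA _ x (hξ.1 x)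
  have i1 : Integrable (fun x => ‖D ξ x‖ ^ 2) (riemannianVolume n M) := by
    simp only [← real_inner_self_eq_norm_sq]
    exact integrable_riemannianVolume (hDξ.inner_bundle hDξ).continuous
  have i2 : Integrable (fun x => ⟪D ξ x, A x (ξ x)⟫_ℝ) (riemannianVolume n M) :=
    integrable_riemannianVolume (hDξ.inner_bundle hAξ).continuous
  have i3 : Integrable (fun x => ‖A x (ξ x)‖ ^ 2) (riemannianVolume n M) := by
    simp only [← real_inner_self_eq_norm_sq]
    exact integrable_riemannianVolume (hAξ.inner_bundle hAξ).continuous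
  have i4 : Integrable (fun x => ‖ξ x‖ ^ 2) (riemannianVolume n M) := by
    simp only [← real_inner_self_eq_norm_sq]
    exact integrable_riemannianVolume (hξ.1.inner_bundle hξ.1).continuous
  have hP : ∫ x, ‖D ξ x + s • A x (ξ x)‖ ^ 2 ∂(riemannianVolume n M) ≤ C * |s| := by
    rcases hlowξ with h | ⟨lam, hlam, h⟩
    · exact h
    -- Testing the eigenvalue equation against ξ itself gives ‖Pξ‖² = λ‖ξ‖² = λ ≤ C|s|.
    · have h1 := h ξ hξ
      simp only [real_inner_self_eq_norm_sq, real_inner_smul_right, integral_const_mul] at h1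
      rw [h1, hnorm, mul_one]
      exact (le_abs_self _).trans hlam
  have hexp : ∫ x, ‖D ξ x + s • A x (ξ x)‖ ^ 2 ∂(riemannianVolume n M) =
      ∫ x, ‖D ξ x‖ ^ 2 ∂(riemannianVolume n M) +
        2 * s * ∫ x, ⟪D ξ x, A x (ξ x)⟫_ℝ ∂(riemannianVolume n M) +
        s ^ 2 * ∫ x, ‖A x (ξ x)‖ ^ 2 ∂(riemannianVolume n M) := by
    have i12 : Integrable (fun x => ‖D ξ x‖ ^ 2 + 2 * s * ⟪D ξ x, A x (ξ x)⟫_ℝ)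
        (riemannianVolume n M) := i1.add (i2.const_mul _)
    rw [← integral_const_mul, ← integral_const_mul, ← integral_add i1 (i2.const_mul _),
      ← integral_add i12 (i3.const_mul _)]
    refine integral_congr_ae (ae_of_all _ fun x => ?_)
    dsimp only
    rw [norm_add_sq_real, real_inner_smul_right, norm_smul, mul_pow, Real.norm_eq_abs, sq_abs]
    ring
  have hX := hcross ξ hξ
  rw [hnorm, mul_one] at hX
  have hDnn : 0 ≤ ∫ x, ‖D ξ x‖ ^ 2 ∂(riemannianVolume n M) :=
    integral_nonneg fun x => sq_nonneg _
  have hKA : κ * ∫ x in K, ‖ξ x‖ ^ 2 ∂(riemannianVolume n M) ≤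
      ∫ x, ‖A x (ξ x)‖ ^ 2 ∂(riemannianVolume n M) := by
    rw [← integral_const_mul]
    refine (setIntegral_mono_on (i4.const_mul κ).integrableOn i3.integrableOn hKc.measurableSet
      fun x hx => hlow x hx _ (hpid x _ (hξ.2 x))).trans ?_
    exact setIntegral_le_integral i3 (ae_of_all _ fun x => sq_nonneg _)
  set I := ∫ x in K, ‖ξ x‖ ^ 2 ∂(riemannianVolume n M)
  set X := ∫ x, ⟪D ξ x, A x (ξ x)⟫_ℝ ∂(riemannianVolume n M)
  have h2 : -(2 * s * X) ≤ 2 * C₀ * |s| := by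
    refine (neg_le_abs _).trans ?_
    rw [abs_mul, abs_mul, abs_two]
    nlinarith
  -- ‖Dξ‖² is nonnegative and is discarded; the cross term costs at most 2C₀|s|, since ‖ξ‖ = 1.
  have h3 : s ^ 2 * (κ * I) ≤ (C + 2 * C₀) * |s| := by
    have := mul_le_mul_of_nonneg_left hKA (sq_nonneg s)
    linarith
  have h4 : |s| * (κ * I) ≤ C + 2 * C₀ := by
    rw [← sq_abs, pow_two, mul_assoc, mul_comm (C + 2 * C₀)] at h3
    exact le_of_mul_le_mul_left h3 hs'
  rw [lt_div_iff₀ hs']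
  have h5 : I * |s| ≤ (C + 2 * C₀) / κ := by
    rw [le_div_iff₀ hκ]
    linarith
  linarith

end Estimates

/-! ### Smoothness and the Leibniz rule for Dirac operators -/

/-- The contraction of a bilinear map over a basis of `ℝⁿ` and its dual basis does not depend on the
basis. -/
theorem sum_apply_dual_eq {n : ℕ} {G H : Type*} [NormedAddCommGroup G] [NormedSpace ℝ G]
    [NormedAddCommGroup H] [NormedSpace ℝ H]
    (B : (EuclideanSpace ℝ (Fin n) →L[ℝ] ℝ) →L[ℝ] (G →L[ℝ] H))
    (L : EuclideanSpace ℝ (Fin n) →L[ℝ] G)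
    {φ : Fin n → EuclideanSpace ℝ (Fin n) →L[ℝ] ℝ} {b : Fin n → EuclideanSpace ℝ (Fin n)}
    (h : ∀ v, ∑ i, φ i v • b i = v) :
    ∑ i, B (φ i) (L (b i)) =
      ∑ i, B (EuclideanSpace.proj i) (L (EuclideanSpace.single i (1 : ℝ))) := by
  have hb : ∀ v : EuclideanSpace ℝ (Fin n), v = ∑ j, v j • EuclideanSpace.single j (1 : ℝ) :=
    fun v => by simpa using ((EuclideanSpace.basisFun (Fin n) ℝ).sum_repr v).symm
  have hφ : ∀ j, (EuclideanSpace.proj j : EuclideanSpace ℝ (Fin n) →L[ℝ] ℝ) =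
      ∑ i, b i j • φ i := fun j => by
    ext v
    have := congrArg (fun w : EuclideanSpace ℝ (Fin n) => w j) (h v)
    simp only [WithLp.ofLp_sum, Finset.sum_apply, PiLp.smul_apply, smul_eq_mul] at this
    simp [← this, mul_comm]
  calc ∑ i, B (φ i) (L (b i)) =
        ∑ i, ∑ j, b i j • B (φ i) (L (EuclideanSpace.single j (1 : ℝ))) := by
        refine Finset.sum_congr rfl fun i _ => ?_
        conv_lhs => rw [hb (b i)]
        simp only [map_sum, map_smul]
    _ = ∑ j, ∑ i, b i j • B (φ i) (L (EuclideanSpace.single j (1 : ℝ))) := Finset.sum_comm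
    _ = _ := by
        refine Finset.sum_congr rfl fun j _ => ?_
        rw [hφ j]
        simp only [map_sum, map_smul, _root_.sum_apply, _root_.smul_apply]

section

variable {n : ℕ} {M : Type u} [TopologicalSpace M] [ChartedSpace (EuclideanSpace ℝ (Fin n)) M]
  {FE : Type*} [NormedAddCommGroup FE] [NormedSpace ℝ FE]
  {E : M → Type*} [TopologicalSpace (TotalSpace FE E)]
  [∀ x, NormedAddCommGroup (E x)] [∀ x, InnerProductSpace ℝ (E x)]
  [FiberBundle FE E] [VectorBundle ℝ FE E]
  {FF : Type*} [NormedAddCommGroup FF] [NormedSpace ℝ FF]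
  {F : M → Type*} [TopologicalSpace (TotalSpace FF F)]
  [∀ x, NormedAddCommGroup (F x)] [∀ x, InnerProductSpace ℝ (F x)]
  [FiberBundle FF F] [VectorBundle ℝ FF F]
  {FG : Type*} [NormedAddCommGroup FG] [NormedSpace ℝ FG]
  {G : M → Type*} [TopologicalSpace (TotalSpace FG G)]
  [∀ x, NormedAddCommGroup (G x)] [∀ x, InnerProductSpace ℝ (G x)]
  [FiberBundle FG G] [VectorBundle ℝ FG G]

theorem IsSmoothHom.preservesSmooth {A : ∀ x : M, E x →L[ℝ] F x} (hA : IsSmoothHom n FE FF A) :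
    PreservesSmooth n FE FF A := fun _ x hξ =>
  (hA x).clm_bundle_apply (b := fun x => x) hξ

theorem PreservesSmooth.id : PreservesSmooth n FE FE fun x : M => ContinuousLinearMap.id ℝ (E x) :=
  fun _ _ hξ => hξ

theorem PreservesSmooth.comp {A : ∀ x : M, E x →L[ℝ] F x} {B : ∀ x : M, F x →L[ℝ] G x}
    (hB : PreservesSmooth n FF FG B) (hA : PreservesSmooth n FE FF A) :
    PreservesSmooth n FE FG fun x => B x ∘L A x := fun _ x hξ => hB _ x (hA _ x hξ)

theorem PreservesSmooth.eigenproj {τ : ∀ x : M, E x →L[ℝ] E x} (hτ : PreservesSmooth n FE FE τ)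
    (ε : ℝ) : PreservesSmooth n FE FE (eigenproj τ ε) := fun ξ x hξ =>
  ContMDiffAt.const_smul_section (a := (1 / 2 : ℝ))
    (hξ.add_section (ContMDiffAt.const_smul_section (a := ε) (hτ ξ x hξ)))

end

section DiracOp

variable {n : ℕ} {M : Type u} [TopologicalSpace M] [ChartedSpace (EuclideanSpace ℝ (Fin n)) M]
  [IsManifold (𝓡 n) ∞ M] [RiemannianBundle (fun x : M => TangentSpace (𝓡 n) x)]
  {FE : Type*} [NormedAddCommGroup FE] [NormedSpace ℝ FE]
  {E : M → Type*} [TopologicalSpace (TotalSpace FE E)]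
  [∀ x, NormedAddCommGroup (E x)] [∀ x, InnerProductSpace ℝ (E x)]
  [FiberBundle FE E] [VectorBundle ℝ FE E] [ContMDiffVectorBundle ∞ FE E (𝓡 n)]
  {FF : Type*} [NormedAddCommGroup FF] [NormedSpace ℝ FF]
  {F : M → Type*} [TopologicalSpace (TotalSpace FF F)]
  [∀ x, NormedAddCommGroup (F x)] [∀ x, InnerProductSpace ℝ (F x)]
  [FiberBundle FF F] [VectorBundle ℝ FF F] [ContMDiffVectorBundle ∞ FF F (𝓡 n)]

/-- The coframe of the preferred chart at `x₀`. -/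
def coordCovector (x₀ : M) (i : Fin n) (p : M) : Cotangent n p :=
  (EuclideanSpace.proj i : EuclideanSpace ℝ (Fin n) →L[ℝ] ℝ) ∘L
    (trivializationAt (EuclideanSpace ℝ (Fin n))
      (fun x : M => TangentSpace (𝓡 n) x) x₀).continuousLinearMapAt ℝ p

theorem sum_coordCovector_smul {x₀ p : M} (hp : p ∈ (chartAt (EuclideanSpace ℝ (Fin n)) x₀).source)
    (v : TangentSpace (𝓡 n) p) :
    ∑ i, coordCovector (n := n) x₀ i p v • coordVector (n := n) x₀ i p = v := by
  let e := trivializationAt (EuclideanSpace ℝ (Fin n)) (fun x : M => TangentSpace (𝓡 n) x) x₀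
  have hb : p ∈ e.baseSet := by simpa [e] using hp
  have h1 : ∀ i, coordVector (n := n) x₀ i p = e.symmL ℝ p (EuclideanSpace.single i (1 : ℝ)) :=
    fun i => by rw [coordVector, ← Trivialization.symmL_apply (R := ℝ) _ hb]
  set w : EuclideanSpace ℝ (Fin n) := e.continuousLinearMapAt ℝ p v with hw
  have h2 : w = ∑ i, w i • EuclideanSpace.single i (1 : ℝ) := by
    simpa using ((EuclideanSpace.basisFun (Fin n) ℝ).sum_repr w).symm
  have h3 : e.symmL ℝ p w = v := e.symmL_continuousLinearMapAt hb v
  conv_rhs => rw [← h3, h2, map_sum]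
  refine Finset.sum_congr rfl fun i _ => ?_
  rw [h1, map_smul]
  rfl

theorem contMDiffAt_coordCovector (x₀ : M) (i : Fin n) :
    ContMDiffAt (𝓡 n) ((𝓡 n).prod 𝓘(ℝ, EuclideanSpace ℝ (Fin n) →L[ℝ] ℝ)) ∞
      (fun p => TotalSpace.mk' (EuclideanSpace ℝ (Fin n) →L[ℝ] ℝ)
        (E := fun x : M => TangentSpace (𝓡 n) x →L[ℝ] Bundle.Trivial M ℝ x) p
        (coordCovector (n := n) x₀ i p)) x₀ := by
  rw [contMDiffAt_hom_bundle]
  refine ⟨contMDiffAt_id, ?_⟩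
  refine (contMDiffAt_const (c := (EuclideanSpace.proj i : EuclideanSpace ℝ (Fin n) →L[ℝ] ℝ))).congr_of_eventuallyEq ?_
  let e := trivializationAt (EuclideanSpace ℝ (Fin n)) (fun x : M => TangentSpace (𝓡 n) x) x₀
  filter_upwards [e.open_baseSet.mem_nhds (mem_baseSet_trivializationAt _ _ x₀)] with p hp
  ext v
  rw [ContinuousLinearMap.inCoordinates_eq hp (by simp)]
  have hw : e.continuousLinearMapAt ℝ p ((e.continuousLinearEquivAt ℝ p hp).symm v) = v := by
    have := (e.continuousLinearEquivAt ℝ p hp).apply_symm_apply v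
    rwa [e.coe_continuousLinearEquivAt_eq hp] at this
  exact congrArg (fun w : EuclideanSpace ℝ (Fin n) => w i) hw

/-- `diracOp` contracts over the standard basis of the chart at the varying point x, a frame that
need not be continuous in x. Independence of the basis replaces it by the smooth coordinate frame of
one fixed chart, which is what smoothness of the operator requires. -/
theorem diracOp_eq_sum (nabla : CovariantDerivative (𝓡 n) FE E)
    (σ : ∀ x : M, Cotangent n x →L[ℝ] (E x →L[ℝ] F x)) (p : ∀ x : M, E x →L[ℝ] E x)
    (ξ : ∀ x, E x) {x₀ x : M} (hx : x ∈ (chartAt (EuclideanSpace ℝ (Fin n)) x₀).source) :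
    diracOp nabla σ p ξ x =
      ∑ i, σ x (coordCovector (n := n) x₀ i x) (p x (nabla ξ x (coordVector (n := n) x₀ i x))) := by
  exact (sum_apply_dual_eq (σ x) (p x ∘L nabla ξ x) (φ := fun i => coordCovector x₀ i x)
    (b := fun i => coordVector x₀ i x) (sum_coordCovector_smul hx)).symm

theorem smoothSection_diracOp {nabla : CovariantDerivative (𝓡 n) FE E}
    [CovariantDerivative.ContMDiffCovariantDerivative nabla ∞]
    {σ : ∀ x : M, Cotangent n x →L[ℝ] (E x →L[ℝ] F x)} (hσ : IsSmoothSymbol FE FF σ)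
    {p : ∀ x : M, E x →L[ℝ] E x} (hp : PreservesSmooth n FE FE p) {ξ : ∀ x, E x}
    (hξ : SmoothSection n FE ξ) : SmoothSection n FF (diracOp nabla σ p ξ) := by
  intro x₀
  have hs : (chartAt (EuclideanSpace ℝ (Fin n)) x₀).source ∈ nhds x₀ :=
    (chartAt _ x₀).open_source.mem_nhds (mem_chart_source _ x₀)
  have h1 : SmoothSectionAt n FF (fun x => ∑ i, σ x (coordCovector (n := n) x₀ i x)
      (p x (nabla ξ x (coordVector (n := n) x₀ i x)))) x₀ := by
    refine ContMDiffAt.sum_section fun i _ => ?_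
    have hv := (contMDiffOn_coordVector (n := n) x₀ i).contMDiffAt hs
    have hn : ContMDiffOn (𝓡 n) ((𝓡 n).prod 𝓘(ℝ, EuclideanSpace ℝ (Fin n) →L[ℝ] FE)) ∞
        (fun x => TotalSpace.mk' (EuclideanSpace ℝ (Fin n) →L[ℝ] FE)
          (E := fun x => TangentSpace (𝓡 n) x →L[ℝ] E x) x (nabla ξ x)) Set.univ :=
      (CovariantDerivative.ContMDiffCovariantDerivative.contMDiff (cov := nabla) (k := ∞)).contMDiff
        (contMDiffOn_univ.2 hξ)
    have hn' := (contMDiffOn_univ.1 hn) x₀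
    have hc := contMDiffAt_coordCovector (n := n) x₀ i
    have h2 := (hσ x₀).clm_bundle_apply (b := fun x => x) hc
    exact h2.clm_bundle_apply (b := fun x => x)
      (hp _ x₀ (hn'.clm_bundle_apply (b := fun x => x) hv))
  refine h1.congr_of_eventuallyEq ?_
  filter_upwards [hs] with x hx
  rw [diracOp_eq_sum nabla σ p ξ hx]

end DiracOp

section Pointwise

variable {n : ℕ} {M : Type u} [TopologicalSpace M] [ChartedSpace (EuclideanSpace ℝ (Fin n)) M]
  {E F : M → Type*} [∀ x, NormedAddCommGroup (E x)] [∀ x, InnerProductSpace ℝ (E x)]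
  [∀ x, FiniteDimensional ℝ (E x)]
  [∀ x, NormedAddCommGroup (F x)] [∀ x, InnerProductSpace ℝ (F x)]
  [∀ x, FiniteDimensional ℝ (F x)]

/-- A pair `(σ, A)` is concentrating if and only if the forms `⟪σ(u) e, A e'⟫` are symmetric. -/
theorem isConcentratingPair_iff {σ : ∀ x : M, Cotangent n x → (E x →ₗ[ℝ] F x)}
    {A : ∀ x : M, E x →ₗ[ℝ] F x} : IsConcentratingPair σ A ↔
      ∀ x u e e', ⟪σ x u e, A x e'⟫_ℝ = ⟪σ x u e', A x e⟫_ℝ := by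
  refine forall_congr' fun x => forall_congr' fun u => ?_
  rw [LinearMap.ext_iff]
  refine forall_congr' fun e => ?_
  rw [ext_iff_inner_right ℝ]
  refine forall_congr' fun e' => ?_
  simp only [LinearMap.comp_apply, LinearMap.adjoint_inner_left]
  rw [real_inner_comm (σ x u e') (A x e)]

end Pointwise

section Contraction

variable {n : ℕ} {G H : Type*} [NormedAddCommGroup G] [NormedSpace ℝ G]
  [NormedAddCommGroup H] [NormedSpace ℝ H]

/-- The contraction `∑ᵢ B(eⁱ) (L eᵢ)`. -/
def dualContraction (B : (EuclideanSpace ℝ (Fin n) →L[ℝ] ℝ) →L[ℝ] (G →L[ℝ] H))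
    (L : EuclideanSpace ℝ (Fin n) →L[ℝ] G) : H :=
  ∑ i, B (EuclideanSpace.proj i) (L (EuclideanSpace.single i (1 : ℝ)))

variable (B : (EuclideanSpace ℝ (Fin n) →L[ℝ] ℝ) →L[ℝ] (G →L[ℝ] H))

theorem dualContraction_add (L L' : EuclideanSpace ℝ (Fin n) →L[ℝ] G) :
    dualContraction B (L + L') = dualContraction B L + dualContraction B L' := by
  simp [dualContraction, Finset.sum_add_distrib]

theorem dualContraction_smul (a : ℝ) (L : EuclideanSpace ℝ (Fin n) →L[ℝ] G) :
    dualContraction B (a • L) = a • dualContraction B L := by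
  simp [dualContraction, Finset.smul_sum]

/-- The Leibniz rule for ∇ adds the rank one map df ⊗ ξ; contracting it with σ produces σ(df)ξ, so
this identifies the symbol of a Dirac operator. -/
theorem dualContraction_smulRight (φ : EuclideanSpace ℝ (Fin n) →L[ℝ] ℝ) (g : G) :
    dualContraction B (φ.smulRight g) = B φ g := by
  have hφ : φ = ∑ i, φ (EuclideanSpace.single i (1 : ℝ)) •
      (EuclideanSpace.proj i : EuclideanSpace ℝ (Fin n) →L[ℝ] ℝ) := by
    ext v
    have : v = ∑ j, v j • EuclideanSpace.single j (1 : ℝ) := by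
      simpa using ((EuclideanSpace.basisFun (Fin n) ℝ).sum_repr v).symm
    conv_lhs => rw [this]
    simp [mul_comm]
  conv_rhs => rw [hφ]
  simp [dualContraction]

end Contraction

section Connection

variable {n : ℕ} {M : Type u} [TopologicalSpace M] [ChartedSpace (EuclideanSpace ℝ (Fin n)) M]
  [IsManifold (𝓡 n) ∞ M]
  {FE : Type*} [NormedAddCommGroup FE] [NormedSpace ℝ FE]
  {E : M → Type*} [TopologicalSpace (TotalSpace FE E)]
  [∀ x, NormedAddCommGroup (E x)] [∀ x, InnerProductSpace ℝ (E x)]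
  [FiberBundle FE E] [VectorBundle ℝ FE E]
  {F : M → Type*} [∀ x, NormedAddCommGroup (F x)] [∀ x, InnerProductSpace ℝ (F x)]
  (nabla : CovariantDerivative (𝓡 n) FE E) (σ : ∀ x : M, Cotangent n x →L[ℝ] (E x →L[ℝ] F x))
  (p : ∀ x : M, E x →L[ℝ] E x)

theorem diracOp_add {ξ η : ∀ x, E x} (hξ : SmoothSection n FE ξ) (hη : SmoothSection n FE η)
    (x : M) : diracOp nabla σ p (fun y => ξ y + η y) x =
      diracOp nabla σ p ξ x + diracOp nabla σ p η x := by
  have h : nabla (fun y => ξ y + η y) x = nabla ξ x + nabla η x :=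
    nabla.isCovariantDerivativeOnUniv.add ((hξ x).mdifferentiableAt (by simp))
      ((hη x).mdifferentiableAt (by simp))
  have h' : p x ∘L nabla (fun y => ξ y + η y) x = p x ∘L nabla ξ x + p x ∘L nabla η x := by
    rw [h, ContinuousLinearMap.comp_add]
  exact (congrArg (dualContraction (σ x)) h').trans (dualContraction_add _ _ _)

theorem diracOp_smul {ξ : ∀ x, E x} (hξ : SmoothSection n FE ξ) {f : M → ℝ}
    (hf : ContMDiff (𝓡 n) 𝓘(ℝ) ∞ f) (x : M) : diracOp nabla σ p (fun y => f y • ξ y) x =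
      σ x (mvfderiv (𝓡 n) f x) (p x (ξ x)) + f x • diracOp nabla σ p ξ x := by
  have h : nabla (fun y => f y • ξ y) x =
      f x • nabla ξ x + (mvfderiv (𝓡 n) f x).smulRight (ξ x) :=
    nabla.isCovariantDerivativeOnUniv.leibniz ((hξ x).mdifferentiableAt (by simp))
      ((hf x).mdifferentiableAt (by simp))
  have h' : p x ∘L nabla (fun y => f y • ξ y) x =
      (mvfderiv (𝓡 n) f x).smulRight (p x (ξ x)) + f x • (p x ∘L nabla ξ x) := by
    rw [h, ContinuousLinearMap.comp_add, ContinuousLinearMap.comp_smul, add_comm]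
    congr 1
    ext v
    exact (p x).map_smul _ _
  refine (congrArg (dualContraction (σ x)) h').trans ((dualContraction_add _ _ _).trans ?_)
  exact congrArg₂ (· + ·) (dualContraction_smulRight (σ x) _ _) (dualContraction_smul _ _ _)

end Connection

/-! ### Restriction to subbundles cut out by projections and involutions -/

section Restriction

variable {n : ℕ} {M : Type u} [EMetricSpace M] [CompactSpace M] [MeasurableSpace M] [BorelSpace M]
  [ChartedSpace (EuclideanSpace ℝ (Fin n)) M] [IsManifold (𝓡 n) ∞ M]
  [RiemannianBundle (fun x : M => TangentSpace (𝓡 n) x)]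
  [IsContMDiffRiemannianBundle (𝓡 n) ∞ (EuclideanSpace ℝ (Fin n))
    (fun x : M => TangentSpace (𝓡 n) x)]
  {FE : Type*} [NormedAddCommGroup FE] [NormedSpace ℝ FE] [FiniteDimensional ℝ FE]
  {E : M → Type*} [TopologicalSpace (TotalSpace FE E)]
  [∀ x, NormedAddCommGroup (E x)] [∀ x, InnerProductSpace ℝ (E x)]
  [∀ x, FiniteDimensional ℝ (E x)]
  [FiberBundle FE E] [VectorBundle ℝ FE E] [ContMDiffVectorBundle ∞ FE E (𝓡 n)]
  [IsContMDiffRiemannianBundle (𝓡 n) ∞ FE E]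
  {FF : Type*} [NormedAddCommGroup FF] [NormedSpace ℝ FF]
  {F : M → Type*} [TopologicalSpace (TotalSpace FF F)]
  [∀ x, NormedAddCommGroup (F x)] [∀ x, InnerProductSpace ℝ (F x)]
  [∀ x, FiniteDimensional ℝ (F x)]
  [FiberBundle FF F] [VectorBundle ℝ FF F] [ContMDiffVectorBundle ∞ FF F (𝓡 n)]
  [IsContMDiffRiemannianBundle (𝓡 n) ∞ FF F]
  {nabla : CovariantDerivative (𝓡 n) FE E}
  [CovariantDerivative.ContMDiffCovariantDerivative nabla ∞]
  {σ : ∀ x : M, Cotangent n x →L[ℝ] (E x →L[ℝ] F x)}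
  {E' : ∀ x, Submodule ℝ (E x)} {F' : ∀ x, Submodule ℝ (F x)}
  {p : ∀ x, E x →L[ℝ] E x} {q : ∀ x, F x →L[ℝ] F x} {A : ∀ x, E x →L[ℝ] F x}

/-- The operator `q σ ∘ p ∇`, for a smooth projection `p` onto `E'`, is a concentrating restriction
to `E'` as soon as the pairing of its symbol with `A` is symmetric. -/
theorem isConcentratingRestriction_diracOp (hσ : IsSmoothSymbol FE FF σ)
    (hp : PreservesSmooth n FE FE p) (hpE : ∀ x e, p x e ∈ E' x)
    (hpid : ∀ x, ∀ e ∈ E' x, p x e = e) (hq : PreservesSmooth n FF FF q)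
    (hσF : ∀ x u, ∀ e ∈ E' x, q x (σ x u e) ∈ F' x)
    (hA : PreservesSmooth n FE FF A) (hAF : ∀ x, ∀ e ∈ E' x, A x e ∈ F' x)
    (hsymm : ∀ x u, ∀ e ∈ E' x, ∀ e' ∈ E' x,
      ⟪q x (σ x u e), A x e'⟫_ℝ = ⟪q x (σ x u e'), A x e⟫_ℝ) :
    IsConcentratingRestriction FE FF E' F' (fun ξ x => q x (diracOp nabla σ p ξ x))
      (fun x u => q x ∘L σ x u) A := by
  have hD : ∀ ξ ∈ sectionsIn n FE E', SmoothSection n FF fun x => q x (diracOp nabla σ p ξ x) :=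
    fun ξ hξ x => hq _ x (smoothSection_diracOp hσ hp hξ.1 x)
  have hleib : ∀ ξ ∈ sectionsIn n FE E', ∀ f : M → ℝ, ContMDiff (𝓡 n) 𝓘(ℝ) ∞ f → ∀ x,
      q x (diracOp nabla σ p (fun y => f y • ξ y) x) =
        q x (σ x (mvfderiv (𝓡 n) f x) (ξ x)) + f x • q x (diracOp nabla σ p ξ x) := by
    intro ξ hξ f hf x
    rw [diracOp_smul nabla σ p hξ.1 hf, hpid x _ (hξ.2 x), map_add, map_smul]
  refine ⟨hσF, hAF, fun ξ hξ => ⟨hD ξ hξ, fun x => ?_⟩, hleib,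
    isConcentratingPair_iff.2 fun x u e e' => hsymm x u e e.2 e' e'.2, ?_⟩
  · change q x (diracOp nabla σ p ξ x) ∈ F' x
    rw [diracOp, map_sum]
    exact Submodule.sum_mem _ fun i _ => hσF x _ _ (hpE x _)
  -- Composing with q keeps the symbol linear in the covector, so its pairings with `A` are vector
  -- fields.
  · let σ' : ∀ x : M, Cotangent n x →ₗ[ℝ] (E x →L[ℝ] F x) := fun x =>
      { toFun := fun u => q x ∘L σ x u
        map_add' := fun u v => by rw [map_add, ContinuousLinearMap.comp_add]
        map_smul' := fun a u => by rw [map_smul, ContinuousLinearMap.comp_smul]; rfl }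
    refine concentratesAlong_of_leibniz (σ := σ') hp hpE hpid hD ?_ hleib hA hsymm ?_
    · intro ξ hξ η hη x
      rw [diracOp_add nabla σ p hξ.1 hη.1, map_add]
    · intro x hx e he h
      have h1 : LinearMap.ker ((A x : E x →ₗ[ℝ] F x).restrict (hAF x)) = ⊥ := by
        by_contra h1
        exact hx h1
      have h2 := LinearMap.ker_eq_bot'.1 h1 ⟨e, he⟩ (Subtype.ext h)
      exact congrArg Subtype.val h2

end Restriction

section Involutions

variable {M : Type u} {E : M → Type*} [∀ x, NormedAddCommGroup (E x)]
  [∀ x, InnerProductSpace ℝ (E x)] {τ T : ∀ x : M, E x →L[ℝ] E x} {ε δ : ℝ} {x : M}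

theorem mem_eigenbundle {e : E x} : e ∈ eigenbundle τ ε x ↔ τ x e = ε • e :=
  Module.End.mem_eigenspace_iff

theorem eigenproj_apply (e : E x) :
    eigenproj τ ε x e = (1 / 2 : ℝ) • (e + ε • τ x e) := rfl

theorem eigenproj_mem (hτ : ∀ x e, τ x (τ x e) = e) (hε : ε * ε = 1) (e : E x) :
    eigenproj τ ε x e ∈ eigenbundle τ ε x := by
  have h : ε • ε • τ x e = τ x e := by rw [smul_smul, hε, one_smul]
  rw [mem_eigenbundle, eigenproj_apply, map_smul, map_add, map_smul, hτ, smul_comm ε (1 / 2 : ℝ),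
    smul_add ε, h, add_comm]

theorem eigenproj_eq_self (hε : ε * ε = 1) {e : E x} (he : e ∈ eigenbundle τ ε x) :
    eigenproj τ ε x e = e := by
  rw [mem_eigenbundle] at he
  rw [eigenproj_apply, he, smul_smul, hε]
  module

theorem inner_eigenproj (hτ : ∀ x e, τ x (τ x e) = e)
    (hi : ∀ x e e', ⟪τ x e, τ x e'⟫_ℝ = ⟪e, e'⟫_ℝ) (e e' : E x) :
    ⟪eigenproj τ ε x e, e'⟫_ℝ = ⟪e, eigenproj τ ε x e'⟫_ℝ := by
  have h : ⟪τ x e, e'⟫_ℝ = ⟪e, τ x e'⟫_ℝ := by rw [← hi, hτ]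
  simp only [eigenproj_apply, real_inner_smul_left, real_inner_smul_right, inner_add_left,
    inner_add_right, h]

theorem eigenproj_mem_of_comm (h : ∀ x e, τ x (T x e) = T x (τ x e)) {e : E x}
    (he : e ∈ eigenbundle τ ε x) : eigenproj T δ x e ∈ eigenbundle τ ε x := by
  rw [mem_eigenbundle] at he ⊢
  rw [eigenproj_apply, map_smul, map_add, map_smul, h, he, map_smul]
  module

end Involutions

section Parallel

variable {n : ℕ} {M : Type u} [TopologicalSpace M] [ChartedSpace (EuclideanSpace ℝ (Fin n)) M]
  {E F : M → Type*} [∀ x, NormedAddCommGroup (E x)] [∀ x, InnerProductSpace ℝ (E x)]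
  [∀ x, NormedAddCommGroup (F x)] [∀ x, InnerProductSpace ℝ (F x)]
  {σ : ∀ x : M, Cotangent n x →L[ℝ] (E x →L[ℝ] F x)}
  {τ : ∀ x : M, E x →L[ℝ] E x} {τ' : ∀ x : M, F x →L[ℝ] F x} {ε : ℝ}

/-- For injective σ(u) the intertwining relation can be read backwards: e lies in the eigenbundle if
and only if σ(u)e does. -/
theorem bijOn_eigenbundle (hε : ε = 1 ∨ ε = -1)
    (hστ : ∀ x u e, σ x u (τ x e) = ε • τ' x (σ x u e)) {x : M} {u : Cotangent n x}
    (hu : Function.Bijective (σ x u)) :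
    Set.BijOn (σ x u) (eigenbundle τ 1 x) (eigenbundle τ' ε x) := by
  have hεε : ε * ε = 1 := by rcases hε with rfl | rfl <;> norm_num
  have key : ∀ e, e ∈ eigenbundle τ 1 x ↔ σ x u e ∈ eigenbundle τ' ε x := by
    intro e
    rw [mem_eigenbundle, mem_eigenbundle, one_smul, ← hu.1.eq_iff, hστ]
    constructor
    · intro h
      conv_rhs => rw [← h]
      rw [smul_smul, hεε, one_smul]
    · intro h
      rw [h, smul_smul, hεε, one_smul]
  refine ⟨fun e he => (key e).1 he, hu.1.injOn, fun f hf => ?_⟩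
  obtain ⟨e, rfl⟩ := hu.2 f
  exact ⟨e, (key e).2 hf, rfl⟩

variable [IsManifold (𝓡 n) ∞ M] {FE : Type*} [NormedAddCommGroup FE] [NormedSpace ℝ FE]
  [TopologicalSpace (TotalSpace FE E)] [FiberBundle FE E] {nabla : CovariantDerivative (𝓡 n) FE E}

/-- A parallel τ fixing ξ also fixes ∇ξ, so projecting ∇ξ to E⁺ changes nothing. -/
theorem diracOp_eigenproj (hτ : IsParallel nabla τ) {ξ : ∀ x, E x}
    (hξ : ξ ∈ sectionsIn n FE (eigenbundle τ 1)) :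
    diracOp nabla σ (eigenproj τ 1) ξ =
      diracOp nabla σ (fun x => ContinuousLinearMap.id ℝ (E x)) ξ := by
  have hξ' : (fun y => τ y (ξ y)) = ξ := by
    ext y
    simpa using mem_eigenbundle.1 (hξ.2 y)
  ext x
  refine Finset.sum_congr rfl fun i _ => ?_
  have h := hτ ξ hξ.1 x (EuclideanSpace.single i (1 : ℝ))
  rw [hξ'] at h
  have : nabla ξ x (EuclideanSpace.single i (1 : ℝ)) ∈ eigenbundle τ 1 x := by
    rw [mem_eigenbundle, one_smul]
    exact h.symm
  exact congrArg _ (eigenproj_eq_self (by norm_num) this)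

end Parallel

section Restriction

variable {n : ℕ} {M : Type u} [EMetricSpace M] [CompactSpace M] [MeasurableSpace M] [BorelSpace M]
  [ChartedSpace (EuclideanSpace ℝ (Fin n)) M] [IsManifold (𝓡 n) ∞ M]
  [RiemannianBundle (fun x : M => TangentSpace (𝓡 n) x)]
  [IsContMDiffRiemannianBundle (𝓡 n) ∞ (EuclideanSpace ℝ (Fin n))
    (fun x : M => TangentSpace (𝓡 n) x)]
  {FE : Type*} [NormedAddCommGroup FE] [NormedSpace ℝ FE] [FiniteDimensional ℝ FE]
  {E : M → Type*} [TopologicalSpace (TotalSpace FE E)]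
  [∀ x, NormedAddCommGroup (E x)] [∀ x, InnerProductSpace ℝ (E x)]
  [∀ x, FiniteDimensional ℝ (E x)]
  [FiberBundle FE E] [VectorBundle ℝ FE E] [ContMDiffVectorBundle ∞ FE E (𝓡 n)]
  [IsContMDiffRiemannianBundle (𝓡 n) ∞ FE E]
  {FF : Type*} [NormedAddCommGroup FF] [NormedSpace ℝ FF]
  {F : M → Type*} [TopologicalSpace (TotalSpace FF F)]
  [∀ x, NormedAddCommGroup (F x)] [∀ x, InnerProductSpace ℝ (F x)]
  [∀ x, FiniteDimensional ℝ (F x)]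
  [FiberBundle FF F] [VectorBundle ℝ FF F] [ContMDiffVectorBundle ∞ FF F (𝓡 n)]
  [IsContMDiffRiemannianBundle (𝓡 n) ∞ FF F]
  {nabla : CovariantDerivative (𝓡 n) FE E}
  [CovariantDerivative.ContMDiffCovariantDerivative nabla ∞]
  {σ : ∀ x : M, Cotangent n x →L[ℝ] (E x →L[ℝ] F x)} {A : ∀ x, E x →L[ℝ] F x}
  {τ T : ∀ x : M, E x →L[ℝ] E x} {τ' T' : ∀ x : M, F x →L[ℝ] F x} {ε : ℝ}

theorem isConcentratingRestriction_eigenbundle (hσ : IsSmoothSymbol FE FF σ)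
    (hA : IsSmoothHom n FE FF A) (hε : ε = 1 ∨ ε = -1)
    (hτ : IsMetricInvolution n FE τ) (hτ' : IsMetricInvolution n FF τ')
    (hστ : ∀ x u e, σ x u (τ x e) = ε • τ' x (σ x u e))
    (hsymm : ∀ x u e e', ⟪σ x u e, A x e'⟫_ℝ = ⟪σ x u e', A x e⟫_ℝ) :
    IsConcentratingRestriction FE FF (eigenbundle τ 1) (eigenbundle τ' ε)
      (diracOp nabla σ (eigenproj τ 1)) (fun x u => σ x u)
      (fun x => eigenproj τ' ε x ∘L A x) := by
  have hεε : ε * ε = 1 := by rcases hε with rfl | rfl <;> norm_num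
  have hσF : ∀ x u, ∀ e ∈ eigenbundle τ 1 x, σ x u e ∈ eigenbundle τ' ε x := by
    intro x u e he
    rw [mem_eigenbundle, one_smul] at he
    have := hστ x u e
    rw [mem_eigenbundle]
    rw [he] at this
    conv_rhs => rw [this]
    rw [smul_smul, hεε, one_smul]
  refine isConcentratingRestriction_diracOp (q := fun x => ContinuousLinearMap.id ℝ (F x)) hσ
    (hτ.smooth.preservesSmooth.eigenproj 1) (fun x e => eigenproj_mem hτ.involutive (by norm_num) e)
    (fun x e he => eigenproj_eq_self (by norm_num) he) PreservesSmooth.id hσF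
    ((hτ'.smooth.preservesSmooth.eigenproj ε).comp hA.preservesSmooth)
    (fun x e _ => eigenproj_mem hτ'.involutive hεε _) fun x u e he e' he' => ?_
  -- The projection is self-adjoint and σ(u)e already lies in its image, so it disappears from the
  -- pairing and the symmetry of the unrestricted pair applies.
  have key : ∀ e ∈ eigenbundle τ 1 x, ∀ e', ⟪σ x u e, eigenproj τ' ε x (A x e')⟫_ℝ =
      ⟪σ x u e, A x e'⟫_ℝ := fun e he e' => by
    rw [← inner_eigenproj hτ'.involutive hτ'.isometry, eigenproj_eq_self hεε (hσF x u e he)]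
  exact (key e he e').trans ((hsymm x u e e').trans (key e' he' e).symm)

/-- The restriction by two commuting involutions. -/
theorem isConcentratingRestriction_inf_eigenbundle (hσ : IsSmoothSymbol FE FF σ)
    (hA : IsSmoothHom n FE FF A)
    (hτ : IsMetricInvolution n FE τ) (hτ' : IsMetricInvolution n FF τ')
    (hT : IsMetricInvolution n FE T) (hT' : IsMetricInvolution n FF T')
    (hτT : ∀ x e, τ x (T x e) = T x (τ x e)) (hτT' : ∀ x e, τ' x (T' x e) = T' x (τ' x e))
    (hστ : ∀ x u e, σ x u (τ x e) = -τ' x (σ x u e))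
    (hAτ : ∀ x, ∀ e ∈ eigenbundle τ 1 x, A x e ∈ eigenbundle τ' (-1) x)
    (hsymm : ∀ x u e e', ⟪σ x u e, A x e'⟫_ℝ = ⟪σ x u e', A x e⟫_ℝ)
    (hsymmT : ∀ x u, ∀ e ∈ eigenbundle τ 1 x ⊓ eigenbundle T 1 x,
      ∀ e' ∈ eigenbundle τ 1 x ⊓ eigenbundle T 1 x,
      ⟪T' x (σ x u e), A x e'⟫_ℝ = ⟪T' x (σ x u e'), A x e⟫_ℝ) :
    IsConcentratingRestriction FE FF
      (fun x => eigenbundle τ 1 x ⊓ eigenbundle T 1 x)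
      (fun x => eigenbundle τ' (-1) x ⊓ eigenbundle T' 1 x)
      (fun ξ x => eigenproj T' 1 x
        (diracOp nabla σ (fun x => eigenproj T 1 x ∘L eigenproj τ 1 x) ξ x))
      (fun x u => eigenproj T' 1 x ∘L σ x u)
      (fun x => eigenproj T' 1 x ∘L eigenproj τ' (-1) x ∘L A x) := by
  have hσF : ∀ x u, ∀ e ∈ eigenbundle τ 1 x, σ x u e ∈ eigenbundle τ' (-1) x := by
    intro x u e he
    rw [mem_eigenbundle, one_smul] at he
    have := hστ x u e
    rw [he] at this
    rw [mem_eigenbundle, neg_smul, one_smul]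
    exact (neg_eq_iff_eq_neg.2 this).symm
  refine isConcentratingRestriction_diracOp (q := eigenproj T' 1) hσ
    ((hT.smooth.preservesSmooth.eigenproj 1).comp (hτ.smooth.preservesSmooth.eigenproj 1))
    (fun x e => ⟨eigenproj_mem_of_comm hτT (eigenproj_mem hτ.involutive (by norm_num) e),
      eigenproj_mem hT.involutive (by norm_num) _⟩)
    (fun x e he => ?_) (hT'.smooth.preservesSmooth.eigenproj 1)
    (fun x u e he => ⟨eigenproj_mem_of_comm hτT' (hσF x u e he.1),
      eigenproj_mem hT'.involutive (by norm_num) _⟩)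
    ((hT'.smooth.preservesSmooth.eigenproj 1).comp
      ((hτ'.smooth.preservesSmooth.eigenproj (-1)).comp hA.preservesSmooth))
    (fun x e he => ⟨eigenproj_mem_of_comm hτT' (eigenproj_mem hτ'.involutive (by norm_num) _),
      eigenproj_mem hT'.involutive (by norm_num) _⟩) fun x u e he e' he' => ?_
  · rw [ContinuousLinearMap.comp_apply, eigenproj_eq_self (by norm_num) he.1,
      eigenproj_eq_self (by norm_num) he.2]
  -- `A` maps E⁺ to F⁻, so the parity projection drops out; the remaining projection is self-adjoint
  -- and idempotent and appears once, as ½(1 + T'). Only the term with T' needs a new symmetry.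
  · have key : ∀ e, ∀ e' ∈ eigenbundle τ 1 x,
        ⟪eigenproj T' 1 x (σ x u e), (eigenproj T' 1 x ∘L eigenproj τ' (-1) x ∘L A x) e'⟫_ℝ =
        (1 / 2 : ℝ) * (⟪σ x u e, A x e'⟫_ℝ + ⟪T' x (σ x u e), A x e'⟫_ℝ) := fun e e' he' => by
      rw [ContinuousLinearMap.comp_apply, ContinuousLinearMap.comp_apply,
        eigenproj_eq_self (by norm_num) (hAτ x e' he'),
        ← inner_eigenproj hT'.involutive hT'.isometry,
        eigenproj_eq_self (by norm_num) (eigenproj_mem hT'.involutive (by norm_num) _),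
        eigenproj_apply, one_smul, real_inner_smul_left, inner_add_left]
    rw [key e e' he'.1, key e' e he.1, hsymm x u e e', hsymmT x u e he e' he']

end Restriction

/-! ### Shuffle signs and products of Clifford generators -/

section Signs

variable {n : ℕ} {S S' R R' : Finset (Fin n)}

/-- Counting inversions as a product of signs makes the shuffle sign multiplicative in each
argument. -/
theorem shuffleSign_eq_prod (S R : Finset (Fin n)) :
    shuffleSign S R = ∏ a ∈ S, ∏ b ∈ R, if b < a then (-1 : ℂ) else 1 := by
  rw [shuffleSign, ← Finset.prod_product', Finset.prod_ite]
  simp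

theorem shuffleSign_mul_self (S R : Finset (Fin n)) : shuffleSign S R * shuffleSign S R = 1 := by
  rw [shuffleSign, ← mul_pow]
  simp

theorem norm_shuffleSign (S R : Finset (Fin n)) : ‖shuffleSign S R‖ = 1 := by
  simp [shuffleSign]

theorem shuffleSign_union_left (h : Disjoint S S') (R : Finset (Fin n)) :
    shuffleSign (S ∪ S') R = shuffleSign S R * shuffleSign S' R := by
  simp only [shuffleSign_eq_prod, Finset.prod_union h]

theorem shuffleSign_union_right (S : Finset (Fin n)) (h : Disjoint R R') :
    shuffleSign S (R ∪ R') = shuffleSign S R * shuffleSign S R' := by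
  simp only [shuffleSign_eq_prod, Finset.prod_union h, Finset.prod_mul_distrib]

theorem shuffleSign_insert_left {a : Fin n} (h : a ∉ S) (R : Finset (Fin n)) :
    shuffleSign (insert a S) R = shuffleSign {a} R * shuffleSign S R := by
  rw [Finset.insert_eq, shuffleSign_union_left (Finset.disjoint_singleton_left.2 h)]

theorem shuffleSign_insert_right {b : Fin n} (S : Finset (Fin n)) (h : b ∉ R) :
    shuffleSign S (insert b R) = shuffleSign S {b} * shuffleSign S R := by
  rw [Finset.insert_eq, shuffleSign_union_right S (Finset.disjoint_singleton_left.2 h)]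

theorem shuffleSign_singleton_of_gt {a b : Fin n} (h : b < a) : shuffleSign {a} {b} = -1 := by
  simp [shuffleSign_eq_prod, h]

theorem shuffleSign_singleton_eq_one {a : Fin n} (h : ∀ b ∈ R, a < b) :
    shuffleSign {a} R = 1 := by
  rw [shuffleSign_eq_prod, Finset.prod_singleton]
  exact Finset.prod_eq_one fun b hb => if_neg (h b hb).not_gt

/-- Each pair from S × R is an inversion in exactly one of the two orders. -/
theorem shuffleSign_mul_swap (h : Disjoint S R) :
    shuffleSign S R * shuffleSign R S = (-1) ^ (S.card * R.card) := by
  rw [shuffleSign_eq_prod, shuffleSign_eq_prod R S, Finset.prod_comm (s := R),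
    ← Finset.prod_mul_distrib]
  have : ∀ a ∈ S, (∏ b ∈ R, if b < a then (-1 : ℂ) else 1) *
      (∏ b ∈ R, if a < b then (-1 : ℂ) else 1) = (-1) ^ R.card := fun a ha => by
    rw [← Finset.prod_mul_distrib, ← Finset.prod_const]
    refine Finset.prod_congr rfl fun b hb => ?_
    rcases lt_trichotomy a b with hab | rfl | hab
    · simp [hab, hab.not_gt]
    · exact absurd hb (Finset.disjoint_left.1 h ha)
    · simp [hab, hab.not_gt]
  rw [Finset.prod_congr rfl this, Finset.prod_const, ← pow_mul, mul_comm]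

end Signs

namespace CliffordAction

variable {n : ℕ} {W : Type*} [NormedAddCommGroup W] [InnerProductSpace ℂ W]
  (κ : CliffordAction n W)

/-- Clifford multiplication by a basis vector. -/
def gen (j : Fin n) : Module.End ℂ W := κ.c (EuclideanSpace.single j (1 : ℝ))

theorem c_eq_sum (v : EuclideanSpace ℝ (Fin n)) (φ : W) :
    κ.c v φ = ∑ j, (v j : ℂ) • κ.gen j φ := by
  have : v = ∑ j, v j • EuclideanSpace.single j (1 : ℝ) := by
    simpa using ((EuclideanSpace.basisFun (Fin n) ℝ).sum_repr v).symm
  conv_lhs => rw [this]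
  simp only [map_sum, map_smul, LinearMap.sum_apply]
  rfl

theorem gen_mul_self (j : Fin n) : κ.gen j * κ.gen j = -1 := by
  ext φ
  have h := κ.clifford (EuclideanSpace.single j (1 : ℝ)) (EuclideanSpace.single j (1 : ℝ)) φ
  simp only [EuclideanSpace.inner_single_left] at h
  have h2 : (2 : ℂ) • (κ.gen j (κ.gen j φ)) = (2 : ℂ) • (-φ) := by
    rw [two_smul]
    refine h.trans ?_
    simp
  exact smul_right_injective W (two_ne_zero (α := ℂ)) h2

theorem gen_mul_gen {j k : Fin n} (hjk : j ≠ k) : κ.gen j * κ.gen k = -(κ.gen k * κ.gen j) := by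
  ext φ
  have h := κ.clifford (EuclideanSpace.single j (1 : ℝ)) (EuclideanSpace.single k (1 : ℝ)) φ
  simp [EuclideanSpace.inner_single_left, hjk] at h
  exact eq_neg_of_add_eq_zero_left h

theorem inner_gen (j : Fin n) (φ φ' : W) : ⟪κ.gen j φ, κ.gen j φ'⟫_ℂ = ⟪φ, φ'⟫_ℂ := by
  have h : κ.gen j (κ.gen j φ') = -φ' := DFunLike.congr_fun (κ.gen_mul_self j) φ'
  have := κ.skew (EuclideanSpace.single j (1 : ℝ)) φ (κ.gen j φ')
  refine this.trans ?_
  change -⟪φ, κ.gen j (κ.gen j φ')⟫_ℂ = _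
  rw [h, inner_neg_right, neg_neg]

theorem basisForm_empty : κ.basisForm ∅ = (1 : Module.End ℂ W) := by
  simp [basisForm]

theorem basisForm_insert_of_lt {a : Fin n} {S : Finset (Fin n)} (h : ∀ b ∈ S, a < b) :
    κ.basisForm (insert a S) = κ.gen a * κ.basisForm S := by
  have ha : a ∉ S := fun ha => (h a ha).ne rfl
  rw [basisForm, Finset.sort_insert (· ≤ ·) (fun b hb => (h b hb).le) ha, List.map_cons, List.prod_cons]
  rfl

theorem inner_basisForm (S : Finset (Fin n)) (φ φ' : W) :
    ⟪κ.basisForm S φ, κ.basisForm S φ'⟫_ℂ = ⟪φ, φ'⟫_ℂ := by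
  induction S using Finset.induction_on_min generalizing φ φ' with
  | empty => rw [basisForm_empty]; rfl
  | insert a S ha ih =>
    rw [basisForm_insert_of_lt κ ha]
    exact (κ.inner_gen a _ _).trans (ih _ _)

/-- Moving e_j to its place past the smaller generators costs one sign for each, the same count as
for e_j ∧ e_S. Induction on the least element peels these generators off one at a time. -/
theorem gen_mul_basisForm {j : Fin n} {S : Finset (Fin n)} (hj : j ∉ S) :
    κ.gen j * κ.basisForm S = shuffleSign {j} S • κ.basisForm (insert j S) := by
  induction S using Finset.induction_on_min with
  | empty =>
    rw [κ.basisForm_insert_of_lt (by simp), shuffleSign_singleton_eq_one (by simp), one_smul]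
  | insert a S ha ih =>
    rw [Finset.mem_insert, not_or] at hj
    have haS : a ∉ S := fun h => (ha a h).ne rfl
    rcases lt_or_gt_of_ne hj.1 with hja | hja
    · have h : ∀ b ∈ insert a S, j < b := fun b hb => by
        rcases Finset.mem_insert.1 hb with rfl | hb
        exacts [hja, hja.trans (ha b hb)]
      rw [κ.basisForm_insert_of_lt h, shuffleSign_singleton_eq_one h, one_smul]
    · have h : ∀ b ∈ insert j S, a < b := fun b hb => by
        rcases Finset.mem_insert.1 hb with rfl | hb
        exacts [hja, ha b hb]
      rw [Finset.insert_comm, κ.basisForm_insert_of_lt h, κ.basisForm_insert_of_lt ha,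
        shuffleSign_insert_right _ haS, shuffleSign_singleton_of_gt hja, ← mul_assoc,
        κ.gen_mul_gen hj.1, neg_mul, mul_assoc, ih hj.2, mul_smul_comm, neg_one_mul, neg_smul]

theorem gen_mul_basisForm_insert {j : Fin n} {S : Finset (Fin n)} (hj : j ∉ S) :
    κ.gen j * κ.basisForm (insert j S) = -shuffleSign {j} S • κ.basisForm S := by
  have h : κ.basisForm (insert j S) = shuffleSign {j} S • (κ.gen j * κ.basisForm S) := by
    rw [κ.gen_mul_basisForm hj, smul_smul, shuffleSign_mul_self, one_smul]
  rw [h, mul_smul_comm, ← mul_assoc, gen_mul_self, neg_one_mul, smul_neg, neg_smul]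

theorem basisForm_mul_basisForm {S R : Finset (Fin n)} (h : Disjoint S R) :
    κ.basisForm S * κ.basisForm R = shuffleSign S R • κ.basisForm (S ∪ R) := by
  induction S using Finset.induction_on_min with
  | empty => simp [basisForm_empty, shuffleSign]
  | insert a S ha ih =>
    rw [Finset.disjoint_insert_left] at h
    have haS : a ∉ S := fun h => (ha a h).ne rfl
    have haR : a ∉ S ∪ R := by simp [haS, h.1]
    rw [κ.basisForm_insert_of_lt ha, mul_assoc, ih h.2, mul_smul_comm, κ.gen_mul_basisForm haR,
      smul_smul, Finset.insert_union, shuffleSign_union_right _ h.2,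
      shuffleSign_singleton_eq_one ha, one_mul, shuffleSign_insert_left haS, mul_comm]

/-- A generator anticommutes with every other generator and commutes with itself, which accounts for
the correction when j ∈ S. -/
theorem gen_mul_basisForm_comm (j : Fin n) (S : Finset (Fin n)) :
    κ.gen j * κ.basisForm S =
      ((-1 : ℂ) ^ S.card * if j ∈ S then -1 else 1) • (κ.basisForm S * κ.gen j) := by
  induction S using Finset.induction_on_min with
  | empty => simp [basisForm_empty]
  | insert a S ha ih =>
    have haS : a ∉ S := fun h => (ha a h).ne rfl
    rw [κ.basisForm_insert_of_lt ha, Finset.card_insert_of_notMem haS]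
    by_cases hja : j = a
    · subst hja
      rw [if_neg haS, mul_one] at ih
      rw [mul_assoc, ih, if_pos (Finset.mem_insert_self _ _), pow_succ]
      simp
    · rw [← mul_assoc, κ.gen_mul_gen hja, neg_mul, mul_assoc, ih, mul_smul_comm, mul_assoc,
        ← neg_smul, pow_succ]
      simp only [Finset.mem_insert, hja, false_or]
      congr 1
      ring

theorem basisForm_mul_self (S : Finset (Fin n)) :
    κ.basisForm S * κ.basisForm S = ((-1 : ℂ) ^ (S.card + 1).choose 2) • (1 : Module.End ℂ W) := by
  induction S using Finset.induction_on_min with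
  | empty => simp [basisForm_empty]
  | insert a S ha ih =>
    have haS : a ∉ S := fun h => (ha a h).ne rfl
    have hc := κ.gen_mul_basisForm_comm a S
    rw [if_neg haS, mul_one] at hc
    rw [κ.basisForm_insert_of_lt ha, Finset.card_insert_of_notMem haS]
    have : κ.gen a * κ.basisForm S * (κ.gen a * κ.basisForm S) =
        (-1 : ℂ) ^ S.card • (κ.basisForm S * (κ.gen a * κ.gen a) * κ.basisForm S) := by
      conv_lhs => enter [1]; rw [hc]
      simp only [smul_mul_assoc, mul_assoc]
    rw [this, gen_mul_self, mul_neg_one, neg_mul, ih, Nat.choose_succ_succ' (S.card + 1) 1,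
      Nat.choose_one_right, smul_neg, smul_smul, ← neg_smul, pow_add, pow_succ]
    simp

end CliffordAction

/-! ### Parity and self-duality of forms -/

section Forms

variable {n : ℕ}

theorem formParity_apply (α : Form n) (S : Finset (Fin n)) :
    formParity n α S = (-1) ^ (S.card + 1) * α S := rfl

theorem formClifford_apply (v : EuclideanSpace ℝ (Fin n)) (α : Form n) (S : Finset (Fin n)) :
    formClifford v α S = ∑ j ∈ S, shuffleSign {j} (S.erase j) * (v j : ℂ) * α (S.erase j) -
      ∑ j ∈ Sᶜ, shuffleSign {j} S * (v j : ℂ) * α (insert j S) := rfl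

/-- A signed permutation of the coordinates of a form is an isometry. -/
theorem inner_eq_of_signedPerm {f : Form n → Form n} {a : Finset (Fin n) → ℂ}
    {r : Finset (Fin n) → Finset (Fin n)} (ha : ∀ S, ‖a S‖ = 1) (hr : Function.Bijective r)
    (hf : ∀ α S, f α S = a S * α (r S)) (α β : Form n) : ⟪f α, f β⟫_ℂ = ⟪α, β⟫_ℂ := by
  simp only [PiLp.inner_apply, hf]
  refine Eq.trans (Finset.sum_congr rfl fun S _ => ?_)
    (hr.sum_comp fun S => ⟪α S, β S⟫_ℂ)
  have h : (starRingEnd ℂ) (a S) * a S = 1 := by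
    rw [mul_comm, Complex.mul_conj, Complex.normSq_eq_norm_sq, ha]
    simp
  simp only [RCLike.inner_apply, map_mul]
  linear_combination (β (r S) * (starRingEnd ℂ) (α (r S))) * h

theorem formParity_formParity (α : Form n) : formParity n (formParity n α) = α := by
  ext S
  rw [formParity_apply, formParity_apply, ← mul_assoc, ← pow_add, ← two_mul, pow_mul]
  simp

theorem inner_formParity (α β : Form n) : ⟪formParity n α, formParity n β⟫_ℂ = ⟪α, β⟫_ℂ :=
  inner_eq_of_signedPerm (a := fun S => (-1) ^ (S.card + 1)) (r := id) (by simp)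
    Function.bijective_id (fun _ _ => rfl) α β

/-- Both exterior and interior multiplication change the degree by one, hence reverse parity. -/
theorem formClifford_formParity (v : EuclideanSpace ℝ (Fin n)) (α : Form n) :
    formClifford v (formParity n α) = -formParity n (formClifford v α) := by
  ext S
  have h1 : ∀ j ∈ S, (-1 : ℂ) ^ ((S.erase j).card + 1) = -(-1) ^ (S.card + 1) := fun j hj => by
    rw [Finset.card_erase_add_one hj, pow_succ]
    ring
  have h2 : ∀ j ∈ Sᶜ, (-1 : ℂ) ^ ((insert j S).card + 1) = -(-1) ^ (S.card + 1) := fun j hj => by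
    rw [Finset.card_insert_of_notMem (Finset.mem_compl.1 hj), pow_succ _ (S.card + 1)]
    ring
  have e1 : ∑ j ∈ S, shuffleSign {j} (S.erase j) * (v j : ℂ) * formParity n α (S.erase j) =
      -(-1) ^ (S.card + 1) * ∑ j ∈ S, shuffleSign {j} (S.erase j) * (v j : ℂ) * α (S.erase j) := by
    rw [Finset.mul_sum]
    refine Finset.sum_congr rfl fun j hj => ?_
    rw [formParity_apply, h1 j hj, mul_left_comm]
  have e2 : ∑ j ∈ Sᶜ, shuffleSign {j} S * (v j : ℂ) * formParity n α (insert j S) =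
      -(-1) ^ (S.card + 1) * ∑ j ∈ Sᶜ, shuffleSign {j} S * (v j : ℂ) * α (insert j S) := by
    rw [Finset.mul_sum]
    refine Finset.sum_congr rfl fun j hj => ?_
    rw [formParity_apply, h2 j hj, mul_left_comm]
  rw [PiLp.neg_apply, formParity_apply, formClifford_apply, formClifford_apply, e1, e2]
  ring

theorem hodgeStar_apply (α : Form n) (S : Finset (Fin n)) :
    hodgeStar n α S = shuffleSign Sᶜ S * α Sᶜ := rfl

/-- The signs in the formula for `formSelfDuality`. -/
def selfDualitySign (k : ℕ) (S : Finset (Fin n)) : ℂ :=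
  if S.card < k then 1 else if S.card = k then shuffleSign Sᶜ S else -1

/-- The permutation of the index sets in the formula for `formSelfDuality`. -/
def selfDualityPerm (k : ℕ) (S : Finset (Fin n)) : Finset (Fin n) :=
  if S.card = k then Sᶜ else S

theorem formSelfDuality_apply (k : ℕ) (α : Form n) (S : Finset (Fin n)) :
    formSelfDuality n k α S = selfDualitySign k S * α (selfDualityPerm k S) := by
  change (if S.card < k then α S else if S.card = k then hodgeStar n α S else -α S) = _
  rw [selfDualitySign, selfDualityPerm, hodgeStar_apply]
  by_cases h : S.card = k
  · simp [h]
  · simp only [h, if_false]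
    split_ifs <;> simp

theorem card_compl_of_eq {k : ℕ} (hn : n = 2 * k) {S : Finset (Fin n)} (h : S.card = k) :
    Sᶜ.card = k := by
  rw [Finset.card_compl, Fintype.card_fin]
  omega

theorem selfDualityPerm_involutive {k : ℕ} (hn : n = 2 * k) :
    Function.Involutive (selfDualityPerm (n := n) k) := by
  intro S
  by_cases h : S.card = k
  · rw [selfDualityPerm, selfDualityPerm, if_pos h, if_pos (card_compl_of_eq hn h), compl_compl]
  · rw [selfDualityPerm, selfDualityPerm, if_neg h, if_neg h]

theorem card_selfDualityPerm {k : ℕ} (hn : n = 2 * k) (S : Finset (Fin n)) :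
    (selfDualityPerm k S).card = S.card := by
  rw [selfDualityPerm]
  split_ifs with h
  · rw [card_compl_of_eq hn h, h]
  · rfl

theorem norm_selfDualitySign (k : ℕ) (S : Finset (Fin n)) : ‖selfDualitySign k S‖ = 1 := by
  rw [selfDualitySign]
  split_ifs <;> simp [norm_shuffleSign]

/-- Outside the middle degree the signs square to 1. In degree k the two shuffle signs multiply to
(−1)^(k·k), which is 1 because k is even. -/
theorem formSelfDuality_involutive {k : ℕ} (hn : n = 2 * k) (hk : Even k) (α : Form n) :
    formSelfDuality n k (formSelfDuality n k α) = α := by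
  ext S
  rw [formSelfDuality_apply, formSelfDuality_apply, selfDualityPerm_involutive hn, ← mul_assoc]
  have h : selfDualitySign k S * selfDualitySign k (selfDualityPerm k S) = 1 := by
    by_cases h : S.card = k
    · have h' := card_compl_of_eq hn h
      simp only [selfDualitySign, selfDualityPerm, h, h', if_true, lt_irrefl, if_false, compl_compl]
      rw [shuffleSign_mul_swap disjoint_compl_left, h, h', (hk.mul_right k).neg_one_pow]
    · simp only [selfDualitySign, selfDualityPerm, h, if_false]
      split_ifs <;> simp
  rw [h, one_mul]

theorem inner_formSelfDuality {k : ℕ} (hn : n = 2 * k) (α β : Form n) :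
    ⟪formSelfDuality n k α, formSelfDuality n k β⟫_ℂ = ⟪α, β⟫_ℂ :=
  inner_eq_of_signedPerm (norm_selfDualitySign k) (selfDualityPerm_involutive hn).bijective
    (formSelfDuality_apply k) α β

theorem formParity_formSelfDuality {k : ℕ} (hn : n = 2 * k) (α : Form n) :
    formParity n (formSelfDuality n k α) = formSelfDuality n k (formParity n α) := by
  ext S
  rw [formParity_apply, formSelfDuality_apply, formSelfDuality_apply, formParity_apply,
    card_selfDualityPerm hn, mul_left_comm]

end Forms

theorem sum_sum_mem_eq_sum_sum_compl {ι G : Type*} [Fintype ι] [DecidableEq ι] [AddCommMonoid G]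
    (f : ι → Finset ι → G) :
    ∑ S, ∑ j ∈ S, f j S = ∑ S : Finset ι, ∑ j ∈ Sᶜ, f j (insert j S) := by
  rw [Finset.sum_sigma', Finset.sum_sigma']
  refine Finset.sum_bij' (fun x _ => ⟨x.1.erase x.2, x.2⟩) (fun x _ => ⟨insert x.2 x.1, x.2⟩)
    ?_ ?_ ?_ ?_ ?_
  · simp
  · simp
  · rintro ⟨S, j⟩ h
    simp only [Finset.mem_sigma, Finset.mem_univ, true_and] at h
    simp [Finset.insert_erase h]
  · rintro ⟨S, j⟩ h
    simp only [Finset.mem_sigma, Finset.mem_univ, true_and, Finset.mem_compl] at h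
    simp [Finset.erase_insert h]
  · rintro ⟨S, j⟩ h
    simp only [Finset.mem_sigma, Finset.mem_univ, true_and] at h
    simp [Finset.insert_erase h]

/-! ### Clifford action of forms on a spinor -/

namespace CliffordAction

variable {n : ℕ} {W : Type*} [NormedAddCommGroup W] [InnerProductSpace ℂ W]
  (κ : CliffordAction n W)

theorem formToSpinor_apply (ψ : W) (α : Form n) :
    κ.formToSpinor ψ α = ∑ S, α S • κ.basisForm S ψ := rfl

/-- Clifford multiplication of forms intertwines the symbol of `d + d*` with Clifford multiplication
of spinors. -/
theorem formToSpinor_formClifford (ψ : W) (v : EuclideanSpace ℝ (Fin n)) (α : Form n) :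
    κ.formToSpinor ψ (formClifford v α) = κ.c v (κ.formToSpinor ψ α) := by
  have h1 : ∀ S : Finset (Fin n), ∀ j ∈ Sᶜ, κ.gen j (κ.basisForm S ψ) =
      shuffleSign {j} S • κ.basisForm (insert j S) ψ := fun S j hj =>
    DFunLike.congr_fun (κ.gen_mul_basisForm (Finset.mem_compl.1 hj)) ψ
  have h2 : ∀ S : Finset (Fin n), ∀ j ∈ Sᶜ, κ.gen j (κ.basisForm (insert j S) ψ) =
      -shuffleSign {j} S • κ.basisForm S ψ := fun S j hj =>
    DFunLike.congr_fun (κ.gen_mul_basisForm_insert (Finset.mem_compl.1 hj)) ψ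
  have hR : κ.c v (κ.formToSpinor ψ α) =
      ∑ S, ∑ j ∈ S, (α S * (v j : ℂ)) • κ.gen j (κ.basisForm S ψ) +
      ∑ S, ∑ j ∈ Sᶜ, (α S * (v j : ℂ)) • κ.gen j (κ.basisForm S ψ) := by
    rw [formToSpinor_apply, map_sum, ← Finset.sum_add_distrib]
    refine Finset.sum_congr rfl fun S _ => ?_
    rw [Finset.sum_add_sum_compl, map_smul, c_eq_sum, Finset.smul_sum]
    simp only [smul_smul]
  have hL : κ.formToSpinor ψ (formClifford v α) =
      ∑ S, ∑ j ∈ S, (shuffleSign {j} (S.erase j) * (v j : ℂ) * α (S.erase j)) • κ.basisForm S ψ -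
      ∑ S, ∑ j ∈ Sᶜ, (shuffleSign {j} S * (v j : ℂ) * α (insert j S)) • κ.basisForm S ψ := by
    rw [formToSpinor_apply, ← Finset.sum_sub_distrib]
    refine Finset.sum_congr rfl fun S _ => ?_
    rw [formClifford_apply, sub_smul, Finset.sum_smul, Finset.sum_smul]
  -- All four sums are indexed by pairs (S, j) with j ∉ S; the exterior product then matches e_j ·
  -- e_S and the interior product matches e_j · e_{S ∪ {j}} = ∓e_S, term by term.
  rw [hL, hR, sum_sum_mem_eq_sum_sum_compl fun j S =>
      (shuffleSign {j} (S.erase j) * (v j : ℂ) * α (S.erase j)) • κ.basisForm S ψ,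
    sum_sum_mem_eq_sum_sum_compl fun j S => (α S * (v j : ℂ)) • κ.gen j (κ.basisForm S ψ),
    ← Finset.sum_sub_distrib, ← Finset.sum_add_distrib]
  refine Finset.sum_congr rfl fun S _ => ?_
  rw [← Finset.sum_sub_distrib, ← Finset.sum_add_distrib]
  refine Finset.sum_congr rfl fun j hj => ?_
  rw [Finset.erase_insert (Finset.mem_compl.1 hj), h1 S j hj, h2 S j hj, smul_smul, smul_smul,
    sub_eq_add_neg, ← neg_smul, add_comm]
  congr 2 <;> ring

section Even

variable {m : ℕ}

/-- The volume element has n factors, one of them e_j itself, so the commutation sign is (−1)ⁿ⁻¹ =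
−1. -/
theorem chirality_gen (hn : n = 2 * m) (j : Fin n) (φ : W) :
    κ.chirality m (κ.gen j φ) = -κ.gen j (κ.chirality m φ) := by
  have h := DFunLike.congr_fun (κ.gen_mul_basisForm_comm j Finset.univ) φ
  have h' : κ.gen j (κ.basisForm Finset.univ φ) = -κ.basisForm Finset.univ (κ.gen j φ) := by
    refine h.trans ?_
    simp [hn]
  rw [chirality, LinearMap.smul_apply, LinearMap.smul_apply, map_smul, h', smul_neg, neg_neg]

theorem chirality_c (hn : n = 2 * m) (v : EuclideanSpace ℝ (Fin n)) (φ : W) :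
    κ.chirality m (κ.c v φ) = -κ.c v (κ.chirality m φ) := by
  rw [c_eq_sum, c_eq_sum, map_sum, ← Finset.sum_neg_distrib]
  refine Finset.sum_congr rfl fun j _ => ?_
  rw [map_smul, κ.chirality_gen hn, smul_neg]

theorem chirality_basisForm (hn : n = 2 * m) (S : Finset (Fin n)) (φ : W) :
    κ.chirality m (κ.basisForm S φ) = (-1 : ℂ) ^ S.card • κ.basisForm S (κ.chirality m φ) := by
  induction S using Finset.induction_on_min with
  | empty => rw [basisForm_empty]; simp
  | insert a S ha ih =>
    have haS : a ∉ S := fun h => (ha a h).ne rfl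
    rw [κ.basisForm_insert_of_lt ha, Module.End.mul_apply, κ.chirality_gen hn, ih, map_smul,
      Finset.card_insert_of_notMem haS, pow_succ, mul_neg_one, neg_smul]
    rfl

/-- c(dvol)² = (−1)^(m(2m+1)) = (−1)^m, which cancels (i^m)². -/
theorem chirality_chirality (hn : n = 2 * m) (φ : W) : κ.chirality m (κ.chirality m φ) = φ := by
  have h := DFunLike.congr_fun (κ.basisForm_mul_self Finset.univ) φ
  have h' : κ.basisForm Finset.univ (κ.basisForm Finset.univ φ) = (-1 : ℂ) ^ m • φ := by
    refine h.trans ?_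
    have : (n + 1).choose 2 = m * (2 * m + 1) := by
      rw [Nat.choose_two_right, Nat.add_sub_cancel, hn, mul_comm, mul_assoc,
        Nat.mul_div_cancel_left _ two_pos]
    rw [Finset.card_univ, Fintype.card_fin, this, mul_comm m, pow_mul,
      Odd.neg_one_pow ⟨m, rfl⟩]
    rfl
  rw [chirality, LinearMap.smul_apply, LinearMap.smul_apply, map_smul, h', smul_smul, smul_smul,
    ← mul_pow, ← mul_pow]
  simp

theorem inner_chirality (φ φ' : W) : ⟪κ.chirality m φ, κ.chirality m φ'⟫_ℂ = ⟪φ, φ'⟫_ℂ := by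
  rw [chirality, LinearMap.smul_apply, LinearMap.smul_apply, inner_smul_left, inner_smul_right,
    inner_basisForm, ← mul_assoc, map_pow, ← mul_pow]
  simp

theorem inner_chirality_left (hn : n = 2 * m) (φ φ' : W) :
    ⟪κ.chirality m φ, φ'⟫_ℂ = ⟪φ, κ.chirality m φ'⟫_ℂ := by
  rw [← κ.inner_chirality (m := m), κ.chirality_chirality hn]

/-- Moving the chirality operator past c(e_S) gives (−1)^|S| and then it fixes ψ, while parity acts
by (−1)^(|S|+1). -/
theorem formToSpinor_formParity (hn : n = 2 * m) {ψ : W} (hψ : κ.chirality m ψ = ψ) (α : Form n) :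
    κ.formToSpinor ψ (formParity n α) = -κ.chirality m (κ.formToSpinor ψ α) := by
  rw [formToSpinor_apply, formToSpinor_apply, map_sum, ← Finset.sum_neg_distrib]
  refine Finset.sum_congr rfl fun S _ => ?_
  rw [map_smul, κ.chirality_basisForm hn, hψ, formParity_apply, smul_smul, ← neg_smul, pow_succ]
  congr 1
  ring

/-- Let |S| = m = 2l. Then c(e_S)c(e_{Sᶜ}) = ±c(dvol), c(e_S)² = (−1)^l, and positive chirality
means c(dvol)ψ = (−1)^l ψ. Multiplying the first identity by c(e_S) makes the two signs (−1)^l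
cancel and leaves the shuffle sign. -/
theorem basisForm_compl (hn : n = 2 * m) (hm : Even m) {ψ : W} (hψ : κ.chirality m ψ = ψ)
    {S : Finset (Fin n)} (hS : S.card = m) :
    shuffleSign S Sᶜ • κ.basisForm Sᶜ ψ = κ.basisForm S ψ := by
  obtain ⟨l, rfl⟩ := hm
  have h1 := DFunLike.congr_fun (κ.basisForm_mul_basisForm (disjoint_compl_right (a := S))) ψ
  rw [Finset.union_compl] at h1
  have h2 := DFunLike.congr_fun (κ.basisForm_mul_self S) (κ.basisForm Sᶜ ψ)
  have h3 : Complex.I ^ (l + l) • κ.basisForm Finset.univ ψ = ψ := hψ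
  have h4 : κ.basisForm S (κ.basisForm Sᶜ ψ) =
      shuffleSign S Sᶜ • κ.basisForm Finset.univ ψ := h1
  have h5 : κ.basisForm S (κ.basisForm S (κ.basisForm Sᶜ ψ)) =
      (-1 : ℂ) ^ (S.card + 1).choose 2 • κ.basisForm Sᶜ ψ := h2
  have e : (S.card + 1).choose 2 = l * (2 * l + 1) := by
    rw [Nat.choose_two_right, Nat.add_sub_cancel, hS, ← two_mul, mul_comm, mul_assoc,
      Nat.mul_div_cancel_left _ two_pos]
  have e' : Complex.I ^ (l + l) = (-1) ^ l := by rw [← two_mul, pow_mul, Complex.I_sq]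
  rw [e, mul_comm l, pow_mul, Odd.neg_one_pow ⟨l, rfl⟩, h4, map_smul] at h5
  have e2 : (-1 : ℂ) ^ l * (-1) ^ l = 1 := by rw [← mul_pow]; simp
  calc shuffleSign S Sᶜ • κ.basisForm Sᶜ ψ =
        (shuffleSign S Sᶜ * (-1) ^ l) • (-1 : ℂ) ^ l • κ.basisForm Sᶜ ψ := by
        rw [smul_smul, mul_assoc, e2, mul_one]
    _ = (-1 : ℂ) ^ l • κ.basisForm S (κ.basisForm Finset.univ ψ) := by
        rw [← h5, smul_smul, mul_right_comm, shuffleSign_mul_self, one_mul]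
    _ = κ.basisForm S ψ := by rw [← map_smul, ← e', h3]

end Even

end CliffordAction

/-! ### Involutions and the pairing on spinor-form pairs -/

theorem inner_formParity_left {n : ℕ} (α β : Form n) :
    ⟪formParity n α, β⟫_ℂ = ⟪α, formParity n β⟫_ℂ := by
  rw [← inner_formParity, formParity_formParity]

theorem card_odd_of_formParity_eq {n : ℕ} {α : Form n} (h : formParity n α = α)
    {S : Finset (Fin n)} (hS : α S ≠ 0) : Odd S.card := by
  by_contra hodd
  rw [Nat.not_odd_iff_even] at hodd
  have h1 := congrArg (fun β : Form n => β S) h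
  simp only [formParity_apply, pow_succ, hodd.neg_one_pow, one_mul, neg_one_mul] at h1
  exact hS (self_eq_neg.1 h1.symm)

theorem card_le_of_formSelfDuality_eq {n k : ℕ} {α : Form n} (h : formSelfDuality n k α = α)
    {S : Finset (Fin n)} (hS : α S ≠ 0) : S.card ≤ k := by
  by_contra hk
  have h1 := congrArg (fun β : Form n => β S) h
  have h2 : ¬ S.card < k := fun h => hk h.le
  have h3 : S.card ≠ k := fun h => hk h.le
  simp only [formSelfDuality_apply, selfDualitySign, selfDualityPerm, h2, h3, if_false,
    neg_one_mul] at h1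
  exact hS (self_eq_neg.1 h1.symm)

theorem formClifford_eq_zero_of_card {n k : ℕ} {α : Form n} (h : ∀ S, α S ≠ 0 → S.card < k)
    (v : EuclideanSpace ℝ (Fin n)) {S : Finset (Fin n)} (hS : k < S.card) :
    formClifford v α S = 0 := by
  have h' : ∀ R : Finset (Fin n), k ≤ R.card → α R = 0 := fun R hR => by
    by_contra hα
    exact (h R hα).not_ge hR
  rw [formClifford_apply, Finset.sum_eq_zero, Finset.sum_eq_zero, sub_zero]
  · intro j hj
    rw [h', mul_zero]
    rw [Finset.card_insert_of_notMem (Finset.mem_compl.1 hj)]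
    omega
  · intro j hj
    rw [h', mul_zero]
    rw [Finset.card_erase_of_mem hj]
    omega

theorem inner_pair {V V' : Type*} [NormedAddCommGroup V] [InnerProductSpace ℂ V]
    [NormedAddCommGroup V'] [InnerProductSpace ℂ V'] (a a' : V) (b b' : V') :
    ⟪WithLp.toLp 2 (a, b), WithLp.toLp 2 (a', b')⟫_ℂ = ⟪a, a'⟫_ℂ + ⟪b, b'⟫_ℂ :=
  WithLp.prod_inner_apply _ _

namespace CliffordAction

variable {n : ℕ} {W : Type*} [NormedAddCommGroup W] [InnerProductSpace ℂ W]
  (κ : CliffordAction n W) {m : ℕ}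

/-- Forms of degree at most `n / 2` and their images under the self-duality involution act in the
same way on a spinor of positive chirality. -/
theorem formToSpinor_formSelfDuality (hn : n = 2 * m) (hm : Even m) {ψ : W}
    (hψ : κ.chirality m ψ = ψ) {α : Form n} (hα : ∀ S : Finset (Fin n), m < S.card → α S = 0) :
    κ.formToSpinor ψ (formSelfDuality n m α) = κ.formToSpinor ψ α := by
  rw [formToSpinor_apply, formToSpinor_apply,
    ← (selfDualityPerm_involutive hn).bijective.sum_comp]
  refine Finset.sum_congr rfl fun S _ => ?_
  rw [formSelfDuality_apply, selfDualityPerm_involutive hn]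
  rcases lt_trichotomy S.card m with h | h | h
  · simp [selfDualitySign, selfDualityPerm, h, h.ne]
  -- In the middle degree the Hodge star moves the coefficient of e_S to e_{Sᶜ} with a shuffle sign,
  -- and `basisForm_compl` says that this does not change the action on ψ. The degrees above, where
  -- the involution is −1, are excluded by hypothesis.
  · have h' := card_compl_of_eq hn h
    simp only [selfDualitySign, selfDualityPerm, h, h', lt_irrefl, if_false, if_true, compl_compl]
    rw [← κ.basisForm_compl hn hm hψ h, smul_smul, mul_comm]
  · simp [hα S h]

theorem pairParity_pairParity (hn : n = 2 * m) (w : WithLp 2 (W × Form n)) :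
    κ.pairParity m (κ.pairParity m w) = w :=
  congrArg (WithLp.toLp 2) (Prod.ext (κ.chirality_chirality hn _) (formParity_formParity _))

theorem inner_pairParity (w w' : WithLp 2 (W × Form n)) :
    ⟪κ.pairParity m w, κ.pairParity m w'⟫_ℂ = ⟪w, w'⟫_ℂ := by
  rw [pairParity, pairParity, inner_pair, inner_chirality, inner_formParity]
  exact (inner_pair _ _ _ _).symm

theorem pairSymbol_pairParity (hn : n = 2 * m) (v : EuclideanSpace ℝ (Fin n))
    (w : WithLp 2 (W × Form n)) :
    κ.pairSymbol v (κ.pairParity m w) = -κ.pairParity m (κ.pairSymbol v w) :=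
  congrArg (WithLp.toLp 2) (Prod.ext (neg_eq_iff_eq_neg.1 (κ.chirality_c hn v _).symm)
    (formClifford_formParity v _))

theorem pairSelfDuality_pairSelfDuality (hn : n = 2 * m) (hm : Even m)
    (w : WithLp 2 (W × Form n)) : pairSelfDuality m (pairSelfDuality m w) = w :=
  congrArg (WithLp.toLp 2) (Prod.ext rfl (formSelfDuality_involutive hn hm _))

theorem inner_pairSelfDuality (hn : n = 2 * m) (w w' : WithLp 2 (W × Form n)) :
    ⟪pairSelfDuality m w, pairSelfDuality m w'⟫_ℂ = ⟪w, w'⟫_ℂ := by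
  rw [pairSelfDuality, pairSelfDuality, inner_pair, inner_formSelfDuality hn]
  exact (inner_pair _ _ _ _).symm

theorem pairParity_pairSelfDuality (hn : n = 2 * m) (w : WithLp 2 (W × Form n)) :
    κ.pairParity m (pairSelfDuality m w) = pairSelfDuality m (κ.pairParity m w) :=
  congrArg (WithLp.toLp 2) (Prod.ext rfl (formParity_formSelfDuality hn _))

variable [FiniteDimensional ℂ W]

/-- The spinor component is `formToSpinor_formParity`; the form component is its adjoint, as
chirality and parity are self-adjoint. -/
theorem pairPerturbation_pairParity (hn : n = 2 * m) {ψ : W} (hψ : κ.chirality m ψ = ψ)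
    (w : WithLp 2 (W × Form n)) :
    κ.pairPerturbation ψ (κ.pairParity m w) = -κ.pairParity m (κ.pairPerturbation ψ w) := by
  refine congrArg (WithLp.toLp 2) (Prod.ext (κ.formToSpinor_formParity hn hψ _) ?_)
  change -LinearMap.adjoint (κ.formToSpinor ψ) (κ.chirality m w.fst) =
    -formParity n (-LinearMap.adjoint (κ.formToSpinor ψ) w.fst)
  rw [map_neg, neg_neg, neg_eq_iff_eq_neg]
  refine ext_inner_right ℂ fun α => ?_
  rw [LinearMap.adjoint_inner_left, inner_chirality_left _ hn, inner_neg_left,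
    inner_formParity_left, LinearMap.adjoint_inner_left, κ.formToSpinor_formParity hn hψ,
    inner_neg_right, neg_neg]

/-- Moving P_ψ* across, intertwining the two Clifford actions and using c(v)* = −c(v) turns the
second term into the mirror image of the first. Exchanging w and w' conjugates the sum, so its real
part is symmetric. -/
theorem inner_pairSymbol_pairPerturbation (ψ : W) (v : EuclideanSpace ℝ (Fin n))
    (w w' : WithLp 2 (W × Form n)) :
    ⟪κ.pairSymbol v w, κ.pairPerturbation ψ w'⟫_ℂ =
      ⟪κ.c v w.fst, κ.formToSpinor ψ w'.snd⟫_ℂ + ⟪κ.formToSpinor ψ w.snd, κ.c v w'.fst⟫_ℂ := by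
  rw [pairSymbol, pairPerturbation, inner_pair, inner_neg_right, LinearMap.adjoint_inner_right,
    formToSpinor_formClifford, κ.skew v (κ.formToSpinor ψ w.snd), neg_neg]

/-- The pair of the symbol of `D_A ⊕ (d + d*)` and of `A_ψ` is concentrating. -/
theorem re_inner_pairSymbol_pairPerturbation_symm (ψ : W) (v : EuclideanSpace ℝ (Fin n))
    (w w' : WithLp 2 (W × Form n)) :
    (⟪κ.pairSymbol v w, κ.pairPerturbation ψ w'⟫_ℂ).re =
      (⟪κ.pairSymbol v w', κ.pairPerturbation ψ w⟫_ℂ).re := by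
  rw [inner_pairSymbol_pairPerturbation, inner_pairSymbol_pairPerturbation, Complex.add_re,
    Complex.add_re, add_comm]
  congr 1
  · exact inner_re_symm (𝕜 := ℂ) _ _
  · exact inner_re_symm (𝕜 := ℂ) _ _

theorem inner_pairSelfDuality_pairSymbol (hn : n = 2 * m) (hm : Even m) {ψ : W}
    (hψ : κ.chirality m ψ = ψ) (v : EuclideanSpace ℝ (Fin n)) {w : WithLp 2 (W × Form n)}
    (hw : κ.pairParity m w = w) (hTw : pairSelfDuality m w = w) (w' : WithLp 2 (W × Form n)) :
    ⟪pairSelfDuality m (κ.pairSymbol v w), κ.pairPerturbation ψ w'⟫_ℂ =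
      ⟪κ.pairSymbol v w, κ.pairPerturbation ψ w'⟫_ℂ := by
  have h1 : formParity n w.snd = w.snd := congrArg WithLp.snd hw
  have h2 : formSelfDuality n m w.snd = w.snd := congrArg WithLp.snd hTw
  -- Self-duality bounds the degrees by m; parity makes them odd, and m is even, so m itself is
  -- excluded. The symbol raises degree by at most one and hence stays in degrees at most m.
  have h3 : ∀ S, w.snd S ≠ 0 → S.card < m := fun S hS =>
    (card_le_of_formSelfDuality_eq h2 hS).lt_of_ne fun h =>
      Nat.not_even_iff_odd.2 (card_odd_of_formParity_eq h1 hS) (h ▸ hm)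
  have h4 := κ.formToSpinor_formSelfDuality hn hm hψ
    fun S hS => formClifford_eq_zero_of_card h3 v hS
  rw [pairSymbol, pairSelfDuality, pairPerturbation, inner_pair, inner_pair, inner_neg_right,
    inner_neg_right, LinearMap.adjoint_inner_right, LinearMap.adjoint_inner_right]
  exact congrArg (fun φ => _ + -⟪φ, _⟫_ℂ) h4

end CliffordAction

/-! ### Transfer from the spinor-form model to the bundles -/

/-- Polarization: the identification preserves norms, and the real part of a Hermitian product is
determined by the norm. -/
theorem real_inner_eq_re_inner_map {V U : Type*} [NormedAddCommGroup V] [InnerProductSpace ℝ V]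
    [NormedAddCommGroup U] [InnerProductSpace ℂ U] [Module ℝ U] (f : V ≃ₗᵢ[ℝ] U) (e e' : V) :
    ⟪e, e'⟫_ℝ = (⟪f e, f e'⟫_ℂ).re := by
  refine (re_inner_eq_norm_add_mul_self_sub_norm_sub_mul_self_div_four (𝕜 := ℝ) _ _).trans ?_
  rw [← f.norm_map (e + e'), ← f.norm_map (e - e'), f.map_add, f.map_sub]
  exact (re_inner_eq_norm_add_mul_self_sub_norm_sub_mul_self_div_four (𝕜 := ℂ) _ _).symm

section Involutions

variable {n : ℕ} {M : Type*} [TopologicalSpace M] [ChartedSpace (EuclideanSpace ℝ (Fin n)) M]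
  {FE : Type*} [NormedAddCommGroup FE] [NormedSpace ℝ FE]
  {E : M → Type*} [TopologicalSpace (TotalSpace FE E)]
  [∀ x, NormedAddCommGroup (E x)] [∀ x, InnerProductSpace ℝ (E x)]
  [FiberBundle FE E] [VectorBundle ℝ FE E]
  {U : M → Type*} [∀ x, NormedAddCommGroup (U x)] [∀ x, InnerProductSpace ℂ (U x)]
  [∀ x, Module ℝ (U x)]

/-- The algebraic identities are fibrewise, so the identifications may vary discontinuously;
smoothness is supplied for τ itself. -/
theorem isMetricInvolution_of_conj {τ : ∀ x : M, E x →L[ℝ] E x} (hτ : IsSmoothHom n FE FE τ)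
    (f : ∀ x, E x ≃ₗᵢ[ℝ] U x) {t : ∀ x, U x → U x} (h : ∀ x e, f x (τ x e) = t x (f x e))
    (ht : ∀ x w, t x (t x w) = w) (hi : ∀ x w w', ⟪t x w, t x w'⟫_ℂ = ⟪w, w'⟫_ℂ) :
    IsMetricInvolution n FE τ where
  smooth := hτ
  involutive x e := (f x).injective (by rw [h, h, ht])
  isometry x e e' := by
    rw [real_inner_eq_re_inner_map (f x), real_inner_eq_re_inner_map (f x), h, h, hi]

end Involutions

namespace SpinorFormBundle

variable {n : ℕ} {M : Type*} [TopologicalSpace M] [ChartedSpace (EuclideanSpace ℝ (Fin n)) M]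
  [RiemannianBundle (fun x : M => TangentSpace (𝓡 n) x)]
  {E F : M → Type*}
  [∀ x, NormedAddCommGroup (E x)] [∀ x, InnerProductSpace ℝ (E x)]
  [∀ x, NormedAddCommGroup (F x)] [∀ x, InnerProductSpace ℝ (F x)]
  {σ : ∀ x : M, Cotangent n x → (E x →L[ℝ] F x)} {A : ∀ x : M, E x →L[ℝ] F x}
  {W : M → Type*} [∀ x, NormedAddCommGroup (W x)] [∀ x, InnerProductSpace ℂ (W x)]
  [∀ x, FiniteDimensional ℂ (W x)] {m : ℕ}
  {τ T : ∀ x : M, E x →L[ℝ] E x} {τ' T' : ∀ x : M, F x →L[ℝ] F x}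

theorem inner_symbol_perturbation_symm (S : SpinorFormBundle E F σ A W) (x : M) (u : Cotangent n x) (e e' : E x) :
    ⟪σ x u e, A x e'⟫_ℝ = ⟪σ x u e', A x e⟫_ℝ := by
  rw [real_inner_eq_re_inner_map (S.isoF x), real_inner_eq_re_inner_map (S.isoF x), S.symbol_eq,
    S.symbol_eq, S.perturbation_eq, S.perturbation_eq]
  exact (S.action x).re_inner_pairSymbol_pairPerturbation_symm _ _ _ _

variable (S : SpinorFormBundle E F σ A W)

theorem symbol_parity (hn : n = 2 * m)
    (hτ : ∀ x e, S.isoE x (τ x e) = (S.action x).pairParity m (S.isoE x e))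
    (hτ' : ∀ x e, S.isoF x (τ' x e) = (S.action x).pairParity m (S.isoF x e))
    (x : M) (u : Cotangent n x) (e : E x) : σ x u (τ x e) = -τ' x (σ x u e) := by
  refine (S.isoF x).injective ?_
  rw [map_neg, S.symbol_eq, hτ, hτ', S.symbol_eq, (S.action x).pairSymbol_pairParity hn]

theorem perturbation_parity (hn : n = 2 * m)
    (hψ : ∀ x, (S.action x).chirality m (S.spinor x) = S.spinor x)
    (hτ : ∀ x e, S.isoE x (τ x e) = (S.action x).pairParity m (S.isoE x e))
    (hτ' : ∀ x e, S.isoF x (τ' x e) = (S.action x).pairParity m (S.isoF x e))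
    (x : M) (e : E x) : A x (τ x e) = -τ' x (A x e) := by
  refine (S.isoF x).injective ?_
  rw [map_neg, S.perturbation_eq, hτ, hτ', S.perturbation_eq,
    (S.action x).pairPerturbation_pairParity hn (hψ x)]

theorem perturbation_mem_eigenbundle (hn : n = 2 * m)
    (hψ : ∀ x, (S.action x).chirality m (S.spinor x) = S.spinor x)
    (hτ : ∀ x e, S.isoE x (τ x e) = (S.action x).pairParity m (S.isoE x e))
    (hτ' : ∀ x e, S.isoF x (τ' x e) = (S.action x).pairParity m (S.isoF x e))
    (x : M) {e : E x} (he : e ∈ eigenbundle τ 1 x) : A x e ∈ eigenbundle τ' (-1) x := by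
  rw [mem_eigenbundle, one_smul] at he
  have h := S.perturbation_parity hn hψ hτ hτ' x e
  rw [he] at h
  rw [mem_eigenbundle, neg_smul, one_smul]
  exact (neg_eq_iff_eq_neg.2 h).symm

theorem inner_selfDuality_symbol_perturbation_symm (hn : n = 2 * m) (hm : Even m)
    (hψ : ∀ x, (S.action x).chirality m (S.spinor x) = S.spinor x)
    (hτ : ∀ x e, S.isoE x (τ x e) = (S.action x).pairParity m (S.isoE x e))
    (hT : ∀ x e, S.isoE x (T x e) = pairSelfDuality m (S.isoE x e))
    (hT' : ∀ x e, S.isoF x (T' x e) = pairSelfDuality m (S.isoF x e))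
    (x : M) (u : Cotangent n x) {e e' : E x} (he : e ∈ eigenbundle τ 1 x ⊓ eigenbundle T 1 x)
    (he' : e' ∈ eigenbundle τ 1 x ⊓ eigenbundle T 1 x) :
    ⟪T' x (σ x u e), A x e'⟫_ℝ = ⟪T' x (σ x u e'), A x e⟫_ℝ := by
  -- On E⁺⁺ the involution T' is invisible to the pairing, so its symmetry is that of the full pair.
  have key : ∀ e ∈ eigenbundle τ 1 x ⊓ eigenbundle T 1 x, ∀ e',
      ⟪T' x (σ x u e), A x e'⟫_ℝ = ⟪σ x u e, A x e'⟫_ℝ := by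
    rintro e ⟨h1, h2⟩ e'
    rw [SetLike.mem_coe, mem_eigenbundle, one_smul] at h1 h2
    have h3 := hτ x e
    have h4 := hT x e
    rw [h1] at h3
    rw [h2] at h4
    rw [real_inner_eq_re_inner_map (S.isoF x), real_inner_eq_re_inner_map (S.isoF x), hT',
      S.symbol_eq, S.perturbation_eq,
      (S.action x).inner_pairSelfDuality_pairSymbol hn hm (hψ x) _ h3.symm h4.symm]
  rw [key e he, key e' he', S.inner_symbol_perturbation_symm]

end SpinorFormBundle

end

/-! ### The three restrictions -/

theorem mainTheorem10
    -- a closed Riemannian manifold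
    {n : ℕ} {M : Type*} [EMetricSpace M] [CompactSpace M] [MeasurableSpace M] [BorelSpace M]
    [ChartedSpace (EuclideanSpace ℝ (Fin n)) M] [IsManifold (𝓡 n) ∞ M]
    [RiemannianBundle (fun x : M => TangentSpace (𝓡 n) x)]
    [IsContMDiffRiemannianBundle (𝓡 n) ∞ (EuclideanSpace ℝ (Fin n))
      (fun x : M => TangentSpace (𝓡 n) x)]
    [IsRiemannianManifold (𝓡 n) M]
    -- real vector bundles with metrics
    {FE : Type*} [NormedAddCommGroup FE] [NormedSpace ℝ FE] [FiniteDimensional ℝ FE]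
    {E : M → Type*} [TopologicalSpace (TotalSpace FE E)]
    [∀ x, NormedAddCommGroup (E x)] [∀ x, InnerProductSpace ℝ (E x)]
    [∀ x, FiniteDimensional ℝ (E x)]
    [FiberBundle FE E] [VectorBundle ℝ FE E] [ContMDiffVectorBundle ∞ FE E (𝓡 n)]
    [IsContMDiffRiemannianBundle (𝓡 n) ∞ FE E]
    {FF : Type*} [NormedAddCommGroup FF] [NormedSpace ℝ FF] [FiniteDimensional ℝ FF]
    {F : M → Type*} [TopologicalSpace (TotalSpace FF F)]
    [∀ x, NormedAddCommGroup (F x)] [∀ x, InnerProductSpace ℝ (F x)]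
    [∀ x, FiniteDimensional ℝ (F x)]
    [FiberBundle FF F] [VectorBundle ℝ FF F] [ContMDiffVectorBundle ∞ FF F (𝓡 n)]
    [IsContMDiffRiemannianBundle (𝓡 n) ∞ FF F]
    -- connections, the symbol `σ` of the Dirac operator `D = σ ∘ ∇`, and a bundle map `A`
    (nablaE : CovariantDerivative (𝓡 n) FE E) [CovariantDerivative.ContMDiffCovariantDerivative nablaE ∞]
    (nablaF : CovariantDerivative (𝓡 n) FF F) [CovariantDerivative.ContMDiffCovariantDerivative nablaF ∞]
    (σ : ∀ x : M, Cotangent n x →L[ℝ] (E x →L[ℝ] F x)) (hσ : IsSmoothSymbol FE FF σ)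
    (A : ∀ x : M, E x →L[ℝ] F x) (hA : IsSmoothHom n FE FF A) :
    -- the restriction of a concentrating pair by an involution `T = diag(τ, τ')`
    (∀ (ε : ℝ) (τ : ∀ x : M, E x →L[ℝ] E x) (τ' : ∀ x : M, F x →L[ℝ] F x),
      (ε = 1 ∨ ε = -1) →
      IsMetricInvolution n FE τ → IsMetricInvolution n FF τ' →
      IsParallel nablaE τ → IsParallel nablaF τ' →
      (∀ x u e, σ x u (τ x e) = ε • τ' x (σ x u e)) →
      IsConcentratingPair (n := n) (fun x u => (σ x u : E x →ₗ[ℝ] F x))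
        (fun x => (A x : E x →ₗ[ℝ] F x)) →
      (∀ ξ ∈ sectionsIn n FE (eigenbundle τ 1),
        diracOp nablaE σ (eigenproj τ 1) ξ =
          diracOp nablaE σ (fun x => ContinuousLinearMap.id ℝ (E x)) ξ) ∧
      (∀ x u, Function.Bijective (σ x u) →
        Set.BijOn (σ x u) (eigenbundle τ 1 x) (eigenbundle τ' ε x)) ∧
      IsConcentratingRestriction FE FF (eigenbundle τ 1) (eigenbundle τ' ε)
        (diracOp nablaE σ (eigenproj τ 1)) (fun x u => σ x u)
        (fun x => eigenproj τ' ε x ∘L A x)) ∧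
    -- the parity reduction of spinor-form pairs, in dimension `2m`
    (∀ (m : ℕ) (W : M → Type*) [∀ x, NormedAddCommGroup (W x)] [∀ x, InnerProductSpace ℂ (W x)]
      [∀ x, FiniteDimensional ℂ (W x)]
      (S : SpinorFormBundle E F (fun x u => σ x u) A W)
      (τ : ∀ x : M, E x →L[ℝ] E x) (τ' : ∀ x : M, F x →L[ℝ] F x),
      n = 2 * m →
      (∀ x, (S.action x).chirality m (S.spinor x) = S.spinor x) →
      IsSmoothHom n FE FE τ → IsSmoothHom n FF FF τ' →
      (∀ x e, S.isoE x (τ x e) = (S.action x).pairParity m (S.isoE x e)) →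
      (∀ x e, S.isoF x (τ' x e) = (S.action x).pairParity m (S.isoF x e)) →
      IsMetricInvolution n FE τ ∧ IsMetricInvolution n FF τ' ∧
      (∀ x u e, σ x u (τ x e) = -τ' x (σ x u e)) ∧
      (∀ x, ∀ e ∈ eigenbundle τ 1 x, A x e ∈ eigenbundle τ' (-1) x) ∧
      IsConcentratingRestriction FE FF (eigenbundle τ 1) (eigenbundle τ' (-1))
        (diracOp nablaE σ (eigenproj τ 1)) (fun x u => σ x u)
        (fun x => eigenproj τ' (-1) x ∘L A x)) ∧
    -- the self-duality reduction of spinor-form pairs, in dimension `4m`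
    (∀ (m : ℕ) (W : M → Type*) [∀ x, NormedAddCommGroup (W x)] [∀ x, InnerProductSpace ℂ (W x)]
      [∀ x, FiniteDimensional ℂ (W x)]
      (S : SpinorFormBundle E F (fun x u => σ x u) A W)
      (τ T : ∀ x : M, E x →L[ℝ] E x) (τ' T' : ∀ x : M, F x →L[ℝ] F x),
      n = 4 * m →
      (∀ x, (S.action x).chirality (2 * m) (S.spinor x) = S.spinor x) →
      IsSmoothHom n FE FE τ → IsSmoothHom n FF FF τ' →
      IsSmoothHom n FE FE T → IsSmoothHom n FF FF T' →
      (∀ x e, S.isoE x (τ x e) = (S.action x).pairParity (2 * m) (S.isoE x e)) →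
      (∀ x e, S.isoF x (τ' x e) = (S.action x).pairParity (2 * m) (S.isoF x e)) →
      (∀ x e, S.isoE x (T x e) = pairSelfDuality (2 * m) (S.isoE x e)) →
      (∀ x e, S.isoF x (T' x e) = pairSelfDuality (2 * m) (S.isoF x e)) →
      IsMetricInvolution n FE T ∧ IsMetricInvolution n FF T' ∧
      IsConcentratingRestriction FE FF
        (fun x => eigenbundle τ 1 x ⊓ eigenbundle T 1 x)
        (fun x => eigenbundle τ' (-1) x ⊓ eigenbundle T' 1 x)
        (fun ξ x => eigenproj T' 1 x
          (diracOp nablaE σ (fun x => eigenproj T 1 x ∘L eigenproj τ 1 x) ξ x))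
        (fun x u => eigenproj T' 1 x ∘L σ x u)
        (fun x => eigenproj T' 1 x ∘L eigenproj τ' (-1) x ∘L A x)) := by
  refine ⟨fun ε τ τ' hε hτ hτ' hτp _ hστ hpair => ⟨fun ξ hξ => diracOp_eigenproj hτp hξ,
    fun x u hu => bijOn_eigenbundle hε hστ hu,
    isConcentratingRestriction_eigenbundle hσ hA hε hτ hτ' hστ (isConcentratingPair_iff.1 hpair)⟩,
    ?_, ?_⟩
  · intro m W _ _ _ S τ τ' hn hψ hτs hτs' hτ hτ'
    have iτ : IsMetricInvolution n FE τ := isMetricInvolution_of_conj hτs S.isoE hτ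
      (fun x => (S.action x).pairParity_pairParity hn) fun x => (S.action x).inner_pairParity
    have iτ' : IsMetricInvolution n FF τ' := isMetricInvolution_of_conj hτs' S.isoF hτ'
      (fun x => (S.action x).pairParity_pairParity hn) fun x => (S.action x).inner_pairParity
    have hστ := S.symbol_parity hn hτ hτ'
    refine ⟨iτ, iτ', hστ, fun x e he => S.perturbation_mem_eigenbundle hn hψ hτ hτ' x he,
      isConcentratingRestriction_eigenbundle hσ hA (Or.inr rfl) iτ iτ' (fun x u e => ?_)
        S.inner_symbol_perturbation_symm⟩
    rw [hστ, neg_one_smul]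
  · intro m W _ _ _ S τ T τ' T' hn hψ hτs hτs' hTs hTs' hτ hτ' hT hT'
    -- The half dimension is 2m, and its evenness is used twice: for ⋆² = 1 in the middle degree and
    -- to keep odd forms out of that degree.
    have hn' : n = 2 * (2 * m) := by omega
    have hm : Even (2 * m) := even_two_mul m
    have iτ : IsMetricInvolution n FE τ := isMetricInvolution_of_conj hτs S.isoE hτ
      (fun x => (S.action x).pairParity_pairParity hn') fun x => (S.action x).inner_pairParity
    have iτ' : IsMetricInvolution n FF τ' := isMetricInvolution_of_conj hτs' S.isoF hτ'
      (fun x => (S.action x).pairParity_pairParity hn') fun x => (S.action x).inner_pairParity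
    have iT : IsMetricInvolution n FE T := isMetricInvolution_of_conj hTs S.isoE hT
      (fun x => CliffordAction.pairSelfDuality_pairSelfDuality hn' hm)
      fun x => CliffordAction.inner_pairSelfDuality hn'
    have iT' : IsMetricInvolution n FF T' := isMetricInvolution_of_conj hTs' S.isoF hT'
      (fun x => CliffordAction.pairSelfDuality_pairSelfDuality hn' hm)
      fun x => CliffordAction.inner_pairSelfDuality hn'
    refine ⟨iT, iT', isConcentratingRestriction_inf_eigenbundle hσ hA iτ iτ' iT iT'
      (fun x e => (S.isoE x).injective ?_) (fun x e => (S.isoF x).injective ?_)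
      (S.symbol_parity hn' hτ hτ')
      (fun x e he => S.perturbation_mem_eigenbundle hn' hψ hτ hτ' x he)
      S.inner_symbol_perturbation_symm
      fun x u e he e' he' =>
        S.inner_selfDuality_symbol_perturbation_symm hn' hm hψ hτ hT hT' x u he he'⟩
    · rw [hτ, hT, hT, hτ, (S.action x).pairParity_pairSelfDuality hn']
    · rw [hτ', hT', hT', hτ', (S.action x).pairParity_pairSelfDuality hn']
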